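/- Semi-random planted independent set model. Let $V=\{1,\dots,n\}$ and let $S\subseteq V$ be any set with $|S|=k$. A random set $E'$ of edges between $S$ and $V\setminus S$ is drawn by taking each pair in $S\times(V\setminus S)$ independently with probability $1/2$. Then an adversary, who sees $E'$, adds arbitrary edges outside $S\times S$; the result is a graph $G=(V,E)$ with $E\supseteq E'$ in which $S$ is independent. The crude semidefinite program (C-SDP) of $G$ is: minimize $\sum_{u,v\in V}\|x_u-x_v\|^2$ over vectors $x_u\in\mathbb{R}^n$ $(u\in V)$ subject to $\|x_u\|=1$ for all $u$, $\langle x_u,x_v\rangle\ge 0$ for all $u,v$, and $\langle x_u,x_v\rangle=0$ for every edge $uv$ of $G$. The candidate sets of a solution $x$ are the $n$ sets, one for each vertex $u$, obtained from $\{v:\|x_v-x_u\|<1\}$ by running through the vertices in some order and adding every vertex that has no neighbour in the set built so far. Theorem. The C-SDP of every graph has an optimal solution. There are a constant $c_1>0$, two deterministic polynomial-time algorithms $\mathcal{A}$ and $\mathcal{B}$, which receive only the graph $G$, and a sequence $\delta_n\to 0$ such that the following holds. On every graph with $n$ vertices, $\mathcal{A}$ returns a list of at most $n$ independent sets and $\mathcal{B}$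 returns one independent set. For all $n$, all $k\ge c_1n^{2/3}$ and all $S$ with $|S|=k$, with probability at least $1-\delta_n$ over $E'$, every graph $G$ that the adversary may produce satisfies: 1. $S$ is one of the sets returned by $\mathcal{A}$; 2. the independent set returned by $\mathcal{B}$ has size at least $k$; 3. for every optimal solution of the C-SDP of $G$, and every order of the vertices in the greedy step, $S$ is one of the $n$ candidate sets. -/

import Mathlib

namespace PlantedIndepSet

/-! ### Deterministic algorithms on graphs: an integer RAM with logarithmic cost -/

/-- Memory of the machine: integer registers `reg r`, and integer arrays, `mem b i` being the cell
of array `b` at address `i`. -/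
structure State where
  reg : ℕ → ℤ
  mem : ℕ → ℤ → ℤ

/-- Contents `z` is put into register `r`. -/
def State.setReg (s : State) (r : ℕ) (z : ℤ) : State :=
  { s with reg := Function.update s.reg r z }

/-- Contents `z` is put into cell `i` of array `b`. -/
def State.setMem (s : State) (b : ℕ) (i z : ℤ) : State :=
  { s with mem := Function.update s.mem b (Function.update (s.mem b) i z) }

/-- The four arithmetic operations (integer division, with value `0` for the divisor `0`). -/
inductive Op
  | add
  | sub
  | mul
  | div

/-- The value of an arithmetic operation. -/
def Op.eval : Op → ℤ → ℤ → ℤ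
  | .add, a, b => a + b
  | .sub, a, b => a - b
  | .mul, a, b => a * b
  | .div, a, b => a / b

/-- Structured RAM programs. A program mentions finitely many registers and arrays; the cells of
an array are addressed indirectly, through the contents of a register. -/
inductive Prog
  /-- do nothing -/
  | skip
  /-- `reg r := c` -/
  | const (r : ℕ) (c : ℤ)
  /-- `reg r := reg a ∘ reg b` -/
  | arith (o : Op) (r a b : ℕ)
  /-- `reg r := mem b (reg a)` -/
  | load (r b a : ℕ)
  /-- `mem b (reg a) := reg r` -/
  | store (b a r : ℕ)
  /-- `p; q` -/
  | seq (p q : Prog)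
  /-- `if reg r > 0 then p else q` -/
  | ite (r : ℕ) (p q : Prog)
  /-- `while reg r > 0 do p` -/
  | loop (r : ℕ) (p : Prog)

/-- Number of binary digits of an integer. -/
def bits (z : ℤ) : ℕ := Nat.size z.natAbs

/-- `Exec p s s' t`: the program `p`, started in state `s`, halts in state `s'`, in time `t`. Each
elementary instruction and each test costs one plus the binary lengths of the integers it reads. -/
inductive Exec : Prog → State → State → ℕ → Prop
  | skip (s : State) : Exec .skip s s 1
  | const (r : ℕ) (c : ℤ) (s : State) : Exec (.const r c) s (s.setReg r c) (1 + bits c)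
  | arith (o : Op) (r a b : ℕ) (s : State) :
      Exec (.arith o r a b) s (s.setReg r (o.eval (s.reg a) (s.reg b)))
        (1 + bits (s.reg a) + bits (s.reg b))
  | load (r b a : ℕ) (s : State) :
      Exec (.load r b a) s (s.setReg r (s.mem b (s.reg a)))
        (1 + bits (s.reg a) + bits (s.mem b (s.reg a)))
  | store (b a r : ℕ) (s : State) :
      Exec (.store b a r) s (s.setMem b (s.reg a) (s.reg r))
        (1 + bits (s.reg a) + bits (s.reg r))
  | seq {p q : Prog} {s s' s'' : State} {t t' : ℕ} :
      Exec p s s' t → Exec q s' s'' t' → Exec (.seq p q) s s'' (t + t')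
  | ite_true {r : ℕ} {p q : Prog} {s s' : State} {t : ℕ} :
      0 < s.reg r → Exec p s s' t → Exec (.ite r p q) s s' (1 + bits (s.reg r) + t)
  | ite_false {r : ℕ} {p q : Prog} {s s' : State} {t : ℕ} :
      s.reg r ≤ 0 → Exec q s s' t → Exec (.ite r p q) s s' (1 + bits (s.reg r) + t)
  | loop_done {r : ℕ} {p : Prog} {s : State} :
      s.reg r ≤ 0 → Exec (.loop r p) s s (1 + bits (s.reg r))
  | loop_step {r : ℕ} {p : Prog} {s s' s'' : State} {t t' : ℕ} :
      0 < s.reg r → Exec p s s' t → Exec (.loop r p) s' s'' t' →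
        Exec (.loop r p) s s'' (1 + bits (s.reg r) + t + t')

/-- The machine is deterministic: final state and running time are functions of the initial
state. -/
theorem Exec.deterministic {p : Prog} {s s₁ s₂ : State} {t₁ t₂ : ℕ}
    (h₁ : Exec p s s₁ t₁) (h₂ : Exec p s s₂ t₂) : s₁ = s₂ ∧ t₁ = t₂ := by
  induction h₁ generalizing s₂ t₂ with
  | skip | const | arith | load | store => cases h₂; exact ⟨rfl, rfl⟩
  | seq _ _ ih ih' =>
    cases h₂ with
    | seq h h' =>
      obtain ⟨rfl, rfl⟩ := ih h
      obtain ⟨rfl, rfl⟩ := ih' h'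
      exact ⟨rfl, rfl⟩
  | ite_true hr _ ih =>
    cases h₂ with
    | ite_true _ h =>
      obtain ⟨rfl, rfl⟩ := ih h
      exact ⟨rfl, rfl⟩
    | ite_false hr' _ => omega
  | ite_false hr _ ih =>
    cases h₂ with
    | ite_true hr' _ => omega
    | ite_false _ h =>
      obtain ⟨rfl, rfl⟩ := ih h
      exact ⟨rfl, rfl⟩
  | loop_done hr =>
    cases h₂ with
    | loop_done _ => exact ⟨rfl, rfl⟩
    | loop_step hr' _ _ => omega
  | loop_step hr _ _ ih ih' =>
    cases h₂ with
    | loop_done hr' => omega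
    | loop_step _ h h' =>
      obtain ⟨rfl, rfl⟩ := ih h
      obtain ⟨rfl, rfl⟩ := ih' h'
      exact ⟨rfl, rfl⟩

open Classical in
/-- The input: `n` in register `0`, the adjacency matrix of the graph, row by row, in array `0`,
and zeros everywhere else. -/
noncomputable def inputState {n : ℕ} (G : SimpleGraph (Fin n)) : State where
  reg := fun r => if r = 0 then (n : ℤ) else 0
  mem := fun b i =>
    if b = 0 ∧ ∃ u v : Fin n, i = (u : ℤ) * (n : ℤ) + (v : ℤ) ∧ G.Adj u v then 1 else 0

/-- The output is the list `L` of vertex sets: its length is in register `0`, and the 0-1 indicator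
vectors of its members, one after the other, are in array `1`. -/
def Outputs {n : ℕ} (s : State) (L : List (Finset (Fin n))) : Prop :=
  s.reg 0 = (L.length : ℤ) ∧
    ∀ (i : Fin L.length) (v : Fin n),
      s.mem 1 ((i : ℤ) * (n : ℤ) + (v : ℤ)) = if v ∈ L.get i then 1 else 0

/-- The map `f`, taking a graph on `n` vertices to a list of vertex sets, is computed by one
deterministic program whose running time is at most a polynomial in `n`. -/
def PolyTimeComputable (f : (n : ℕ) → SimpleGraph (Fin n) → List (Finset (Fin n))) : Prop :=
  ∃ (p : Prog) (q : Polynomial ℕ), ∀ (n : ℕ) (G : SimpleGraph (Fin n)),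
    ∃ (s : State) (t : ℕ), Exec p (inputState G) s t ∧ t ≤ q.eval n ∧ Outputs s (f n G)

/-! ### The semi-random model -/

/-- The law of the random set `E'` of edges between `S` and its complement: each pair in `S × Sᶜ`
is taken independently with probability `1/2`, and no other pair is ever taken. -/
noncomputable def boundaryLaw {n : ℕ} (S : Finset (Fin n)) :
    MeasureTheory.Measure (Set (Fin n × Fin n)) :=
  ProbabilityTheory.setBernoulli ((S : Set (Fin n)) ×ˢ (S : Set (Fin n))ᶜ)
    ⟨1 / 2, by norm_num, by norm_num⟩

/-- The (undirected) graph whose edges are the pairs in `E`. -/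
def graphOf {n : ℕ} (E : Set (Fin n × Fin n)) : SimpleGraph (Fin n) :=
  SimpleGraph.fromRel fun u v => (u, v) ∈ E

/-- `G` is a graph that the adversary may produce from the random edges `E`: edges may be added,
but not removed, and none may be added inside `S`. -/
def Admissible {n : ℕ} (S : Finset (Fin n)) (E : Set (Fin n × Fin n))
    (G : SimpleGraph (Fin n)) : Prop :=
  graphOf E ≤ G ∧ G.IsIndepSet (S : Set (Fin n))

/-! ### The crude semidefinite program and its candidate sets -/

/-- Feasible solutions of the crude semidefinite program of `G`. -/
structure IsFeasible {n : ℕ} (G : SimpleGraph (Fin n))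
    (x : Fin n → EuclideanSpace ℝ (Fin n)) : Prop where
  norm_eq_one : ∀ u, ‖x u‖ = 1
  inner_nonneg : ∀ u v, 0 ≤ inner ℝ (x u) (x v)
  inner_eq_zero : ∀ u v, G.Adj u v → inner ℝ (x u) (x v) = 0

/-- The objective of the crude semidefinite program, to be minimized. -/
noncomputable def cost {n : ℕ} (x : Fin n → EuclideanSpace ℝ (Fin n)) : ℝ :=
  ∑ u, ∑ v, ‖x u - x v‖ ^ 2

/-- Optimal solutions of the crude semidefinite program of `G`. -/
def IsOptimal {n : ℕ} (G : SimpleGraph (Fin n)) (x : Fin n → EuclideanSpace ℝ (Fin n)) : Prop :=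
  IsFeasible G x ∧ ∀ y, IsFeasible G y → cost x ≤ cost y

open Classical in
/-- The vertices whose vectors are at distance less than `1` from that of `u`. -/
noncomputable def unitBall {n : ℕ} (x : Fin n → EuclideanSpace ℝ (Fin n)) (u : Fin n) :
    Finset (Fin n) :=
  Finset.univ.filter fun v => ‖x v - x u‖ < 1

open Classical in
/-- The vertices of the list `l` are visited in turn, and each is added to the set if it has no
neighbour in the set built so far, which is `A` at the beginning. -/
noncomputable def greedyExtend {n : ℕ} (G : SimpleGraph (Fin n)) (l : List (Fin n))
    (A : Finset (Fin n)) : Finset (Fin n) :=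
  l.foldl (fun B v => if ∀ w ∈ B, ¬ G.Adj w v then insert v B else B) A

/-- The `n` candidate sets of the solution `x`, one for each vertex: the greedy extensions of the
unit balls. -/
noncomputable def candidates {n : ℕ} (G : SimpleGraph (Fin n)) (l : List (Fin n))
    (x : Fin n → EuclideanSpace ℝ (Fin n)) : List (Finset (Fin n)) :=
  (List.finRange n).map fun u => greedyExtend G l (unitBall x u)

end PlantedIndepSet

/-!
With high probability every vertex outside `S` has many neighbours in `S` among the random edges
(a union bound), and the signed boundary matrix, with entry `-1` on these edges and `1` on the other
boundary pairs, has norm `O(√n)` (an exponential moment bound over a net of lattice points). On this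
event, compare an optimal solution with the one in which the vectors of `S` are merged into a single
unit vector orthogonal to all others: the vectors of `S` must be clustered, so that the unit ball
around a suitable `u ∈ S` contains only vertices of `S`, and enough of them for every vertex outside
`S` to see one. Greedy extension of such a set gives `S`.

The same argument tolerates a small error in the objective and in the constraints. The algorithms
therefore replace the optimum by an approximate one: Frank–Wolfe iteration on a penalized program
over positive semidefinite matrices, where a high power of the integer gradient matrix serves as
linear minimization oracle. Everything is then exact integer arithmetic on numbers of polynomial
length.
-/

namespace PlantedIndepSet

/-! ### Hoare-style reasoning about RAM programs -/

@[simp] theorem State.setReg_mem (s : State) (r : ℕ) (z : ℤ) : (s.setReg r z).mem = s.mem := rfl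

@[simp] theorem State.setReg_reg (s : State) (r : ℕ) (z : ℤ) :
    (s.setReg r z).reg = Function.update s.reg r z := rfl

@[simp] theorem State.setMem_mem (s : State) (b : ℕ) (i z : ℤ) :
    (s.setMem b i z).mem = Function.update s.mem b (Function.update (s.mem b) i z) := rfl

@[simp] theorem bits_zero : bits 0 = 0 := rfl

@[simp] theorem bits_one : bits 1 = 1 := rfl

theorem bits_le_of_abs_le_two_pow {z : ℤ} {k : ℕ} (h : |z| ≤ 2 ^ k) : bits z ≤ k + 1 := by
  have hz : z.natAbs ≤ 2 ^ k := by zify; exact h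
  exact Nat.size_le.2 (hz.trans_lt (Nat.pow_lt_pow_right one_lt_two k.lt_succ_self))

theorem abs_le_two_pow_bits (z : ℤ) : |z| ≤ 2 ^ bits z := by
  rw [← Int.natCast_natAbs]
  exact_mod_cast (Nat.lt_size_self z.natAbs).le

theorem bits_natCast_mono {a b : ℕ} (h : a ≤ b) : bits a ≤ bits b := Nat.size_le_size h

namespace Prog

/-- The program `p`, started in `s`, halts in `s'` within time `T`. -/
def HaltsWithin (p : Prog) (s s' : State) (T : ℕ) : Prop := ∃ t ≤ T, Exec p s s' t

/-- `reg r := reg a`, by way of the scratch register `z`. -/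
def move (r a z : ℕ) : Prog := .seq (.const z 0) (.arith .add r a z)

/-- Saves `reg x` in register `d + 1`, copies `reg y` to register `d`, and puts `reg x := 0`. -/
def enterLoop (x y d : ℕ) : Prog :=
  .seq (.move (d + 1) x (d + 2)) (.seq (.move d y (d + 2)) (.const x 0))

/-- `reg x := reg x + 1; reg d := reg d - 1`. -/
def tick (x d : ℕ) : Prog :=
  .seq (.const (d + 2) 1) (.seq (.arith .add x x (d + 2)) (.arith .sub d d (d + 2)))

/-- `for reg x := 0, …, reg y - 1 do p`. The register `d` counts the remaining rounds, `d + 1`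
keeps the old content of `x`, which is restored in the end, and `d + 2` is scratch space. -/
def forLoop (x y d : ℕ) (p : Prog) : Prog :=
  .seq (.enterLoop x y d) (.seq (.loop d (.seq p (.tick x d))) (.move x (d + 1) (d + 2)))

namespace HaltsWithin

variable {p q : Prog} {s s' s'' : State} {T T' : ℕ}

theorem of_exec {t : ℕ} (h : Exec p s s' t) (ht : t ≤ T) : p.HaltsWithin s s' T := ⟨t, ht, h⟩

theorem mono (h : p.HaltsWithin s s' T) (hT : T ≤ T') : p.HaltsWithin s s' T' :=
  let ⟨t, ht, hp⟩ := h
  ⟨t, ht.trans hT, hp⟩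

theorem seq (hp : p.HaltsWithin s s' T) (hq : q.HaltsWithin s' s'' T') :
    (Prog.seq p q).HaltsWithin s s'' (T + T') :=
  let ⟨_, ht, hp⟩ := hp
  let ⟨_, ht', hq⟩ := hq
  ⟨_, Nat.add_le_add ht ht', hp.seq hq⟩

theorem const (r : ℕ) (c : ℤ) (s : State) :
    (Prog.const r c).HaltsWithin s (s.setReg r c) (1 + bits c) :=
  of_exec (.const r c s) le_rfl

theorem arith (o : Op) (r : ℕ) {a b κ κ' : ℕ} (ha : bits (s.reg a) ≤ κ)
    (hb : bits (s.reg b) ≤ κ') :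
    (Prog.arith o r a b).HaltsWithin s (s.setReg r (o.eval (s.reg a) (s.reg b)))
      (1 + κ + κ') :=
  of_exec (.arith o r a b s) (by omega)

theorem move (r : ℕ) {a z κ : ℕ} (haz : a ≠ z) (ha : bits (s.reg a) ≤ κ) :
    (Prog.move r a z).HaltsWithin s ((s.setReg z 0).setReg r (s.reg a)) (2 + κ) := by
  have key := (const z 0 s).seq (arith .add r (s := s.setReg z 0) (a := a) (b := z) (κ := κ)
    (κ' := 0) (by simpa [haz] using ha) (by simp))
  simp only [State.setReg_reg, Function.update_of_ne haz, Function.update_self, Op.eval,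
    add_zero] at key
  exact key.mono (by rw [bits_zero]; omega)

theorem ite_pos {r κ : ℕ} (hr : 0 < s.reg r) (hκ : bits (s.reg r) ≤ κ)
    (hp : p.HaltsWithin s s' T) : (Prog.ite r p q).HaltsWithin s s' (1 + κ + T) :=
  let ⟨_, ht, hp⟩ := hp
  of_exec (.ite_true hr hp) (by omega)

theorem ite_nonpos {r κ : ℕ} (hr : s.reg r ≤ 0) (hκ : bits (s.reg r) ≤ κ)
    (hq : q.HaltsWithin s s' T) : (Prog.ite r p q).HaltsWithin s s' (1 + κ + T) :=
  let ⟨_, ht, hq⟩ := hq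
  of_exec (.ite_false hr hq) (by omega)

/-- `I j` is the invariant when `j` rounds remain. -/
theorem loop {r m τ κ : ℕ} {I : ℕ → State → Prop} (hκ : bits m ≤ κ)
    (hr : ∀ j s, I j s → s.reg r = j)
    (hp : ∀ j < m, ∀ s, I (j + 1) s → ∃ s', p.HaltsWithin s s' τ ∧ I j s') (hs : I m s) :
    ∃ s', (Prog.loop r p).HaltsWithin s s' (m * (τ + 1 + κ) + (1 + κ)) ∧ I 0 s' := by
  induction m generalizing s with
  | zero =>
    have h0 : s.reg r = 0 := hr 0 s hs
    exact ⟨s, of_exec (.loop_done h0.le) (by rw [h0, bits_zero]; omega), hs⟩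
  | succ m ih =>
    have hm : s.reg r = (m + 1 : ℕ) := hr _ s hs
    obtain ⟨s₁, ⟨t₁, ht₁, h₁⟩, hI₁⟩ := hp m m.lt_succ_self s hs
    obtain ⟨s₂, ⟨t₂, ht₂, h₂⟩, hI₂⟩ := ih ((bits_natCast_mono m.le_succ).trans hκ)
      (fun j hj => hp j (hj.trans m.lt_succ_self)) hI₁
    refine ⟨s₂, of_exec (.loop_step (by omega) h₁ h₂) ?_, hI₂⟩
    rw [hm, Nat.succ_mul]
    omega

theorem enterLoop {x y d κ : ℕ} (hx : x < d) (hy : y < d) (hxκ : bits (s.reg x) ≤ κ)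
    (hyκ : bits (s.reg y) ≤ κ) :
    ∃ s', (Prog.enterLoop x y d).HaltsWithin s s' (5 + 2 * κ) ∧ s'.mem = s.mem ∧
      Set.EqOn s'.reg s.reg (Set.Iio d \ {x}) ∧ s'.reg x = 0 ∧ s'.reg d = s.reg y ∧
      s'.reg (d + 1) = s.reg x := by
  have hx₁ : x ≠ d + 1 := by omega
  have hx₂ : x ≠ d + 2 := by omega
  have hy₁ : y ≠ d + 1 := by omega
  have hy₂ : y ≠ d + 2 := by omega
  have h₁ := move (s := s) (d + 1) hx₂ hxκ
  set s₁ := (s.setReg (d + 2) 0).setReg (d + 1) (s.reg x) with hs₁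
  have hy' : s₁.reg y = s.reg y := by simp [hs₁, hy₁, hy₂]
  have h₂ := move (s := s₁) (κ := κ) d hy₂ (by rwa [hy'])
  refine ⟨_, (h₁.seq (h₂.seq (const x 0 _))).mono (by simp only [bits_zero]; omega), rfl,
    ?_, ?_, ?_, ?_⟩
  · rintro r ⟨hr : r < d, hrx : r ≠ x⟩
    simp [hs₁, hrx, hr.ne, (show r ≠ d + 1 by omega), (show r ≠ d + 2 by omega)]
  all_goals simp [hs₁, hx.ne', hx₁.symm, hy₁, hy₂]

theorem tick {x d κ : ℕ} (hx : x < d) (hxκ : bits (s.reg x) ≤ κ) (hdκ : bits (s.reg d) ≤ κ) :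
    ∃ s', (Prog.tick x d).HaltsWithin s s' (6 + 2 * κ) ∧ s'.mem = s.mem ∧
      Set.EqOn s'.reg s.reg (Set.Iio d \ {x}) ∧ s'.reg x = s.reg x + 1 ∧
      s'.reg d = s.reg d - 1 ∧ s'.reg (d + 1) = s.reg (d + 1) := by
  have hx₁ : d + 1 ≠ x := by omega
  have hx₂ : x ≠ d + 2 := by omega
  refine ⟨_, ((const (d + 2) 1 s).seq
      ((arith (κ := κ) (κ' := 1) .add x (a := x) (b := d + 2) ?_ ?_).seq
        (arith (κ := κ) (κ' := 1) .sub d (a := d) (b := d + 2) ?_ ?_))).mono ?_,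
    rfl, ?_, ?_, ?_, ?_⟩
  case refine_6 =>
    rintro r ⟨hr : r < d, hrx : r ≠ x⟩
    simp [hrx, hr.ne, (show r ≠ d + 2 by omega)]
  case refine_5 => simp only [bits_one]; omega
  all_goals simp [Op.eval, hx.ne, hx.ne', hx₁, hx₂, hx₂.symm, hxκ, hdκ]

theorem forLoop {x y d m τ κ : ℕ} {J : ℕ → State → Prop} (hx : x < d) (hy : y < d)
    (hm : s.reg y = m) (hxκ : bits (s.reg x) ≤ κ) (hmκ : bits m ≤ κ)
    (hJ : ∀ l s₁ s₂, s₂.mem = s₁.mem → Set.EqOn s₂.reg s₁.reg (Set.Iio d \ {x}) →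
      J l s₁ → J l s₂)
    (hp : ∀ l < m, ∀ s₁ : State, s₁.reg x = l → J l s₁ →
      ∃ s₂, p.HaltsWithin s₁ s₂ τ ∧ J (l + 1) s₂ ∧ s₂.reg x = s₁.reg x ∧
        s₂.reg d = s₁.reg d ∧ s₂.reg (d + 1) = s₁.reg (d + 1))
    (h0 : J 0 s) :
    ∃ s', (Prog.forLoop x y d p).HaltsWithin s s' ((m + 1) * (τ + 8 * (κ + 1))) ∧
      s'.reg x = s.reg x ∧ J m s' := by
  let I : ℕ → State → Prop := fun j s₁ =>
    j ≤ m ∧ s₁.reg d = j ∧ s₁.reg (d + 1) = s.reg x ∧ s₁.reg x = (m - j : ℕ) ∧ J (m - j) s₁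
  obtain ⟨s₁, run₁, mem₁, reg₁, x₁, d₁, save₁⟩ := enterLoop hx hy hxκ (by rwa [hm])
  have hI : I m s₁ := ⟨le_rfl, by rw [d₁, hm], save₁, by simp [x₁], by
    rw [Nat.sub_self]; exact hJ 0 s s₁ mem₁ reg₁ h0⟩
  have hround : ∀ j < m, ∀ s₁, I (j + 1) s₁ →
      ∃ s₂, (Prog.seq p (Prog.tick x d)).HaltsWithin s₁ s₂ (τ + (6 + 2 * κ)) ∧ I j s₂ := by
    rintro j hj s₁ ⟨-, d₁, save₁, x₁, J₁⟩
    obtain ⟨s₂, run₂, J₂, x₂, d₂, save₂⟩ := hp _ (by omega) s₁ x₁ J₁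
    have hxκ₂ : bits (s₂.reg x) ≤ κ := by
      rw [x₂, x₁]; exact (bits_natCast_mono (Nat.sub_le _ _)).trans hmκ
    have hdκ₂ : bits (s₂.reg d) ≤ κ := by rw [d₂, d₁]; exact (bits_natCast_mono hj).trans hmκ
    obtain ⟨s₃, run₃, mem₃, reg₃, x₃, d₃, save₃⟩ := tick hx hxκ₂ hdκ₂
    have hj' : m - (j + 1) + 1 = m - j := by omega
    rw [hj'] at J₂
    refine ⟨s₃, run₂.seq run₃, hj.le, ?_, ?_, ?_, hJ _ s₂ s₃ mem₃ reg₃ J₂⟩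
    · rw [d₃, d₂, d₁]; push_cast; ring
    · rw [save₃, save₂, save₁]
    · rw [x₃, x₂, x₁, ← hj']; push_cast; rfl
  obtain ⟨s₂, run₂, -, -, save₂, -, J₂⟩ := loop hmκ (fun j _ h => h.2.1) hround hI
  have run₃ := move (s := s₂) (κ := κ) x (show d + 1 ≠ d + 2 by omega) (by rwa [save₂])
  refine ⟨_, (run₁.seq (run₂.seq run₃)).mono ?_, by simp [save₂], hJ m s₂ _ rfl ?_ J₂⟩
  · have : (m + 1) * (τ + 8 * (κ + 1)) = m * (τ + 8 * (κ + 1)) + (τ + 8 * (κ + 1)) := by ring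
    have : m * (τ + (6 + 2 * κ) + 1 + κ) ≤ m * (τ + 8 * (κ + 1)) :=
      Nat.mul_le_mul_left _ (by omega)
    omega
  · rintro r ⟨hr : r < d, hrx : r ≠ x⟩
    simp [hrx, (show r ≠ d + 2 by omega)]

end HaltsWithin

end Prog

/-! ### Integer expressions with bounded sums -/

/-- Integer expressions: loop variables, array cells, arithmetic, conditionals (on positivity) and
sums, `sum x y e` being the sum of `e` over the values `0, …, y - 1` of the variable `x`. -/
inductive Expr
  | const (c : ℤ)
  | var (x : ℕ)
  | load (b : ℕ) (e : Expr)
  | op (o : Op) (e₁ e₂ : Expr)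
  | cond (e e₁ e₂ : Expr)
  | sum (x y : ℕ) (e : Expr)

/-- The values of the variables below `d` lie in `[0, R]`, and the array entries in
`[-2 ^ L, 2 ^ L]`. -/
structure Fits (d R L : ℕ) (v : ℕ → ℤ) (m : ℕ → ℤ → ℤ) : Prop where
  nonneg : ∀ r < d, 0 ≤ v r
  le : ∀ r < d, v r ≤ R
  abs_mem_le : ∀ b i, |m b i| ≤ 2 ^ L

theorem Op.abs_eval_le (o : Op) {a b A B : ℤ} (hA : 2 ≤ A) (hB : 2 ≤ B) (ha : |a| ≤ A)
    (hb : |b| ≤ B) : |o.eval a b| ≤ A * B := by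
  have hAB : A + B ≤ A * B := by nlinarith
  cases o with
  | add => exact (abs_add_le a b).trans ((add_le_add ha hb).trans hAB)
  | sub => exact (abs_sub a b).trans ((add_le_add ha hb).trans hAB)
  | mul => exact (abs_mul a b).trans_le (mul_le_mul ha hb (abs_nonneg b) (by linarith))
  | div => exact (Int.abs_ediv_le_abs a b).trans (by nlinarith)

theorem eqOn_update {d x : ℕ} {v v' : ℕ → ℤ} (h : Set.EqOn v v' (Set.Iio d \ {x})) (z : ℤ) :
    Set.EqOn (Function.update v x z) (Function.update v' x z) (Set.Iio d) := by
  intro r hr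
  by_cases hx : r = x
  · simp [hx]
  · simpa [hx] using h ⟨hr, hx⟩

theorem eqOn_update_right {d x : ℕ} {v v' : ℕ → ℤ} (h : Set.EqOn v v' (Set.Iio d \ {x})) :
    Set.EqOn v (Function.update v' x (v x)) (Set.Iio d) := by
  simpa using eqOn_update h (v x)

namespace Fits

variable {d R L : ℕ} {v v' : ℕ → ℤ} {m : ℕ → ℤ → ℤ}

theorem congr (h : Fits d R L v m) (hv : Set.EqOn v' v (Set.Iio d)) : Fits d R L v' m where
  nonneg r hr := by rw [hv hr]; exact h.nonneg r hr
  le r hr := by rw [hv hr]; exact h.le r hr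
  abs_mem_le := h.abs_mem_le

theorem update (h : Fits d R L v m) (x : ℕ) {l : ℕ} (hl : l ≤ R) :
    Fits d R L (Function.update v x l) m where
  nonneg r hr := by
    by_cases hx : r = x
    · simp [hx]
    · simpa [hx] using h.nonneg r hr
  le r hr := by
    by_cases hx : r = x
    · simp [hx, hl]
    · simpa [hx] using h.le r hr
  abs_mem_le := h.abs_mem_le

theorem toNat_le (h : Fits d R L v m) {r : ℕ} (hr : r < d) : (v r).toNat ≤ R := by
  simpa using h.le r hr

theorem abs_le (h : Fits d R L v m) (hR : R ≤ 2 ^ L) {r : ℕ} (hr : r < d) : |v r| ≤ 2 ^ L := by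
  rw [abs_of_nonneg (h.nonneg r hr)]
  exact (h.le r hr).trans (by exact_mod_cast hR)

theorem bits_le (h : Fits d R L v m) (hR : R ≤ 2 ^ L) {r : ℕ} (hr : r < d) :
    bits (v r) ≤ L + 1 :=
  bits_le_of_abs_le_two_pow (h.abs_le hR hr)

end Fits

namespace Expr

/-- The value of an expression for the values `v` of the variables and the contents `m` of the
arrays. -/
def eval : Expr → (ℕ → ℤ) → (ℕ → ℤ → ℤ) → ℤ
  | const c, _, _ => c
  | var x, v, _ => v x
  | load b e, v, m => m b (e.eval v m)
  | op o e₁ e₂, v, m => o.eval (e₁.eval v m) (e₂.eval v m)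
  | cond e e₁ e₂, v, m => if 0 < e.eval v m then e₁.eval v m else e₂.eval v m
  | sum x y e, v, m => ∑ l ∈ Finset.range (v y).toNat, e.eval (Function.update v x l) m

/-- All variables of the expression are less than `d`. -/
def Below : Expr → ℕ → Prop
  | const _, _ => True
  | var x, d => x < d
  | load _ e, d => e.Below d
  | op _ e₁ e₂, d => e₁.Below d ∧ e₂.Below d
  | cond e e₁ e₂, d => e.Below d ∧ e₁.Below d ∧ e₂.Below d
  | sum x y e, d => x < d ∧ y < d ∧ e.Below d

/-- Degree of growth: variables and array entries of size at most `2 ^ L` give a value of size at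
most `2 ^ (L * e.deg)`. -/
def deg : Expr → ℕ
  | const c => bits c + 1
  | var _ => 1
  | load _ e => e.deg
  | op _ e₁ e₂ => e₁.deg + e₂.deg
  | cond e e₁ e₂ => e.deg + e₁.deg + e₂.deg
  | sum _ _ e => e.deg + 1

/-- The program that puts the value of the expression into register `d`, using the registers from
`d` on as scratch space. -/
def code : Expr → ℕ → Prog
  | const c, d => .const d c
  | var x, d => .move d x d
  | load b e, d => .seq (e.code d) (.load d b d)
  | op o e₁ e₂, d => .seq (e₁.code d) (.seq (e₂.code (d + 1)) (.arith o d d (d + 1)))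
  | cond e e₁ e₂, d => .seq (e.code d) (.ite d (e₁.code d) (e₂.code d))
  | sum x y e, d =>
    .seq (.const d 0) (.forLoop x y (d + 1) (.seq (e.code (d + 3)) (.arith .add d d (d + 3))))

/-- A bound for the running time of `code`, when the variables are at most `R` and the array
entries at most `2 ^ L`. -/
def time : Expr → ℕ → ℕ → ℕ
  | const c, _, _ => 1 + bits c
  | var _, _, L => L + 3
  | load _ e, R, L => e.time R L + L * e.deg + L + 3
  | op _ e₁ e₂, R, L => e₁.time R L + e₂.time R L + L * e₁.deg + L * e₂.deg + 3
  | cond e e₁ e₂, R, L => e.time R L + e₁.time R L + e₂.time R L + L * e.deg + 2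
  | sum _ _ e, R, L => (R + 1) * (e.time R L + 10 * (L * (e.deg + 1) + 2))

theorem eval_congr (e : Expr) {d : ℕ} (hd : e.Below d) {v v' : ℕ → ℤ}
    (h : Set.EqOn v v' (Set.Iio d)) (m : ℕ → ℤ → ℤ) : e.eval v m = e.eval v' m := by
  induction e generalizing v v' with
  | const c => rfl
  | var x => exact h hd
  | load b e ih => simp only [eval, ih hd h]
  | op o e₁ e₂ ih₁ ih₂ => simp only [eval, ih₁ hd.1 h, ih₂ hd.2 h]
  | cond e e₁ e₂ ih ih₁ ih₂ => simp only [eval, ih hd.1 h, ih₁ hd.2.1 h, ih₂ hd.2.2 h]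
  | sum x y e ih =>
    simp only [eval, h hd.2.1]
    exact Finset.sum_congr rfl fun l _ => ih hd.2.2 (eqOn_update (h.mono Set.sdiff_subset) l)

theorem one_le_deg (e : Expr) : 1 ≤ e.deg := by
  induction e <;> simp only [deg] <;> omega

section Bounds

variable {d R L : ℕ} {v : ℕ → ℤ} {m : ℕ → ℤ → ℤ}

theorem abs_sum_range_le (hR : R ≤ 2 ^ L) {k j : ℕ} (hj : j ≤ R) {f : ℕ → ℤ}
    (hf : ∀ l ≤ R, |f l| ≤ 2 ^ (L * k)) : |∑ l ∈ Finset.range j, f l| ≤ 2 ^ (L * (k + 1)) :=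
  calc |∑ l ∈ Finset.range j, f l|
      ≤ ∑ l ∈ Finset.range j, |f l| := Finset.abs_sum_le_sum_abs _ _
    _ ≤ ∑ _l ∈ Finset.range j, (2 : ℤ) ^ (L * k) :=
        Finset.sum_le_sum fun l hl => hf l ((Finset.mem_range.1 hl).le.trans hj)
    _ = j * 2 ^ (L * k) := by simp
    _ ≤ 2 ^ L * 2 ^ (L * k) := by gcongr; exact_mod_cast hj.trans hR
    _ = 2 ^ (L * (k + 1)) := by ring

theorem abs_eval_le (e : Expr) (hL : 1 ≤ L) (hR : R ≤ 2 ^ L) (hd : e.Below d)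
    (h : Fits d R L v m) : |e.eval v m| ≤ 2 ^ (L * e.deg) := by
  have two_le : ∀ e : Expr, (2 : ℤ) ≤ 2 ^ (L * e.deg) := fun e =>
    le_self_pow₀ one_le_two (Nat.mul_ne_zero (by omega) (by have := e.one_le_deg; omega))
  have weaken : ∀ {z : ℤ} {i j : ℕ}, i ≤ j → |z| ≤ 2 ^ i → |z| ≤ 2 ^ j := fun hij hz =>
    hz.trans (pow_le_pow_right₀ one_le_two hij)
  induction e generalizing v with
  | const c => exact weaken (by simp only [deg]; nlinarith) (abs_le_two_pow_bits c)
  | var x => simpa only [eval, deg, mul_one] using h.abs_le hR hd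
  | load b e => exact weaken (Nat.le_mul_of_pos_right L e.one_le_deg) (h.abs_mem_le b _)
  | op o e₁ e₂ ih₁ ih₂ =>
    rw [deg, Nat.mul_add, pow_add]
    exact o.abs_eval_le (two_le e₁) (two_le e₂) (ih₁ hd.1 h) (ih₂ hd.2 h)
  | cond e e₁ e₂ _ ih₁ ih₂ =>
    rw [eval]
    split_ifs
    · exact weaken (Nat.mul_le_mul_left _ (by simp only [deg]; omega)) (ih₁ hd.2.1 h)
    · exact weaken (Nat.mul_le_mul_left _ (by simp only [deg]; omega)) (ih₂ hd.2.2 h)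
  | sum x y e ih =>
    exact abs_sum_range_le hR (h.toNat_le hd.2.1) fun l hl => ih hd.2.2 (h.update x hl)

theorem bits_eval_le (e : Expr) (hL : 1 ≤ L) (hR : R ≤ 2 ^ L) (hd : e.Below d)
    (h : Fits d R L v m) : bits (e.eval v m) ≤ L * e.deg + 1 :=
  bits_le_of_abs_le_two_pow (e.abs_eval_le hL hR hd h)

end Bounds

/-! ### Compiling expressions -/

/-- From every state that fits the bounds, `e.code` evaluates `e` in time, whatever the scratch
space. -/
def Compiles (e : Expr) (d₀ R L : ℕ) : Prop :=
  ∀ ⦃d : ℕ⦄ ⦃s : State⦄, d₀ ≤ d → Fits d₀ R L s.reg s.mem →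
    ∃ s', (e.code d).HaltsWithin s s' (e.time R L) ∧ s'.mem = s.mem ∧
      Set.EqOn s'.reg s.reg (Set.Iio d) ∧ s'.reg d = e.eval s.reg s.mem

namespace Compiles

variable {d₀ R L : ℕ} {e e₁ e₂ : Expr}

theorem eqOn_setReg (s : State) (d : ℕ) (z : ℤ) :
    Set.EqOn (s.setReg d z).reg s.reg (Set.Iio d) := fun _ hr =>
  Function.update_of_ne (ne_of_lt hr) _ _

theorem apply_congr (he : e.Compiles d₀ R L) (hd : e.Below d₀) {d : ℕ} (hdd : d₀ ≤ d)
    {s s₀ : State} (hs : Fits d₀ R L s₀.reg s₀.mem) (hmem : s.mem = s₀.mem)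
    (hreg : Set.EqOn s.reg s₀.reg (Set.Iio d₀)) :
    ∃ s', (e.code d).HaltsWithin s s' (e.time R L) ∧ s'.mem = s₀.mem ∧
      Set.EqOn s'.reg s.reg (Set.Iio d) ∧ s'.reg d = e.eval s₀.reg s₀.mem := by
  obtain ⟨s', run, mem, reg, val⟩ := he hdd (hmem ▸ hs.congr hreg)
  exact ⟨s', run, mem.trans hmem, reg, by rw [val, hmem, e.eval_congr hd hreg]⟩

theorem const (c : ℤ) : (const c).Compiles d₀ R L := fun d s _ _ =>
  ⟨_, .const d c s, rfl, eqOn_setReg s d c, Function.update_self ..⟩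

theorem var (hR : R ≤ 2 ^ L) {x : ℕ} (hx : x < d₀) : (var x).Compiles d₀ R L := by
  intro d s hdd hs
  refine ⟨_, (Prog.HaltsWithin.move d (by omega) (hs.bits_le hR hx)).mono ?_, rfl,
    (eqOn_setReg _ d _).trans (eqOn_setReg s d 0), by simp [eval]⟩
  simp only [time]
  omega

theorem load (hL : 1 ≤ L) (hR : R ≤ 2 ^ L) (hd : e.Below d₀) (he : e.Compiles d₀ R L) (b : ℕ) :
    (Expr.load b e).Compiles d₀ R L := by
  intro d s hdd hs
  obtain ⟨s', run, mem, reg, val⟩ := he hdd hs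
  have haddr := e.bits_eval_le hL hR hd hs
  have hcell := bits_le_of_abs_le_two_pow (hs.abs_mem_le b (e.eval s.reg s.mem))
  refine ⟨_, (run.seq (.of_exec (.load d b d s') le_rfl)).mono ?_, mem,
    (eqOn_setReg s' d _).trans reg, by simp [eval, mem, val]⟩
  rw [val, mem]
  simp only [time]
  omega

theorem op (hL : 1 ≤ L) (hR : R ≤ 2 ^ L) (o : Op) (hd₁ : e₁.Below d₀) (hd₂ : e₂.Below d₀)
    (h₁ : e₁.Compiles d₀ R L) (h₂ : e₂.Compiles d₀ R L) : (op o e₁ e₂).Compiles d₀ R L := by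
  intro d s hdd hs
  obtain ⟨s₁, run₁, mem₁, reg₁, val₁⟩ := h₁ hdd hs
  obtain ⟨s₂, run₂, mem₂, reg₂, val₂⟩ := h₂.apply_congr hd₂ (hdd.trans d.le_succ) hs mem₁
    (reg₁.mono (Set.Iio_subset_Iio hdd))
  replace val₁ : s₂.reg d = e₁.eval s.reg s.mem := (reg₂ d.lt_succ_self).trans val₁
  have run₃ := Prog.HaltsWithin.arith o d (s := s₂) (a := d) (b := d + 1)
    (κ := L * e₁.deg + 1) (κ' := L * e₂.deg + 1)
    (by rw [val₁]; exact e₁.bits_eval_le hL hR hd₁ hs)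
    (by rw [val₂]; exact e₂.bits_eval_le hL hR hd₂ hs)
  refine ⟨_, (run₁.seq (run₂.seq run₃)).mono (by simp only [time]; omega), mem₂,
    (eqOn_setReg s₂ d _).trans ((reg₂.mono (Set.Iio_subset_Iio d.le_succ)).trans reg₁), ?_⟩
  simp [eval, val₁, val₂]

theorem cond (hL : 1 ≤ L) (hR : R ≤ 2 ^ L) (hd : e.Below d₀) (hd₁ : e₁.Below d₀)
    (hd₂ : e₂.Below d₀) (he : e.Compiles d₀ R L) (h₁ : e₁.Compiles d₀ R L)
    (h₂ : e₂.Compiles d₀ R L) : (cond e e₁ e₂).Compiles d₀ R L := by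
  intro d s hdd hs
  obtain ⟨s₁, run₁, mem₁, reg₁, val₁⟩ := he hdd hs
  have hbits : bits (s₁.reg d) ≤ L * e.deg + 1 := by
    rw [val₁]; exact e.bits_eval_le hL hR hd hs
  have hreg := reg₁.mono (Set.Iio_subset_Iio hdd)
  by_cases hpos : 0 < e.eval s.reg s.mem
  · obtain ⟨s₂, run₂, mem₂, reg₂, val₂⟩ := h₁.apply_congr hd₁ hdd hs mem₁ hreg
    exact ⟨s₂, (run₁.seq (.ite_pos (by rwa [val₁]) hbits run₂)).mono (by simp only [time]; omega),
      mem₂, reg₂.trans reg₁, by rw [val₂, eval, if_pos hpos]⟩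
  · obtain ⟨s₂, run₂, mem₂, reg₂, val₂⟩ := h₂.apply_congr hd₂ hdd hs mem₁ hreg
    exact ⟨s₂, (run₁.seq (.ite_nonpos (by rw [val₁]; omega) hbits run₂)).mono
      (by simp only [time]; omega), mem₂, reg₂.trans reg₁, by rw [val₂, eval, if_neg hpos]⟩

theorem accumulate (he : e.Compiles d₀ R L) (hd : e.Below d₀) {d : ℕ} (hdd : d₀ ≤ d)
    {s s₀ : State} (hs : Fits d₀ R L s₀.reg s₀.mem) (hmem : s.mem = s₀.mem)
    (hreg : Set.EqOn s.reg s₀.reg (Set.Iio d)) {κ : ℕ} (hacc : bits (s.reg d) ≤ κ)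
    (hval : bits (e.eval s₀.reg s₀.mem) ≤ κ) :
    ∃ s', (Prog.seq (e.code (d + 3)) (.arith .add d d (d + 3))).HaltsWithin s s'
        (e.time R L + (1 + κ + κ)) ∧ s'.mem = s₀.mem ∧
      Set.EqOn s'.reg s.reg (Set.Iio (d + 3) \ {d}) ∧
      s'.reg d = s.reg d + e.eval s₀.reg s₀.mem := by
  obtain ⟨s₁, run₁, mem₁, reg₁, val₁⟩ := he.apply_congr hd (d := d + 3) (by omega) hs hmem
    (hreg.mono (Set.Iio_subset_Iio hdd))
  have acc₁ : s₁.reg d = s.reg d := reg₁ (show d < d + 3 by omega)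
  have run₂ := Prog.HaltsWithin.arith .add d (s := s₁) (a := d) (b := d + 3)
    (by rwa [acc₁] : _ ≤ κ) (by rwa [val₁] : _ ≤ κ)
  refine ⟨_, run₁.seq run₂, mem₁, fun r hr => ?_, by simp [acc₁, val₁, Op.eval]⟩
  rw [State.setReg_reg, Function.update_of_ne hr.2, reg₁ hr.1]

/-- The invariant of the loop computing `.sum x y e` from the state `s`: after `l` rounds, register
`d` holds the sum of the first `l` terms. -/
def PartialSum (e : Expr) (x d : ℕ) (s : State) (l : ℕ) (s' : State) : Prop :=
  s'.mem = s.mem ∧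
    s'.reg d = ∑ i ∈ Finset.range l, e.eval (Function.update s.reg x i) s.mem ∧
    Set.EqOn s'.reg s.reg (Set.Iio d \ {x})

theorem partialSum_succ (he : e.Compiles d₀ R L) (hL : 1 ≤ L) (hR : R ≤ 2 ^ L) (hd : e.Below d₀)
    {d : ℕ} (hdd : d₀ ≤ d) {s s₁ : State} (hs : Fits d₀ R L s.reg s.mem) {x l : ℕ} (hl : l ≤ R)
    (hx : s₁.reg x = l) (h : PartialSum e x d s l s₁) :
    ∃ s₂, (Prog.seq (e.code (d + 3)) (.arith .add d d (d + 3))).HaltsWithin s₁ s₂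
        (e.time R L + (1 + (L * (e.deg + 1) + 1) + (L * (e.deg + 1) + 1))) ∧
      PartialSum e x d s (l + 1) s₂ ∧ Set.EqOn s₂.reg s₁.reg (Set.Iio (d + 3) \ {d}) := by
  obtain ⟨mem₁, acc₁, reg₁⟩ := h
  have hterm : ∀ i ≤ R, |e.eval (Function.update s.reg x i) s.mem| ≤ 2 ^ (L * e.deg) :=
    fun i hi => e.abs_eval_le hL hR hd (hs.update x hi)
  have hacc : bits (s₁.reg d) ≤ L * (e.deg + 1) + 1 := by
    rw [acc₁]
    exact bits_le_of_abs_le_two_pow (abs_sum_range_le hR hl hterm)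
  have hval := (bits_le_of_abs_le_two_pow (hterm l hl)).trans
    (show L * e.deg + 1 ≤ L * (e.deg + 1) + 1 by nlinarith)
  obtain ⟨s₂, run, mem₂, reg₂, acc₂⟩ := he.accumulate hd hdd (s := s₁)
    (s₀ := ⟨Function.update s.reg x l, s.mem⟩) (hs.update x hl) mem₁
    (by simpa only [hx] using eqOn_update_right reg₁) hacc hval
  refine ⟨s₂, run, ⟨mem₂, by rw [acc₂, acc₁, Finset.sum_range_succ], fun r hr => ?_⟩, reg₂⟩
  exact (reg₂ ⟨Nat.lt_add_right 3 hr.1, ne_of_lt hr.1⟩).trans (reg₁ hr)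

theorem PartialSum.congr {x d l : ℕ} {s s₁ s₂ : State} (h : PartialSum e x d s l s₁)
    (hxd : x ≠ d) (hmem : s₂.mem = s₁.mem)
    (hreg : Set.EqOn s₂.reg s₁.reg (Set.Iio (d + 1) \ {x})) : PartialSum e x d s l s₂ :=
  ⟨hmem.trans h.1, (hreg ⟨d.lt_succ_self, hxd.symm⟩).trans h.2.1,
    (hreg.mono (Set.sdiff_subset_sdiff_left (Set.Iio_subset_Iio d.le_succ))).trans h.2.2⟩

theorem sum (hL : 1 ≤ L) (hR : R ≤ 2 ^ L) {x y : ℕ} (hx : x < d₀) (hy : y < d₀)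
    (hd : e.Below d₀) (he : e.Compiles d₀ R L) : (sum x y e).Compiles d₀ R L := by
  intro d s hdd hs
  set m := (s.reg y).toNat
  have hmR : m ≤ R := hs.toNat_le hy
  have hmy : s.reg y = m := (Int.toNat_of_nonneg (hs.nonneg y hy)).symm
  set κ := L * (e.deg + 1) + 1 with hκ
  have hLκ : L + 1 ≤ κ := by rw [hκ]; nlinarith
  obtain ⟨s', run, x', ⟨mem', acc', reg'⟩⟩ := Prog.HaltsWithin.forLoop (s := s.setReg d 0)
    (x := x) (y := y) (d := d + 1) (m := m) (τ := e.time R L + (1 + κ + κ)) (κ := κ)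
    (J := PartialSum e x d s) (by omega) (by omega)
    (by simp [(show y ≠ d by omega), hmy])
    (by simpa [(show x ≠ d by omega)] using (hs.bits_le hR hx).trans hLκ)
    (by rw [← hmy]; exact (hs.bits_le hR hy).trans hLκ)
    (fun l s₁ s₂ hmem hreg h => h.congr (by omega) hmem hreg)
    (fun l hl s₁ hx₁ h => by
      obtain ⟨s₂, run, h₂, reg₂⟩ := he.partialSum_succ hL hR hd hdd hs (by omega) hx₁ h
      have keep {r : ℕ} (hr : r < d + 3) (hrd : r ≠ d) : s₂.reg r = s₁.reg r := reg₂ ⟨hr, hrd⟩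
      exact ⟨s₂, run, h₂, keep (by omega) (by omega), keep (by omega) (by omega),
        keep (by omega) (by omega)⟩)
    ⟨rfl, by simp, (eqOn_setReg s d 0).mono Set.sdiff_subset⟩
  refine ⟨s', ((Prog.HaltsWithin.const d 0 s).seq run).mono ?_, mem', fun r hr => ?_, acc'⟩
  · have : (m + 1) * (e.time R L + (1 + κ + κ) + 8 * (κ + 1)) + (m + 1) =
        (m + 1) * (e.time R L + 10 * (L * (e.deg + 1) + 2)) := by rw [hκ]; ring
    have : (m + 1) * (e.time R L + 10 * (L * (e.deg + 1) + 2)) ≤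
        (R + 1) * (e.time R L + 10 * (L * (e.deg + 1) + 2)) := Nat.mul_le_mul_right _ (by omega)
    simp only [bits_zero, time]
    omega
  · by_cases hrx : r = x
    · rw [hrx, x', State.setReg_reg, Function.update_of_ne (by omega)]
    · exact reg' ⟨hr, hrx⟩

end Compiles

theorem compiles (e : Expr) {d₀ R L : ℕ} (hL : 1 ≤ L) (hR : R ≤ 2 ^ L) (hd : e.Below d₀) :
    e.Compiles d₀ R L := by
  induction e with
  | const c => exact .const c
  | var x => exact .var hR hd
  | load b e ih => exact .load (e := e) hL hR hd (ih hd) b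
  | op o e₁ e₂ ih₁ ih₂ => exact .op hL hR o hd.1 hd.2 (ih₁ hd.1) (ih₂ hd.2)
  | cond e e₁ e₂ ih ih₁ ih₂ =>
    exact .cond hL hR hd.1 hd.2.1 hd.2.2 (ih hd.1) (ih₁ hd.2.1) (ih₂ hd.2.2)
  | sum x y e ih => exact .sum hL hR hd.1 hd.2.1 hd.2.2 (ih hd.2.2)

end Expr

/-! ### Commands on integer arrays -/

/-- Commands: assignment to an array cell, sequencing, and loops, `loop x y c` being the execution
of `c` for the values `0, …, y - 1` of the variable `x`. -/
inductive Cmd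
  | store (b : ℕ) (a e : Expr)
  | seq (c₁ c₂ : Cmd)
  | loop (x y : ℕ) (c : Cmd)

/-- The state after `l` rounds of a counting loop with body `f`. -/
def rounds {α : Type*} (f : ℕ → α → α) : ℕ → α → α
  | 0, m => m
  | l + 1, m => f l (rounds f l m)

namespace Cmd

/-- The effect of a command on the arrays. -/
def run : Cmd → (ℕ → ℤ) → (ℕ → ℤ → ℤ) → (ℕ → ℤ → ℤ)
  | store b a e, v, m => Function.update m b (Function.update (m b) (a.eval v m) (e.eval v m))
  | seq c₁ c₂, v, m => c₂.run v (c₁.run v m)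
  | loop x y c, v, m => rounds (fun l => c.run (Function.update v x l)) (v y).toNat m

/-- All values that the command stores lie in `[-2 ^ L, 2 ^ L]`. -/
def Safe (L : ℕ) : Cmd → (ℕ → ℤ) → (ℕ → ℤ → ℤ) → Prop
  | store _ _ e, v, m => |e.eval v m| ≤ 2 ^ L
  | seq c₁ c₂, v, m => c₁.Safe L v m ∧ c₂.Safe L v (c₁.run v m)
  | loop x y c, v, m => ∀ l < (v y).toNat,
      c.Safe L (Function.update v x l) (rounds (fun l => c.run (Function.update v x l)) l m)

/-- All variables of the command are less than `d`. -/
def Below : Cmd → ℕ → Prop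
  | store _ a e, d => a.Below d ∧ e.Below d
  | seq c₁ c₂, d => c₁.Below d ∧ c₂.Below d
  | loop x y c, d => x < d ∧ y < d ∧ c.Below d

/-- The program of a command, using the registers from `d` on as scratch space. -/
def code : Cmd → ℕ → Prog
  | store b a e, d => .seq (a.code d) (.seq (e.code (d + 1)) (.store b d (d + 1)))
  | seq c₁ c₂, d => .seq (c₁.code d) (c₂.code d)
  | loop x y c, d => .forLoop x y d (c.code (d + 3))

/-- A bound for the running time of `code`, when the variables are at most `R` and the array
entries at most `2 ^ L`. -/
def time : Cmd → ℕ → ℕ → ℕ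
  | store _ a e, R, L => a.time R L + e.time R L + L * a.deg + L * e.deg + 3
  | seq c₁ c₂, R, L => c₁.time R L + c₂.time R L
  | loop _ _ c, R, L => (R + 1) * (c.time R L + 8 * (L + 2))

theorem run_congr (c : Cmd) {d : ℕ} (hd : c.Below d) {v v' : ℕ → ℤ}
    (h : Set.EqOn v v' (Set.Iio d)) (m : ℕ → ℤ → ℤ) : c.run v m = c.run v' m := by
  induction c generalizing v v' m with
  | store b a e => simp only [run, a.eval_congr hd.1 h, e.eval_congr hd.2 h]
  | seq c₁ c₂ ih₁ ih₂ => simp only [run, ih₁ hd.1 h, ih₂ hd.2 h]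
  | loop x y c ih =>
    simp only [run, h hd.2.1]
    congr 1
    funext l m
    exact ih hd.2.2 (eqOn_update (h.mono Set.sdiff_subset) l) m

theorem safe_congr (c : Cmd) {d L : ℕ} (hd : c.Below d) {v v' : ℕ → ℤ}
    (h : Set.EqOn v v' (Set.Iio d)) {m : ℕ → ℤ → ℤ} : c.Safe L v m ↔ c.Safe L v' m := by
  induction c generalizing v v' m with
  | store b a e => simp only [Safe, e.eval_congr hd.2 h]
  | seq c₁ c₂ ih₁ ih₂ => simp only [Safe, c₁.run_congr hd.1 h, ih₁ hd.1 h, ih₂ hd.2 h]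
  | loop x y c ih =>
    have hupd (l : ℕ) := eqOn_update (h.mono Set.sdiff_subset) (x := x) (l : ℤ)
    simp only [Safe, h hd.2.1, ih hd.2.2 (hupd _),
      fun l : ℕ => funext (c.run_congr hd.2.2 (hupd l))]

theorem abs_run_le (c : Cmd) {L : ℕ} {v : ℕ → ℤ} {m : ℕ → ℤ → ℤ}
    (hm : ∀ b i, |m b i| ≤ 2 ^ L) (hc : c.Safe L v m) : ∀ b i, |c.run v m b i| ≤ 2 ^ L := by
  induction c generalizing v m with
  | store b a e =>
    intro b' i
    by_cases hb : b' = b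
    · subst hb
      by_cases hi : i = a.eval v m
      · simpa [run, hi] using (show |e.eval v m| ≤ 2 ^ L from hc)
      · simpa [run, hi] using hm b' i
    · simpa [run, hb] using hm b' i
  | seq c₁ c₂ ih₁ ih₂ => exact ih₂ (ih₁ hm hc.1) hc.2
  | loop x y c ih =>
    suffices ∀ k ≤ (v y).toNat, ∀ b i,
        |rounds (fun l => c.run (Function.update v x l)) k m b i| ≤ 2 ^ L from this _ le_rfl
    intro k hk
    induction k with
    | zero => exact hm
    | succ k ihk => exact ih (ihk (by omega)) (hc k (by omega))

/-- From every state that fits the bounds, `c.code` executes the command `c` in time if it is safe,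
whatever the scratch space. -/
def Compiles (c : Cmd) (d₀ R L : ℕ) : Prop :=
  ∀ ⦃d : ℕ⦄ ⦃s : State⦄, d₀ ≤ d → Fits d₀ R L s.reg s.mem → c.Safe L s.reg s.mem →
    ∃ s', (c.code d).HaltsWithin s s' (c.time R L) ∧ s'.mem = c.run s.reg s.mem ∧
      Set.EqOn s'.reg s.reg (Set.Iio d)

namespace Compiles

variable {d₀ R L : ℕ} {c c₁ c₂ : Cmd}

theorem apply_congr (hc : c.Compiles d₀ R L) (hd : c.Below d₀) {d : ℕ} (hdd : d₀ ≤ d)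
    {s : State} {v : ℕ → ℤ} (hs : Fits d₀ R L v s.mem) (hsafe : c.Safe L v s.mem)
    (hreg : Set.EqOn s.reg v (Set.Iio d₀)) :
    ∃ s', (c.code d).HaltsWithin s s' (c.time R L) ∧ s'.mem = c.run v s.mem ∧
      Set.EqOn s'.reg s.reg (Set.Iio d) := by
  obtain ⟨s', run, mem, reg⟩ := hc hdd (hs.congr hreg) ((c.safe_congr hd hreg).2 hsafe)
  exact ⟨s', run, mem.trans (c.run_congr hd hreg _), reg⟩

theorem store (hL : 1 ≤ L) (hR : R ≤ 2 ^ L) (b : ℕ) {a e : Expr} (ha : a.Below d₀)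
    (he : e.Below d₀) : (store b a e).Compiles d₀ R L := by
  intro d s hdd hs _
  obtain ⟨s₁, run₁, mem₁, reg₁, val₁⟩ := a.compiles hL hR ha hdd hs
  obtain ⟨s₂, run₂, mem₂, reg₂, val₂⟩ := (e.compiles hL hR he).apply_congr he
    (hdd.trans d.le_succ) hs mem₁ (reg₁.mono (Set.Iio_subset_Iio hdd))
  replace val₁ : s₂.reg d = a.eval s.reg s.mem := (reg₂ d.lt_succ_self).trans val₁
  have haddr := a.bits_eval_le hL hR ha hs
  have hval := e.bits_eval_le hL hR he hs
  refine ⟨_, (run₁.seq (run₂.seq (.of_exec (.store b d (d + 1) s₂) le_rfl))).mono ?_, ?_,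
    (reg₂.mono (Set.Iio_subset_Iio d.le_succ)).trans reg₁⟩
  · rw [val₁, val₂]
    simp only [time]
    omega
  · simp [run, val₁, val₂, mem₂]

theorem seq (hd₂ : c₂.Below d₀) (h₁ : c₁.Compiles d₀ R L)
    (h₂ : c₂.Compiles d₀ R L) : (seq c₁ c₂).Compiles d₀ R L := by
  intro d s hdd hs hsafe
  obtain ⟨s₁, run₁, mem₁, reg₁⟩ := h₁ hdd hs hsafe.1
  obtain ⟨s₂, run₂, mem₂, reg₂⟩ := h₂.apply_congr hd₂ hdd (s := s₁)
    ⟨hs.nonneg, hs.le, mem₁ ▸ c₁.abs_run_le hs.abs_mem_le hsafe.1⟩ (mem₁ ▸ hsafe.2)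
    (reg₁.mono (Set.Iio_subset_Iio hdd))
  exact ⟨s₂, run₁.seq run₂, by rw [mem₂, mem₁, run], reg₂.trans reg₁⟩

theorem loop (hR : R ≤ 2 ^ L) {x y : ℕ} (hx : x < d₀) (hy : y < d₀) (hd : c.Below d₀)
    (hc : c.Compiles d₀ R L) : (loop x y c).Compiles d₀ R L := by
  intro d s hdd hs hsafe
  set m := (s.reg y).toNat
  have hmR : m ≤ R := hs.toNat_le hy
  have hmy : s.reg y = m := (Int.toNat_of_nonneg (hs.nonneg y hy)).symm
  let f : ℕ → (ℕ → ℤ → ℤ) → ℕ → ℤ → ℤ := fun l => c.run (Function.update s.reg x l)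
  let J : ℕ → State → Prop := fun l s' => s'.mem = rounds f l s.mem ∧
    (∀ b i, |s'.mem b i| ≤ 2 ^ L) ∧ Set.EqOn s'.reg s.reg (Set.Iio d \ {x})
  have hround : ∀ l < m, ∀ s₁ : State, s₁.reg x = l → J l s₁ →
      ∃ s₂, (c.code (d + 3)).HaltsWithin s₁ s₂ (c.time R L) ∧ J (l + 1) s₂ ∧
        s₂.reg x = s₁.reg x ∧ s₂.reg d = s₁.reg d ∧ s₂.reg (d + 1) = s₁.reg (d + 1) := by
    rintro l hl s₁ x₁ ⟨mem₁, bound₁, reg₁⟩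
    have hupd := hs.update x (show l ≤ R by omega)
    have hsafe₁ : c.Safe L (Function.update s.reg x l) s₁.mem := mem₁ ▸ hsafe l hl
    have hreg₁ := x₁ ▸ eqOn_update_right (reg₁.mono
      (Set.sdiff_subset_sdiff_left (Set.Iio_subset_Iio hdd)))
    obtain ⟨s₂, run₂, mem₂, reg₂⟩ := hc.apply_congr hd (d := d + 3) (by omega)
      ⟨hupd.nonneg, hupd.le, bound₁⟩ hsafe₁ hreg₁
    have keep : ∀ {r}, r < d + 3 → s₂.reg r = s₁.reg r := fun hr => reg₂ hr
    exact ⟨s₂, run₂, ⟨by rw [mem₂, mem₁]; rfl, mem₂ ▸ c.abs_run_le bound₁ hsafe₁,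
      fun r hr => (keep (Nat.lt_add_right 3 hr.1)).trans (reg₁ hr)⟩,
      keep (by omega), keep (by omega), keep (by omega)⟩
  obtain ⟨s', run, x', mem', -, reg'⟩ := Prog.HaltsWithin.forLoop (κ := L + 1) (J := J)
    (by omega) (by omega) hmy (hs.bits_le hR hx) (by rw [← hmy]; exact hs.bits_le hR hy)
    (fun l s₁ s₂ hmem hreg ⟨mem₁, bound₁, reg₁⟩ =>
      ⟨hmem.trans mem₁, hmem ▸ bound₁, hreg.trans reg₁⟩)
    hround ⟨rfl, hs.abs_mem_le, fun _ _ => rfl⟩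
  refine ⟨s', run.mono (Nat.mul_le_mul_right _ (by omega)), mem', fun r hr => ?_⟩
  by_cases hrx : r = x
  · rw [hrx, x']
  · exact reg' ⟨hr, hrx⟩

end Compiles

theorem compiles (c : Cmd) {d₀ R L : ℕ} (hL : 1 ≤ L) (hR : R ≤ 2 ^ L) (hd : c.Below d₀) :
    c.Compiles d₀ R L := by
  induction c with
  | store b a e => exact .store hL hR b hd.1 hd.2
  | seq c₁ c₂ ih₁ ih₂ => exact .seq (c₁ := c₁) hd.2 (ih₁ hd.1) (ih₂ hd.2)
  | loop x y c ih => exact .loop (c := c) hR hd.1 hd.2.1 hd.2.2 (ih hd.2.2)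

end Cmd

/-- `f` is bounded by a polynomial. -/
def PolyBounded (f : ℕ → ℕ) : Prop := ∃ q : Polynomial ℕ, ∀ n, f n ≤ q.eval n

namespace PolyBounded

variable {f g R L : ℕ → ℕ}

theorem const (c : ℕ) : PolyBounded fun _ => c := ⟨.C c, by simp⟩

theorem id : PolyBounded fun n => n := ⟨.X, by simp⟩

theorem add (hf : PolyBounded f) (hg : PolyBounded g) : PolyBounded fun n => f n + g n := by
  obtain ⟨p, hp⟩ := hf
  obtain ⟨q, hq⟩ := hg
  exact ⟨p + q, fun n => by simpa using Nat.add_le_add (hp n) (hq n)⟩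

theorem mul (hf : PolyBounded f) (hg : PolyBounded g) : PolyBounded fun n => f n * g n := by
  obtain ⟨p, hp⟩ := hf
  obtain ⟨q, hq⟩ := hg
  exact ⟨p * q, fun n => by simpa using Nat.mul_le_mul (hp n) (hq n)⟩

theorem exprTime (e : Expr) (hR : PolyBounded R) (hL : PolyBounded L) :
    PolyBounded fun n => e.time (R n) (L n) := by
  induction e with
  | const => exact const _
  | var => exact hL.add (const 3)
  | load _ _ ih => exact ((ih.add (hL.mul (const _))).add hL).add (const _)
  | op _ _ _ ih₁ ih₂ =>
    exact (((ih₁.add ih₂).add (hL.mul (const _))).add (hL.mul (const _))).add (const _)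
  | cond _ _ _ ih ih₁ ih₂ =>
    exact (((ih.add ih₁).add ih₂).add (hL.mul (const _))).add (const _)
  | sum _ _ _ ih =>
    exact (hR.add (const _)).mul (ih.add ((const _).mul ((hL.mul (const _)).add (const _))))

theorem cmdTime (c : Cmd) (hR : PolyBounded R) (hL : PolyBounded L) :
    PolyBounded fun n => c.time (R n) (L n) := by
  induction c with
  | store _ a e =>
    exact ((((exprTime a hR hL).add (exprTime e hR hL)).add (hL.mul (const _))).add
      (hL.mul (const _))).add (const _)
  | seq _ _ ih₁ ih₂ => exact ih₁.add ih₂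
  | loop _ _ _ ih => exact (hR.add (const _)).mul (ih.add ((const _).mul (hL.add (const _))))

end PolyBounded

/-! ### Positive semidefinite matrices -/

section Matrices

open Matrix

variable {ι : Type*} [Fintype ι]

open scoped MatrixOrder in
theorem exists_eq_inner_of_posSemidef {X : Matrix ι ι ℝ} (hX : X.PosSemidef) :
    ∃ x : ι → EuclideanSpace ℝ ι, ∀ u v, X u v = inner ℝ (x u) (x v) := by
  classical
  obtain ⟨B, hB⟩ : ∃ B : Matrix ι ι ℝ, X = Bᴴ * B := by
    simpa [Matrix.star_eq_conjTranspose] using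
      CStarAlgebra.nonneg_iff_eq_star_mul_self.1 (Matrix.nonneg_iff_posSemidef.2 hX)
  refine ⟨fun u => WithLp.toLp 2 fun j => B j u, fun u v => ?_⟩
  simp [hB, Matrix.mul_apply, PiLp.inner_apply, mul_comm]

theorem abs_apply_le_trace_of_posSemidef {X : Matrix ι ι ℝ} (hX : X.PosSemidef) (u v : ι) :
    |X u v| ≤ X.trace := by
  obtain ⟨x, hx⟩ := exists_eq_inner_of_posSemidef hX
  have hdiag : ∀ w, ‖x w‖ ^ 2 ≤ X.trace := fun w => by
    rw [← real_inner_self_eq_norm_sq, ← hx]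
    exact Finset.single_le_sum (f := fun i => X i i) (fun i _ => hX.diag_nonneg)
      (Finset.mem_univ w)
  rw [hx u v]
  nlinarith [abs_real_inner_le_norm (x u) (x v), hdiag u, hdiag v, sq_nonneg (‖x u‖ - ‖x v‖)]

theorem trace_mul_eq_sum {R : Type*} [NonUnitalNonAssocSemiring R] (A : Matrix ι ι R)
    {B : Matrix ι ι R} (hB : B.IsSymm) : (A * B).trace = ∑ u, ∑ v, A u v * B u v := by
  simp only [trace, diag_apply, mul_apply, hB.apply]

theorem abs_trace_mul_le {A B : Matrix ι ι ℝ} {a b : ℝ} (hA : ∀ u v, |A u v| ≤ a)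
    (hB : ∀ u v, |B u v| ≤ b) : |(A * B).trace| ≤ Fintype.card ι ^ 2 * (a * b) :=
  calc |(A * B).trace| = |∑ u, ∑ v, A u v * B v u| := by simp only [trace, diag_apply, mul_apply]
    _ ≤ ∑ u, ∑ v, |A u v * B v u| :=
        (Finset.abs_sum_le_sum_abs _ _).trans
          (Finset.sum_le_sum fun u _ => Finset.abs_sum_le_sum_abs _ _)
    _ ≤ ∑ _u : ι, ∑ _v : ι, a * b := by
        refine Finset.sum_le_sum fun u _ => Finset.sum_le_sum fun v _ => ?_
        rw [abs_mul]
        exact mul_le_mul (hA u v) (hB v u) (abs_nonneg _) ((abs_nonneg _).trans (hA u v))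
    _ = Fintype.card ι ^ 2 * (a * b) := by simp; ring

theorem posSemidef_add_smul_one [DecidableEq ι] {A : Matrix ι ι ℝ} (hA : A.IsHermitian) {g c : ℝ}
    (hg : ∀ u v, |A u v| ≤ g) (hc : Fintype.card ι * g ≤ c) :
    (A + c • (1 : Matrix ι ι ℝ)).PosSemidef := by
  refine .of_dotProduct_mulVec_nonneg (hA.add (by simp [IsHermitian])) fun x => ?_
  have hform : star x ⬝ᵥ ((A + c • (1 : Matrix ι ι ℝ)) *ᵥ x) =
      ∑ u, ∑ v, A u v * (x u * x v) + c * ∑ u, x u ^ 2 := by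
    simp only [add_mulVec, smul_mulVec, one_mulVec, dotProduct_add, dotProduct_smul, smul_eq_mul]
    simp only [dotProduct, mulVec, Pi.star_apply, star_trivial, Finset.mul_sum, sq]
    congr 1
    exact Finset.sum_congr rfl fun u _ => Finset.sum_congr rfl fun v _ => by ring
  have hbound : |∑ u, ∑ v, A u v * (x u * x v)| ≤ c * ∑ u, x u ^ 2 :=
    calc |∑ u, ∑ v, A u v * (x u * x v)|
        ≤ ∑ u, ∑ v, |A u v * (x u * x v)| :=
          (Finset.abs_sum_le_sum_abs _ _).trans
            (Finset.sum_le_sum fun u _ => Finset.abs_sum_le_sum_abs _ _)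
      _ ≤ ∑ u, ∑ v, g * ((x u ^ 2 + x v ^ 2) / 2) := by
          refine Finset.sum_le_sum fun u _ => Finset.sum_le_sum fun v _ => ?_
          rw [abs_mul]
          refine mul_le_mul (hg u v) (abs_le.2 ⟨?_, ?_⟩) (abs_nonneg _)
            ((abs_nonneg _).trans (hg u v))
          · nlinarith [sq_nonneg (x u + x v)]
          · nlinarith [sq_nonneg (x u - x v)]
      _ = Fintype.card ι * g * ∑ u, x u ^ 2 := by
          simp only [← Finset.mul_sum, add_div, Finset.sum_add_distrib, Finset.sum_const,
            Finset.card_univ, nsmul_eq_mul, ← Finset.sum_div]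
          ring
      _ ≤ c * ∑ u, x u ^ 2 := by gcongr
  linarith [neg_abs_le (∑ u, ∑ v, A u v * (x u * x v))]

theorem add_one_mul_pow_mul_sub_le {x Λ : ℝ} (hx : 0 ≤ x) (hxΛ : x ≤ Λ) (N : ℕ) :
    (N + 1) * (x ^ N * (Λ - x)) ≤ Λ ^ (N + 1) := by
  have hterm : ∀ i ∈ Finset.range (N + 1), x ^ N ≤ Λ ^ i * x ^ (N - i) := fun i hi => by
    calc x ^ N = x ^ i * x ^ (N - i) := by
          rw [← pow_add, Nat.add_sub_cancel' (Finset.mem_range_succ_iff.1 hi)]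
      _ ≤ Λ ^ i * x ^ (N - i) := by gcongr
  calc (N + 1) * (x ^ N * (Λ - x)) = (∑ _i ∈ Finset.range (N + 1), x ^ N) * (Λ - x) := by
        simp; ring
    _ ≤ (∑ i ∈ Finset.range (N + 1), Λ ^ i * x ^ (N - i)) * (Λ - x) :=
        mul_le_mul_of_nonneg_right (Finset.sum_le_sum hterm) (sub_nonneg.2 hxΛ)
    _ = Λ ^ (N + 1) - x ^ (N + 1) := (Commute.all Λ x).geom_sum₂_mul (N + 1)
    _ ≤ Λ ^ (N + 1) := sub_le_self _ (pow_nonneg hx _)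

section Eigenvalues

variable [DecidableEq ι] {B : Matrix ι ι ℝ}

theorem trace_pow_eq_sum_eigenvalues (hB : B.IsHermitian) (k : ℕ) :
    (B ^ k).trace = ∑ i, hB.eigenvalues i ^ k := by
  conv_lhs => rw [hB.spectral_theorem]
  rw [← map_pow, Unitary.conjStarAlgAut_apply, diagonal_pow, trace_mul_cycle]
  simp

theorem trace_mul_le_of_eigenvalues_le (hB : B.IsHermitian) {Λ : ℝ}
    (hΛ : ∀ i, hB.eigenvalues i ≤ Λ) {Z : Matrix ι ι ℝ} (hZ : Z.PosSemidef) :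
    (B * Z).trace ≤ Λ * Z.trace := by
  let U : Matrix ι ι ℝ := hB.eigenvectorUnitary
  let V : Matrix ι ι ℝ := star U * Z * U
  have hV : V.PosSemidef := hZ.conjTranspose_mul_mul_same U
  have hspec : B = U * diagonal hB.eigenvalues * star U := by
    simpa [Unitary.conjStarAlgAut_apply] using hB.spectral_theorem
  have htrV : V.trace = Z.trace := by
    rw [trace_mul_cycle]
    simp [U]
  calc (B * Z).trace = (diagonal hB.eigenvalues * V).trace := by
        conv_lhs => rw [hspec]
        rw [mul_assoc, mul_assoc, trace_mul_comm]
        simp only [V, mul_assoc]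
    _ = ∑ i, hB.eigenvalues i * V i i := by simp [trace]
    _ ≤ ∑ i, Λ * V i i :=
        Finset.sum_le_sum fun i _ => mul_le_mul_of_nonneg_right (hΛ i) hV.diag_nonneg
    _ = Λ * Z.trace := by rw [← Finset.mul_sum, ← htrV]; rfl

/- The density matrix proportional to `B ^ N` nearly maximizes the linear functional `tr (B Z)`: the
eigenvalues of `B` that are not close to the largest one are killed by the power. -/
theorem add_one_mul_trace_mul_sub_le [Nonempty ι] (hB : B.PosSemidef) (N : ℕ) {Z : Matrix ι ι ℝ}
    (hZ : Z.PosSemidef) :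
    (N + 1) * ((B * Z).trace * (B ^ N).trace - Z.trace * (B ^ (N + 1)).trace) ≤
      Fintype.card ι * Z.trace * B.trace * (B ^ N).trace := by
  let ev := hB.isHermitian.eigenvalues
  have hev : ∀ i, 0 ≤ ev i := hB.eigenvalues_nonneg
  obtain ⟨j, hj⟩ := Finite.exists_max ev
  have htr : ∀ k, (B ^ k).trace = ∑ i, ev i ^ k := trace_pow_eq_sum_eigenvalues hB.isHermitian
  have hle : ∀ k, ev j ^ k ≤ (B ^ k).trace := fun k => htr k ▸
    Finset.single_le_sum (f := fun i => ev i ^ k) (fun i _ => pow_nonneg (hev i) k)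
      (Finset.mem_univ j)
  have hBZ : (B * Z).trace ≤ ev j * Z.trace := trace_mul_le_of_eigenvalues_le _ hj hZ
  have hgap : (N + 1) * (ev j * (B ^ N).trace - (B ^ (N + 1)).trace) ≤
      Fintype.card ι * (B.trace * (B ^ N).trace) :=
    calc (N + 1) * (ev j * (B ^ N).trace - (B ^ (N + 1)).trace)
        = ∑ i, (N + 1) * (ev i ^ N * (ev j - ev i)) := by
          rw [htr, htr, Finset.mul_sum, ← Finset.sum_sub_distrib, Finset.mul_sum]
          exact Finset.sum_congr rfl fun i _ => by ring
      _ ≤ ∑ _i : ι, ev j ^ (N + 1) :=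
          Finset.sum_le_sum fun i _ => add_one_mul_pow_mul_sub_le (hev i) (hj i) N
      _ = Fintype.card ι * (ev j * ev j ^ N) := by simp [pow_succ']
      _ ≤ Fintype.card ι * (B.trace * (B ^ N).trace) := by
          have := hle 1
          rw [pow_one, pow_one] at this
          gcongr
          · exact pow_nonneg (hev j) N
          · exact hB.trace_nonneg
          · exact hle N
  have hN : 0 ≤ (B ^ N).trace := (hB.pow N).trace_nonneg
  calc (N + 1) * ((B * Z).trace * (B ^ N).trace - Z.trace * (B ^ (N + 1)).trace)
      ≤ (N + 1) * (ev j * Z.trace * (B ^ N).trace - Z.trace * (B ^ (N + 1)).trace) := by gcongr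
    _ = Z.trace * ((N + 1) * (ev j * (B ^ N).trace - (B ^ (N + 1)).trace)) := by ring
    _ ≤ Z.trace * (Fintype.card ι * (B.trace * (B ^ N).trace)) :=
        mul_le_mul_of_nonneg_left hgap hZ.trace_nonneg
    _ = Fintype.card ι * Z.trace * B.trace * (B ^ N).trace := by ring

end Eigenvalues

end Matrices

/-! ### A penalized semidefinite program, solved by the Frank–Wolfe method in integers -/

section FrankWolfe

open Matrix

/-- The weight of the penalties of the constraints that fix an entry of the Gram matrix. -/
def penWeight (n : ℕ) : ℤ := (n : ℤ) ^ 4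

/-- The multiple of the identity whose addition makes all gradients positive definite. -/
def shiftWeight (n : ℕ) : ℤ := 8 * (n : ℤ) ^ 6

/-- The inverse of the step size. -/
def stepInv (n : ℕ) : ℤ := 64 * (n : ℤ) ^ 8

/-- The number of steps, which is also the exponent of the matrix power taken in each step. -/
def numIter (n : ℕ) : ℕ := 1024 * n ^ 11

/-- The common denominator of the entries of the iterates. -/
def denom (n : ℕ) : ℤ := 4096 * (n : ℤ) ^ 15

section Cast

variable (n : ℕ)

@[simp] theorem cast_penWeight : (penWeight n : ℝ) = (n : ℝ) ^ 4 := by simp [penWeight]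

@[simp] theorem cast_shiftWeight : (shiftWeight n : ℝ) = 8 * (n : ℝ) ^ 6 := by simp [shiftWeight]

@[simp] theorem cast_stepInv : (stepInv n : ℝ) = 64 * (n : ℝ) ^ 8 := by simp [stepInv]

@[simp] theorem cast_numIter : (numIter n : ℝ) = 1024 * (n : ℝ) ^ 11 := by simp [numIter]

@[simp] theorem cast_denom : (denom n : ℝ) = 4096 * (n : ℝ) ^ 15 := by simp [denom]

variable {n}

theorem cast_denom_pos (hn : 1 ≤ n) : (0 : ℝ) < denom n := by
  rw [cast_denom]
  positivity

theorem one_le_cast_stepInv (hn : 1 ≤ n) : (1 : ℝ) ≤ stepInv n := by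
  have : (1 : ℝ) ≤ (n : ℝ) ^ 8 := one_le_pow₀ (by exact_mod_cast hn)
  rw [cast_stepInv]
  linarith

theorem twenty_mul_cast_stepInv_le_cast_denom (hn : 1 ≤ n) : 20 * (stepInv n : ℝ) ≤ denom n := by
  have h1 : (1 : ℝ) ≤ n := by exact_mod_cast hn
  rw [cast_stepInv, cast_denom, ← mul_assoc]
  gcongr <;> norm_num

theorem cast_stepInv_le_cast_denom (hn : 1 ≤ n) : (stepInv n : ℝ) ≤ denom n := by
  linarith [twenty_mul_cast_stepInv_le_cast_denom hn, one_le_cast_stepInv hn]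

end Cast

variable {n : ℕ} (G : SimpleGraph (Fin n))

open Classical in
/-- The indicator of the entries of the Gram matrix that the constraints fix: the diagonal, and the
edges. -/
noncomputable def mask (u v : Fin n) : ℤ :=
  if u = v ∨ G.Adj u v then 1 else 0

open Classical in
theorem mask_comm (u v : Fin n) : mask G u v = mask G v u :=
  if_congr (or_congr eq_comm (G.adj_comm u v)) rfl rfl

theorem mask_self (u : Fin n) : mask G u u = 1 := if_pos (Or.inl rfl)

theorem cast_mask_nonneg (u v : Fin n) : (0 : ℝ) ≤ mask G u v := by
  unfold mask; split_ifs <;> simp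

theorem cast_mask_le_one (u v : Fin n) : (mask G u v : ℝ) ≤ 1 := by
  unfold mask; split_ifs <;> simp

/-- The objective of the penalized program, which is maximized over the density matrices. -/
noncomputable def objective (X : Matrix (Fin n) (Fin n) ℝ) : ℝ :=
  ∑ u, ∑ v, (X u v - penWeight n * (mask G u v * (X u v - (1 : Matrix _ _ ℝ) u v) ^ 2))

/-- The gradient of `objective`. -/
noncomputable def gradient (X : Matrix (Fin n) (Fin n) ℝ) : Matrix (Fin n) (Fin n) ℝ :=
  .of fun u v => 1 - 2 * penWeight n * (mask G u v * (X u v - (1 : Matrix _ _ ℝ) u v))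

/-- The gradient at `W / denom n`, shifted by a multiple of the identity and scaled by `denom n`, so
that it is an integer matrix. -/
noncomputable def gradMat (W : Matrix (Fin n) (Fin n) ℤ) : Matrix (Fin n) (Fin n) ℤ :=
  .of fun u v => denom n + shiftWeight n * denom n * (1 : Matrix _ _ ℤ) u v -
    2 * penWeight n * (mask G u v * (W u v - denom n * (1 : Matrix _ _ ℤ) u v))

/-- One step of the method, from `W / denom n` towards the density matrix proportional to the power
of the gradient, rounded to integers. -/
noncomputable def fwStep (W : Matrix (Fin n) (Fin n) ℤ) : Matrix (Fin n) (Fin n) ℤ :=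
  .of fun u v =>
    ((stepInv n - 1) * W u v * (gradMat G W ^ numIter n).trace +
      n * denom n * (gradMat G W ^ numIter n) u v) /
    (stepInv n * (gradMat G W ^ numIter n).trace)

/-- The iterates of the method, scaled by the common denominator. -/
noncomputable def fwIter (t : ℕ) : Matrix (Fin n) (Fin n) ℤ :=
  (fwStep G)^[t] (denom n • 1)

/-- The feasible matrices of the penalized program: positive semidefinite of trace `n`. -/
structure IsDensity (X : Matrix (Fin n) (Fin n) ℝ) : Prop where
  posSemidef : X.PosSemidef
  trace_eq : X.trace = n

theorem isDensity_one : IsDensity (1 : Matrix (Fin n) (Fin n) ℝ) :=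
  ⟨.one, by simp⟩

section Density

variable {B X Y Z : Matrix (Fin n) (Fin n) ℝ}

theorem IsDensity.abs_le (hX : IsDensity X) (u v : Fin n) : |X u v| ≤ n :=
  hX.trace_eq ▸ abs_apply_le_trace_of_posSemidef hX.posSemidef u v

theorem IsDensity.abs_sub_le (hX : IsDensity X) (hY : IsDensity Y) (u v : Fin n) :
    |(X - Y) u v| ≤ 2 * n := by
  rw [Matrix.sub_apply, two_mul]
  exact (abs_sub _ _).trans (add_le_add (hX.abs_le u v) (hY.abs_le u v))

theorem IsDensity.isSymm (hX : IsDensity X) : X.IsSymm := by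
  rw [IsSymm, ← conjTranspose_eq_transpose_of_trivial]
  exact hX.posSemidef.isHermitian

theorem IsDensity.convex_comb (hX : IsDensity X) (hY : IsDensity Y) {γ : ℝ} (h0 : 0 ≤ γ)
    (h1 : γ ≤ 1) : IsDensity ((1 - γ) • X + γ • Y) := by
  refine ⟨(hX.posSemidef.smul (sub_nonneg.2 h1)).add (hY.posSemidef.smul h0), ?_⟩
  simp only [trace_add, trace_smul, hX.trace_eq, hY.trace_eq, smul_eq_mul]
  ring

theorem objective_sub_le (hX : IsDensity X) (hZ : IsDensity Z) :
    objective G Z - objective G X ≤ (gradient G X * (Z - X)).trace := by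
  rw [trace_mul_eq_sum _ (hZ.isSymm.sub hX.isSymm)]
  simp only [objective, ← Finset.sum_sub_distrib]
  refine Finset.sum_le_sum fun u _ => Finset.sum_le_sum fun v _ => ?_
  have hpen : 0 ≤ (penWeight n : ℝ) * (mask G u v * (Z u v - X u v) ^ 2) :=
    mul_nonneg (by simp) (mul_nonneg (cast_mask_nonneg G u v) (sq_nonneg _))
  simp only [gradient, of_apply, Matrix.sub_apply]
  linarith

theorem objective_convex_comb (hX : IsDensity X) (hY : IsDensity Y) (γ : ℝ) :
    objective G ((1 - γ) • X + γ • Y) = objective G X + γ * (gradient G X * (Y - X)).trace -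
      γ ^ 2 * ∑ u, ∑ v, penWeight n * (mask G u v * (Y - X) u v ^ 2) := by
  rw [trace_mul_eq_sum _ (hY.isSymm.sub hX.isSymm)]
  simp only [objective, Finset.mul_sum, ← Finset.sum_sub_distrib, ← Finset.sum_add_distrib]
  refine Finset.sum_congr rfl fun u _ => Finset.sum_congr rfl fun v _ => ?_
  simp only [gradient, of_apply, Matrix.add_apply, Matrix.sub_apply, Matrix.smul_apply, smul_eq_mul]
  ring

theorem sum_penalty_sub_le (hX : IsDensity X) (hY : IsDensity Y) :
    ∑ u, ∑ v, penWeight n * (mask G u v * (Y - X) u v ^ 2) ≤ 4 * (n : ℝ) ^ 8 :=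
  calc ∑ u, ∑ v, penWeight n * (mask G u v * (Y - X) u v ^ 2)
      ≤ ∑ _u : Fin n, ∑ _v : Fin n, (n : ℝ) ^ 4 * (1 * (2 * n) ^ 2) := by
        refine Finset.sum_le_sum fun u _ => Finset.sum_le_sum fun v _ => ?_
        have hsq : (Y - X) u v ^ 2 ≤ (2 * n) ^ 2 :=
          sq_le_sq.2 ((hY.abs_sub_le hX u v).trans (le_abs_self _))
        rw [cast_penWeight]
        gcongr
        exact cast_mask_le_one G u v
    _ = 4 * (n : ℝ) ^ 8 := by simp; ring

/- The Frank–Wolfe inequality: the step from `X` towards a near maximizer `Y` of the linearization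
at `X` reduces the optimality gap by the factor `1 - γ`, up to the curvature of the objective. -/
theorem objective_sub_convex_comb_le (hX : IsDensity X) (hY : IsDensity Y) (hZ : IsDensity Z)
    {γ ε : ℝ} (hγ : 0 ≤ γ) (hε : (gradient G X * (Z - Y)).trace ≤ ε) :
    objective G Z - objective G ((1 - γ) • X + γ • Y) ≤
      (1 - γ) * (objective G Z - objective G X) + γ * (ε + γ * (4 * (n : ℝ) ^ 8)) := by
  have hlin : objective G Z - objective G X - ε ≤ (gradient G X * (Y - X)).trace := by
    have hsplit : gradient G X * (Z - X) = gradient G X * (Z - Y) + gradient G X * (Y - X) := by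
      rw [← mul_add, sub_add_sub_cancel]
    have := objective_sub_le G hX hZ
    rw [hsplit, trace_add] at this
    linarith
  have hcurv := mul_le_mul_of_nonneg_left (sum_penalty_sub_le G hX hY) (sq_nonneg γ)
  rw [objective_convex_comb G hX hY]
  linarith [mul_le_mul_of_nonneg_left hlin hγ]

/-- The density matrix proportional to `B ^ N`. -/
noncomputable def powDensity (B : Matrix (Fin n) (Fin n) ℝ) (N : ℕ) : Matrix (Fin n) (Fin n) ℝ :=
  (n / (B ^ N).trace) • B ^ N

theorem trace_pow_pos (hn : 1 ≤ n) (hB : B.PosDef) (N : ℕ) : 0 < (B ^ N).trace := by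
  have : Nonempty (Fin n) := ⟨⟨0, hn⟩⟩
  have hN := hB.posSemidef.pow N
  refine hN.trace_nonneg.lt_of_ne' fun h => not_isUnit_zero (M₀ := Matrix (Fin n) (Fin n) ℝ) ?_
  exact hN.trace_eq_zero_iff.1 h ▸ hB.isUnit.pow N

theorem isDensity_powDensity (hn : 1 ≤ n) (hB : B.PosDef) (N : ℕ) :
    IsDensity (powDensity B N) := by
  have htr := trace_pow_pos hn hB N
  refine ⟨(hB.posSemidef.pow N).smul (by positivity), ?_⟩
  rw [powDensity, trace_smul, smul_eq_mul, div_mul_cancel₀ _ htr.ne']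

theorem add_one_mul_trace_mul_sub_powDensity_le (hn : 1 ≤ n) (hB : B.PosDef) (hZ : IsDensity Z)
    (N : ℕ) : (N + 1) * (B * (Z - powDensity B N)).trace ≤ n ^ 2 * B.trace := by
  have : Nonempty (Fin n) := ⟨⟨0, hn⟩⟩
  have htr := trace_pow_pos hn hB N
  have key := add_one_mul_trace_mul_sub_le hB.posSemidef N hZ.posSemidef
  rw [hZ.trace_eq, Fintype.card_fin] at key
  refine le_of_mul_le_mul_right (le_of_eq_of_le ?_ (key.trans_eq ?_)) htr
  · rw [mul_sub, trace_sub, powDensity, mul_smul_comm, trace_smul, smul_eq_mul, ← pow_succ']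
    field_simp
  · ring

end Density

section Rounding

variable {W : Matrix (Fin n) (Fin n) ℤ} {X Z : Matrix (Fin n) (Fin n) ℝ}

/-- The symmetric integer matrix `W` is, up to an error that does not accumulate over the steps of
the method, the multiple by `denom n` of the density matrix `X`. -/
structure IsRounding (W : Matrix (Fin n) (Fin n) ℤ) (X : Matrix (Fin n) (Fin n) ℝ) : Prop where
  isDensity : IsDensity X
  isSymm : W.IsSymm
  abs_sub_le : ∀ u v, |(W u v : ℝ) - denom n * X u v| ≤ stepInv n

theorem isRounding_one (hn : 1 ≤ n) : IsRounding (denom n • 1 : Matrix (Fin n) (Fin n) ℤ) 1 where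
  isDensity := isDensity_one
  isSymm := isSymm_one.smul _
  abs_sub_le u v := by
    have h : (((denom n • 1 : Matrix (Fin n) (Fin n) ℤ) u v : ℤ) : ℝ) =
        denom n * (1 : Matrix (Fin n) (Fin n) ℝ) u v := by
      simp [one_apply, -cast_denom]
    rw [h, sub_self, abs_zero]
    exact zero_le_one.trans (one_le_cast_stepInv hn)

theorem abs_apply_le_of_isRounding (hn : 1 ≤ n) (h : IsRounding W X) (u v : Fin n) :
    |W u v| ≤ denom n * n + stepInv n := by
  have hD := cast_denom_pos hn
  have : |(W u v : ℝ)| ≤ denom n * n + stepInv n :=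
    calc |(W u v : ℝ)| = |denom n * X u v + (W u v - denom n * X u v)| := by ring_nf
      _ ≤ |denom n * X u v| + |W u v - denom n * X u v| := abs_add_le _ _
      _ ≤ denom n * n + stepInv n := by
          rw [abs_mul, abs_of_pos hD]
          gcongr
          · exact h.isDensity.abs_le u v
          · exact h.abs_sub_le u v
  exact_mod_cast this

/-- The matrix `gradMat G W` with real entries. -/
noncomputable def realGradMat (W : Matrix (Fin n) (Fin n) ℤ) : Matrix (Fin n) (Fin n) ℝ :=
  (Int.castRingHom ℝ).mapMatrix (gradMat G W)

theorem realGradMat_pow_apply (W : Matrix (Fin n) (Fin n) ℤ) (N : ℕ) (u v : Fin n) :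
    (realGradMat G W ^ N) u v = ((gradMat G W ^ N) u v : ℤ) := by
  rw [realGradMat, ← map_pow]
  rfl

theorem abs_realGradMat_sub_le (h : IsRounding W X) (u v : Fin n) :
    |(realGradMat G W - (denom n : ℝ) • (gradient G X + (shiftWeight n : ℝ) • 1)) u v| ≤
      2 * (n : ℝ) ^ 4 * stepInv n := by
  have hdiff :
      (realGradMat G W - (denom n : ℝ) • (gradient G X + (shiftWeight n : ℝ) • 1)) u v =
        -(2 * penWeight n * (mask G u v * (W u v - denom n * X u v))) := by
    by_cases huv : u = v <;> simp [realGradMat, gradMat, gradient, one_apply, huv] <;> ring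
  rw [hdiff, abs_neg, abs_mul, abs_mul (mask G u v : ℝ), abs_of_nonneg (cast_mask_nonneg G u v),
    cast_penWeight, abs_of_nonneg (by positivity : (0 : ℝ) ≤ 2 * n ^ 4)]
  gcongr
  exact (mul_le_of_le_one_left (abs_nonneg _) (cast_mask_le_one G u v)).trans (h.abs_sub_le u v)

theorem abs_gradient_le (hX : IsDensity X) (u v : Fin n) :
    |gradient G X u v| ≤ 1 + 2 * (n : ℝ) ^ 4 * (n + 1) := by
  have hdev : |X u v - (1 : Matrix (Fin n) (Fin n) ℝ) u v| ≤ n + 1 := by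
    refine (abs_sub _ _).trans (add_le_add (hX.abs_le u v) ?_)
    rw [one_apply]
    split_ifs <;> simp
  rw [gradient, of_apply, cast_penWeight]
  refine (abs_sub _ _).trans ?_
  rw [abs_one, abs_mul, abs_mul (mask G u v : ℝ), abs_of_nonneg (cast_mask_nonneg G u v),
    abs_of_nonneg (by positivity : (0 : ℝ) ≤ 2 * n ^ 4)]
  gcongr
  exact (mul_le_of_le_one_left (abs_nonneg _) (cast_mask_le_one G u v)).trans hdev

theorem isHermitian_realGradMat (h : W.IsSymm) : (realGradMat G W).IsHermitian := by
  refine .ext fun u v => ?_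
  simp [realGradMat, gradMat, mask_comm G v u, h.apply, one_apply, eq_comm]

theorem posDef_realGradMat (hn : 1 ≤ n) (h : IsRounding W X) : (realGradMat G W).PosDef := by
  have h1 : (1 : ℝ) ≤ n := by exact_mod_cast hn
  have hD := cast_denom_pos hn
  have hqD := cast_stepInv_le_cast_denom hn
  have hentry : ∀ u v,
      |(realGradMat G W - ((shiftWeight n : ℝ) * denom n) • (1 : Matrix (Fin n) (Fin n) ℝ)) u v| ≤
        denom n * (1 + 2 * (n : ℝ) ^ 4 * (n + 2)) := fun u v => by
    have hdec : (realGradMat G W -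
          ((shiftWeight n : ℝ) * denom n) • (1 : Matrix (Fin n) (Fin n) ℝ)) u v =
        (realGradMat G W - (denom n : ℝ) • (gradient G X + (shiftWeight n : ℝ) • 1)) u v +
          denom n * gradient G X u v := by
      simp only [Matrix.sub_apply, Matrix.add_apply, Matrix.smul_apply, smul_eq_mul]
      ring
    rw [hdec]
    refine (abs_add_le _ _).trans ?_
    rw [abs_mul, abs_of_pos hD]
    have hgrad := mul_le_mul_of_nonneg_left (abs_gradient_le G h.isDensity u v) hD.le
    have hround := (abs_realGradMat_sub_le G h u v).trans
      (mul_le_mul_of_nonneg_left hqD (by positivity))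
    linarith
  have hshift : (Fintype.card (Fin n) : ℝ) * (denom n * (1 + 2 * (n : ℝ) ^ 4 * (n + 2))) ≤
      (shiftWeight n - 1) * denom n := by
    have h5 : (n : ℝ) ^ 5 ≤ (n : ℝ) ^ 6 := pow_le_pow_right₀ h1 (by norm_num)
    have h0 : (n : ℝ) ≤ (n : ℝ) ^ 6 := le_self_pow₀ h1 (by norm_num)
    rw [Fintype.card_fin, cast_shiftWeight]
    calc (n : ℝ) * (denom n * (1 + 2 * (n : ℝ) ^ 4 * (n + 2)))
        = (n + 2 * (n : ℝ) ^ 6 + 4 * (n : ℝ) ^ 5) * denom n := by ring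
      _ ≤ (8 * (n : ℝ) ^ 6 - 1) * denom n := by gcongr; linarith
  have hherm : (realGradMat G W -
      ((shiftWeight n : ℝ) * denom n) • (1 : Matrix (Fin n) (Fin n) ℝ)).IsHermitian :=
    (isHermitian_realGradMat G h.isSymm).sub (by simp [IsHermitian])
  have hposDef : ((denom n : ℝ) • (1 : Matrix (Fin n) (Fin n) ℝ)).PosDef := PosDef.one.smul hD
  convert hposDef.add_posSemidef (posSemidef_add_smul_one hherm hentry hshift) using 1
  module

theorem trace_realGradMat_le (hn : 1 ≤ n) (h : IsRounding W X) :
    (realGradMat G W).trace ≤ 13 * (n : ℝ) ^ 7 * denom n := by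
  have h1 : (1 : ℝ) ≤ n := by exact_mod_cast hn
  have hD := cast_denom_pos hn
  have h4 : (n : ℝ) ^ 4 ≤ (n : ℝ) ^ 6 := pow_le_pow_right₀ h1 (by norm_num)
  have h0 : (1 : ℝ) ≤ (n : ℝ) ^ 6 := one_le_pow₀ h1
  have hdiag : ∀ u, realGradMat G W u u ≤ 13 * (n : ℝ) ^ 6 * denom n := fun u => by
    have hround := (le_abs_self _).trans (abs_realGradMat_sub_le G h u u)
    have hX : 0 ≤ (n : ℝ) ^ 4 * X u u :=
      mul_nonneg (by positivity) h.isDensity.posSemidef.diag_nonneg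
    simp only [Matrix.sub_apply, Matrix.add_apply, Matrix.smul_apply, smul_eq_mul, one_apply_eq,
      gradient, of_apply, mask_self, cast_penWeight, cast_shiftWeight, Int.cast_one] at hround
    have hround' : realGradMat G W u u ≤
        denom n * (1 + 2 * n ^ 4 - 2 * (n ^ 4 * X u u) + 8 * n ^ 6) + 2 * n ^ 4 * stepInv n := by
      linarith
    calc realGradMat G W u u
        ≤ denom n * (1 + 2 * n ^ 4 - 2 * (n ^ 4 * X u u) + 8 * n ^ 6) + 2 * n ^ 4 * stepInv n :=
          hround'
      _ ≤ denom n * (1 + 2 * n ^ 4 - 2 * 0 + 8 * n ^ 6) + 2 * n ^ 4 * denom n := by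
          have := cast_denom_pos hn
          exact add_le_add (by gcongr)
            (mul_le_mul_of_nonneg_left (cast_stepInv_le_cast_denom hn) (by positivity))
      _ = (1 + 4 * n ^ 4 + 8 * n ^ 6) * denom n := by ring
      _ ≤ 13 * (n : ℝ) ^ 6 * denom n := by gcongr; linarith
  calc (realGradMat G W).trace ≤ ∑ _u : Fin n, 13 * (n : ℝ) ^ 6 * denom n :=
        Finset.sum_le_sum fun u _ => hdiag u
    _ = 13 * (n : ℝ) ^ 7 * denom n := by
        rw [Finset.sum_const, Finset.card_univ, Fintype.card_fin, nsmul_eq_mul]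
        ring

/-- The density matrix towards which `fwStep G W` moves. -/
noncomputable def fwTarget (W : Matrix (Fin n) (Fin n) ℤ) : Matrix (Fin n) (Fin n) ℝ :=
  powDensity (realGradMat G W) (numIter n)

theorem isDensity_fwTarget (hn : 1 ≤ n) (h : IsRounding W X) : IsDensity (fwTarget G W) :=
  isDensity_powDensity hn (posDef_realGradMat G hn h) _

theorem trace_realGradMat_mul_sub_le (hn : 1 ≤ n) (h : IsRounding W X) (hZ : IsDensity Z) :
    (realGradMat G W * (Z - fwTarget G W)).trace ≤ denom n * (1 / 16) := by
  have h1 : (1 : ℝ) ≤ n := by exact_mod_cast hn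
  have hD := cast_denom_pos hn
  have hpos : (0 : ℝ) < numIter n + 1 := by positivity
  refine le_of_mul_le_mul_left ?_ hpos
  calc ((numIter n : ℝ) + 1) * (realGradMat G W * (Z - fwTarget G W)).trace
      ≤ n ^ 2 * (realGradMat G W).trace :=
        add_one_mul_trace_mul_sub_powDensity_le hn (posDef_realGradMat G hn h) hZ _
    _ ≤ n ^ 2 * (13 * (n : ℝ) ^ 7 * denom n) := by gcongr; exact trace_realGradMat_le G hn h
    _ = 13 * (n : ℝ) ^ 9 * denom n := by ring
    _ ≤ 64 * (n : ℝ) ^ 11 * denom n := by gcongr <;> norm_num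
    _ ≤ (numIter n + 1) * (denom n * (1 / 16)) := by rw [cast_numIter]; nlinarith

theorem trace_gradient_mul_sub_le (hn : 1 ≤ n) (h : IsRounding W X) (hZ : IsDensity Z) :
    (gradient G X * (Z - fwTarget G W)).trace ≤ 1 / 8 := by
  have hD := cast_denom_pos hn
  have hY := isDensity_fwTarget G hn h
  have htr : (Z - fwTarget G W).trace = 0 := by rw [trace_sub, hZ.trace_eq, hY.trace_eq, sub_self]
  have hround := abs_trace_mul_le (abs_realGradMat_sub_le G h) (hZ.abs_sub_le hY)
  have hexpand :
      ((realGradMat G W - (denom n : ℝ) • (gradient G X + (shiftWeight n : ℝ) • 1)) *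
        (Z - fwTarget G W)).trace = (realGradMat G W * (Z - fwTarget G W)).trace -
          denom n * (gradient G X * (Z - fwTarget G W)).trace := by
    rw [sub_mul, trace_sub, smul_mul_assoc, trace_smul, add_mul, trace_add, smul_mul_assoc, one_mul,
      trace_smul, htr, smul_zero, add_zero, smul_eq_mul]
  have hsize : (n : ℝ) ^ 2 * (2 * (n : ℝ) ^ 4 * stepInv n * (2 * n)) = denom n * (1 / 16) := by
    rw [cast_stepInv, cast_denom]
    ring
  rw [Fintype.card_fin, hexpand, hsize] at hround
  refine le_of_mul_le_mul_left ?_ hD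
  linarith [neg_le_of_abs_le hround, trace_realGradMat_mul_sub_le G hn h hZ]

theorem abs_intCast_ediv_sub_div_le {a b : ℤ} (hb : 0 < b) :
    |((a / b : ℤ) : ℝ) - a / b| ≤ 1 := by
  have hb' : (0 : ℝ) < b := by exact_mod_cast hb
  have hlow : ((a / b : ℤ) : ℝ) ≤ a / b := by
    rw [le_div_iff₀ hb']
    exact_mod_cast Int.ediv_mul_le a hb.ne'
  have hupp : (a : ℝ) / b ≤ ((a / b : ℤ) : ℝ) + 1 := by
    rw [div_le_iff₀ hb']
    exact_mod_cast (Int.lt_ediv_add_one_mul_self a hb).le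
  rw [abs_le]
  constructor <;> linarith

theorem abs_fwStep_sub_le (hn : 1 ≤ n) (h : IsRounding W X) (u v : Fin n) :
    |(fwStep G W u v : ℝ) - ((1 - 1 / stepInv n) * W u v +
      1 / stepInv n * (denom n * fwTarget G W u v))| ≤ 1 := by
  have hq : (0 : ℝ) < stepInv n := zero_lt_one.trans_le (one_le_cast_stepInv hn)
  have htr := trace_pow_pos hn (posDef_realGradMat G hn h) (numIter n)
  have htrace : (realGradMat G W ^ numIter n).trace = ((gradMat G W ^ numIter n).trace : ℤ) := by
    simp [trace, realGradMat_pow_apply]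
  have htr' : (0 : ℝ) < ((gradMat G W ^ numIter n).trace : ℤ) := htrace ▸ htr
  have hb : 0 < stepInv n * (gradMat G W ^ numIter n).trace := by exact_mod_cast mul_pos hq htr'
  convert abs_intCast_ediv_sub_div_le
    (a := (stepInv n - 1) * W u v * (gradMat G W ^ numIter n).trace +
      n * denom n * (gradMat G W ^ numIter n) u v) hb using 2
  rw [fwStep, of_apply, sub_right_inj, fwTarget, powDensity, Matrix.smul_apply,
    realGradMat_pow_apply, htrace, smul_eq_mul]
  push_cast
  field_simp

theorem isRounding_fwStep (hn : 1 ≤ n) (h : IsRounding W X) :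
    IsRounding (fwStep G W)
      ((1 - 1 / (stepInv n : ℝ)) • X + (1 / (stepInv n : ℝ)) • fwTarget G W) := by
  have hq := one_le_cast_stepInv hn
  have hq0 : (0 : ℝ) < stepInv n := zero_lt_one.trans_le hq
  have hγ : 1 / (stepInv n : ℝ) ≤ 1 := (div_le_one hq0).2 hq
  refine ⟨h.isDensity.convex_comb (isDensity_fwTarget G hn h) (by positivity) hγ,
    .ext fun u v => ?_, fun u v => ?_⟩
  · have hpow : (gradMat G W ^ numIter n) u v = (gradMat G W ^ numIter n) v u := by
      have := ((isHermitian_realGradMat G h.isSymm).pow (numIter n)).apply v u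
      rw [realGradMat_pow_apply, realGradMat_pow_apply, star_trivial] at this
      exact_mod_cast this
    simp only [fwStep, of_apply, h.isSymm.apply, hpow]
  · have hW := mul_le_mul_of_nonneg_left (h.abs_sub_le u v) (sub_nonneg.2 hγ)
    have hq1 : (1 - 1 / (stepInv n : ℝ)) * stepInv n = stepInv n - 1 := by field_simp
    rw [← abs_of_nonneg (sub_nonneg.2 hγ), ← abs_mul, abs_of_nonneg (sub_nonneg.2 hγ), hq1] at hW
    calc _ = |((fwStep G W u v : ℝ) - ((1 - 1 / stepInv n) * W u v +
              1 / stepInv n * (denom n * fwTarget G W u v))) +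
            (1 - 1 / stepInv n) * (W u v - denom n * X u v)| := by
          simp only [Matrix.add_apply, Matrix.smul_apply, smul_eq_mul]
          ring_nf
      _ ≤ 1 + (stepInv n - 1) :=
          (abs_add_le _ _).trans (add_le_add (abs_fwStep_sub_le G hn h u v) hW)
      _ = stepInv n := by ring

theorem objective_sub_fwStep_le (hn : 1 ≤ n) (h : IsRounding W X) (hZ : IsDensity Z) :
    objective G Z -
        objective G ((1 - 1 / (stepInv n : ℝ)) • X + (1 / (stepInv n : ℝ)) • fwTarget G W) ≤
      (1 - 1 / (stepInv n : ℝ)) * (objective G Z - objective G X) +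
        1 / (stepInv n : ℝ) * (1 / 4) := by
  have hcurv : 1 / (stepInv n : ℝ) * (4 * (n : ℝ) ^ 8) = 1 / 16 := by
    rw [cast_stepInv]
    field_simp
    norm_num
  have hq := zero_lt_one.trans_le (one_le_cast_stepInv hn)
  refine (objective_sub_convex_comb_le G h.isDensity (isDensity_fwTarget G hn h) hZ
    (by positivity) (trace_gradient_mul_sub_le G hn h hZ)).trans ?_
  rw [hcurv]
  gcongr
  norm_num

theorem exists_isRounding_fwIter (hn : 1 ≤ n) (t : ℕ) :
    ∃ X, IsRounding (fwIter G t) X ∧ ∀ Z, IsDensity Z → objective G Z - objective G X ≤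
      (1 - 1 / (stepInv n : ℝ)) ^ t * (objective G Z - objective G 1) + 1 / 4 := by
  have hγ : 1 / (stepInv n : ℝ) ≤ 1 :=
    (div_le_one (zero_lt_one.trans_le (one_le_cast_stepInv hn))).2 (one_le_cast_stepInv hn)
  induction t with
  | zero => exact ⟨1, isRounding_one hn, fun Z _ => by simp⟩
  | succ t ih =>
    obtain ⟨X, hX, hgap⟩ := ih
    rw [fwIter, Function.iterate_succ_apply', ← fwIter]
    refine ⟨_, isRounding_fwStep G hn hX, fun Z hZ =>
      (objective_sub_fwStep_le G hn hX hZ).trans ?_⟩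
    have := mul_le_mul_of_nonneg_left (hgap Z hZ) (sub_nonneg.2 hγ)
    rw [pow_succ]
    linarith

theorem abs_fwIter_le (hn : 1 ≤ n) (t : ℕ) (u v : Fin n) :
    |fwIter G t u v| ≤ denom n * n + stepInv n := by
  obtain ⟨X, hX, -⟩ := exists_isRounding_fwIter G hn t
  exact abs_apply_le_of_isRounding hn hX u v

theorem one_sub_pow_mul_one_add_mul_le {γ : ℝ} (h0 : 0 ≤ γ) (h1 : γ ≤ 1) (N : ℕ) :
    (1 - γ) ^ N * (1 + N * γ) ≤ 1 :=
  calc (1 - γ) ^ N * (1 + N * γ) ≤ (1 - γ) ^ N * (1 + γ) ^ N :=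
        mul_le_mul_of_nonneg_left (one_add_mul_le_pow (by linarith) N)
          (pow_nonneg (sub_nonneg.2 h1) N)
    _ = (1 - γ ^ 2) ^ N := by rw [← mul_pow]; ring
    _ ≤ 1 := pow_le_one₀ (by nlinarith) (by nlinarith)

theorem objective_le (hZ : IsDensity Z) : objective G Z ≤ (n : ℝ) ^ 3 :=
  calc objective G Z ≤ ∑ _u : Fin n, ∑ _v : Fin n, (n : ℝ) := by
        refine Finset.sum_le_sum fun u _ => Finset.sum_le_sum fun v _ => ?_
        exact (sub_le_self _ (mul_nonneg (by simp)
          (mul_nonneg (cast_mask_nonneg G u v) (sq_nonneg _)))).trans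
          (le_of_abs_le (hZ.abs_le u v))
    _ = (n : ℝ) ^ 3 := by simp; ring

theorem objective_one : objective G 1 = n := by
  simp [objective, one_apply]

/-- `X` maximizes the penalized objective over the density matrices up to an additive error `1`. -/
structure IsNearlyOptimal (X : Matrix (Fin n) (Fin n) ℝ) : Prop where
  isDensity : IsDensity X
  sub_le : ∀ Z, IsDensity Z → objective G Z - objective G X ≤ 1

theorem exists_isRounding_fwIter_numIter (hn : 1 ≤ n) :
    ∃ X, IsRounding (fwIter G (numIter n)) X ∧ IsNearlyOptimal G X := by
  obtain ⟨X, hX, hgap⟩ := exists_isRounding_fwIter G hn (numIter n)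
  refine ⟨X, hX, hX.isDensity, fun Z hZ => (hgap Z hZ).trans ?_⟩
  have hq := zero_lt_one.trans_le (one_le_cast_stepInv hn)
  have hγ : 1 / (stepInv n : ℝ) ≤ 1 := (div_le_one hq).2 (one_le_cast_stepInv hn)
  have hNγ : (numIter n : ℝ) * (1 / stepInv n) = 16 * (n : ℝ) ^ 3 := by
    rw [cast_numIter, cast_stepInv]
    field_simp
    norm_num
  have hdecay := one_sub_pow_mul_one_add_mul_le (by positivity) hγ (numIter n)
  rw [hNγ] at hdecay
  have hpow : 0 ≤ (1 - 1 / (stepInv n : ℝ)) ^ numIter n := pow_nonneg (sub_nonneg.2 hγ) _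
  have hone : 0 ≤ objective G 1 := (objective_one G).symm ▸ n.cast_nonneg
  have hobj := mul_le_mul_of_nonneg_left ((sub_le_self _ hone).trans (objective_le G hZ)) hpow
  linarith

end Rounding

end FrankWolfe

/-! ### Uniformly random subsets -/

section HalfLaw

open MeasureTheory ProbabilityTheory

variable {ι : Type*} [Countable ι] (U : Finset ι)

/-- The law of the random subset of `U` that takes each element independently with probability
`1/2`. -/
noncomputable abbrev halfLaw : Measure (Set ι) :=
  setBernoulli (U : Set ι) ⟨1 / 2, by norm_num, by norm_num⟩

theorem halfLaw_real_singleton {s : Finset ι} (hs : s ⊆ U) :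
    (halfLaw U).real {(s : Set ι)} = 1 / 2 ^ U.card := by
  classical
  rw [setBernoulli_real_singleton _ (by exact_mod_cast hs) U.finite_toSet, ← Finset.coe_sdiff,
    Set.ncard_coe_finset, Set.ncard_coe_finset, ← Finset.card_sdiff_add_card_eq_card hs, pow_add]
  norm_num
  simp only [one_div, inv_pow]

open Classical in
theorem halfLaw_real_le_card_div (A : Set (Set ι)) :
    (halfLaw U).real A ≤
      (U.powerset.filter fun s : Finset ι => (s : Set ι) ∈ A).card / 2 ^ U.card := by
  set F : Finset (Finset ι) := U.powerset.filter fun s : Finset ι => (s : Set ι) ∈ A with hF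
  have hcover : {s ∈ A | s ⊆ (U : Set ι)} ⊆ ⋃ s ∈ F, {(s : Set ι)} := by
    rintro s ⟨hs, hsU⟩
    obtain ⟨t, rfl⟩ := (U.finite_toSet.subset hsU).exists_finset_coe
    exact Set.mem_biUnion (x := t) (by simpa [hF, hs] using hsU) rfl
  calc (halfLaw U).real A = (halfLaw U).real {s ∈ A | s ⊆ (U : Set ι)} := by
        rw [measureReal_def, measureReal_def, setBernoulli_apply_eq_apply_subsets]
    _ ≤ (halfLaw U).real (⋃ s ∈ F, {(s : Set ι)}) := measureReal_mono hcover (measure_ne_top _ _)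
    _ ≤ ∑ s ∈ F, (halfLaw U).real {(s : Set ι)} := measureReal_biUnion_finset_le _ _
    _ = ∑ _s ∈ F, 1 / 2 ^ U.card :=
        Finset.sum_congr rfl fun _ hs =>
          halfLaw_real_singleton U (Finset.mem_powerset.1 (Finset.mem_filter.1 hs).1)
    _ = F.card / 2 ^ U.card := by rw [Finset.sum_const, nsmul_eq_mul, mul_one_div]

theorem halfLaw_real_le_prod [DecidableEq ι] (A : Set (Set ι)) {a b : ι → ℝ} (ha : ∀ i, 0 ≤ a i)
    (hb : ∀ i, 0 ≤ b i) {c : ℝ} (hc : 0 ≤ c)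
    (hA : ∀ s ⊆ U, (s : Set ι) ∈ A → 1 ≤ c * ((∏ i ∈ s, a i) * ∏ i ∈ U \ s, b i)) :
    (halfLaw U).real A ≤ c * ∏ i ∈ U, ((a i + b i) / 2) := by
  classical
  let f : Finset ι → ℝ := fun s => c * ((∏ i ∈ s, a i) * ∏ i ∈ U \ s, b i)
  have hf : ∀ s, 0 ≤ f s := fun s => mul_nonneg hc
    (mul_nonneg (Finset.prod_nonneg fun i _ => ha i) (Finset.prod_nonneg fun i _ => hb i))
  let F : Finset (Finset ι) := U.powerset.filter fun s : Finset ι => (s : Set ι) ∈ A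
  have hcard : (F.card : ℝ) ≤ ∑ s ∈ U.powerset, f s :=
    calc (F.card : ℝ) = ∑ s ∈ F, 1 := by simp
      _ ≤ ∑ s ∈ F, f s := Finset.sum_le_sum fun s hs =>
          hA s (Finset.mem_powerset.1 (Finset.mem_filter.1 hs).1) (Finset.mem_filter.1 hs).2
      _ ≤ ∑ s ∈ U.powerset, f s :=
          Finset.sum_le_sum_of_subset_of_nonneg (Finset.filter_subset _ _) fun s _ _ => hf s
  calc (halfLaw U).real A ≤ F.card / 2 ^ U.card := halfLaw_real_le_card_div U A
    _ ≤ (∑ s ∈ U.powerset, f s) / 2 ^ U.card := by gcongr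
    _ = c * ∏ i ∈ U, ((a i + b i) / 2) := by
        rw [← Finset.mul_sum, ← Finset.prod_add, Finset.prod_div_distrib, Finset.prod_const,
          mul_div_assoc]

open Classical in
/-- The Rademacher variable of `i`: `-1` on the set `E`, and `1` off it. -/
noncomputable def sgn (E : Set ι) (i : ι) : ℝ := if i ∈ E then -1 else 1

omit [Countable ι] in
theorem sum_sgn_mul_eq [DecidableEq ι] {s : Finset ι} (hs : s ⊆ U) (t : ι → ℝ) :
    ∑ i ∈ U, sgn (s : Set ι) i * t i = ∑ i ∈ s, -t i + ∑ i ∈ U \ s, t i := by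
  rw [← Finset.sum_sdiff hs, add_comm]
  congr 1
  · exact Finset.sum_congr rfl fun i hi => by simp [sgn, hi]
  · exact Finset.sum_congr rfl fun i hi => by simp [sgn, (Finset.mem_sdiff.1 hi).2]

theorem halfLaw_real_le_sum_sgn_mul_le (t : ι → ℝ) (T : ℝ) :
    (halfLaw U).real {E | T ≤ ∑ i ∈ U, sgn E i * t i} ≤ Real.exp ((∑ i ∈ U, t i ^ 2) / 2 - T) := by
  classical
  have hmarkov : ∀ s ⊆ U, (s : Set ι) ∈ {E | T ≤ ∑ i ∈ U, sgn E i * t i} → 1 ≤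
      Real.exp (-T) * ((∏ i ∈ s, Real.exp (-t i)) * ∏ i ∈ U \ s, Real.exp (t i)) := by
    intro s hs hT
    rw [← Real.exp_sum, ← Real.exp_sum, ← Real.exp_add, ← Real.exp_add, Real.one_le_exp_iff,
      ← sum_sgn_mul_eq U hs]
    exact le_neg_add_iff_add_le.2 (by simpa using hT)
  have hcosh : ∀ i ∈ U, (Real.exp (-t i) + Real.exp (t i)) / 2 ≤ Real.exp (t i ^ 2 / 2) :=
    fun i _ => by
      rw [add_comm, ← Real.cosh_eq]
      exact Real.cosh_le_exp_half_sq (t i)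
  calc _ ≤ Real.exp (-T) * ∏ i ∈ U, ((Real.exp (-t i) + Real.exp (t i)) / 2) :=
        halfLaw_real_le_prod U _ (fun i => (Real.exp_pos _).le) (fun i => (Real.exp_pos _).le)
          (Real.exp_pos _).le hmarkov
    _ ≤ Real.exp (-T) * ∏ i ∈ U, Real.exp (t i ^ 2 / 2) := by
        gcongr with i hi
        exact hcosh i hi
    _ = Real.exp ((∑ i ∈ U, t i ^ 2) / 2 - T) := by
        rw [← Real.exp_sum, ← Real.exp_add, ← Finset.sum_div, neg_add_eq_sub]

end HalfLaw

/-! ### A net of lattice points -/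

section LatticeBall

theorem exp_neg_sq_le (j : ℤ) : Real.exp (-(j : ℝ) ^ 2) ≤ (1 / 2 : ℝ) ^ j.natAbs := by
  have hexp : Real.exp (-1) ≤ 1 / 2 := by
    rw [Real.exp_neg, one_div]
    gcongr
    linarith [Real.add_one_le_exp (1 : ℝ)]
  have hsq : (j.natAbs : ℝ) ≤ (j : ℝ) ^ 2 := by
    rw [Nat.cast_natAbs, ← sq_abs]
    exact_mod_cast Int.le_self_sq |j|
  calc Real.exp (-(j : ℝ) ^ 2) ≤ Real.exp (j.natAbs * -1) := by gcongr; linarith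
    _ = Real.exp (-1) ^ j.natAbs := Real.exp_nat_mul _ _
    _ ≤ (1 / 2) ^ j.natAbs := by gcongr

theorem sum_half_pow_natAbs_le (s : Finset ℤ) : ∑ j ∈ s, (1 / 2 : ℝ) ^ j.natAbs ≤ 4 := by
  have hfiber : ∀ m : ℕ, {j ∈ s | j.natAbs = m}.card ≤ 2 := fun m => by
    refine (Finset.card_le_card (t := {(m : ℤ), -(m : ℤ)}) fun j hj => ?_).trans Finset.card_le_two
    have := (Finset.mem_filter.1 hj).2
    simp only [Finset.mem_insert, Finset.mem_singleton]
    omega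
  calc ∑ j ∈ s, (1 / 2 : ℝ) ^ j.natAbs
      = ∑ m ∈ s.image Int.natAbs, {j ∈ s | j.natAbs = m}.card • (1 / 2 : ℝ) ^ m :=
        Finset.sum_comp (fun m : ℕ => (1 / 2 : ℝ) ^ m) Int.natAbs
    _ ≤ ∑ m ∈ s.image Int.natAbs, 2 * (1 / 2 : ℝ) ^ m := by
        refine Finset.sum_le_sum fun m _ => ?_
        rw [nsmul_eq_mul]
        gcongr
        exact_mod_cast hfiber m
    _ ≤ 2 * 2 := by
        rw [← Finset.mul_sum]
        gcongr
        exact (summable_geometric_two.sum_le_tsum _ fun m _ => by positivity).trans_eq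
          tsum_geometric_two
    _ = 4 := by norm_num

theorem sum_exp_neg_sq_le (s : Finset ℤ) : ∑ j ∈ s, Real.exp (-(j : ℝ) ^ 2) ≤ Real.exp 2 := by
  have hexp : (4 : ℝ) ≤ Real.exp 2 := by
    have h1 := Real.add_one_le_exp (1 : ℝ)
    rw [show (2 : ℝ) = 1 + 1 by norm_num, Real.exp_add]
    nlinarith
  exact (Finset.sum_le_sum fun j _ => exp_neg_sq_le j).trans
    ((sum_half_pow_natAbs_le s).trans hexp)

variable (ι : Type*) [Fintype ι] [DecidableEq ι]

/-- The lattice points in the ball whose squared radius is seven times the dimension. The factor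
seven makes the ball contain a rounding of every point of squared norm at most four times the
dimension. -/
noncomputable def latticeBall : Finset (ι → ℤ) :=
  {z ∈ Fintype.piFinset fun _ => Finset.Icc (-(7 * Fintype.card ι : ℤ)) (7 * Fintype.card ι) |
    ∑ i, z i ^ 2 ≤ 7 * Fintype.card ι}

variable {ι}

theorem mem_latticeBall {z : ι → ℤ} : z ∈ latticeBall ι ↔ ∑ i, z i ^ 2 ≤ 7 * Fintype.card ι := by
  simp only [latticeBall, Finset.mem_filter, Fintype.mem_piFinset, ← abs_le, Finset.mem_Icc,
    and_iff_right_iff_imp]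
  intro hz i
  calc |z i| ≤ z i ^ 2 := sq_abs (z i) ▸ Int.le_self_sq |z i|
    _ ≤ ∑ i, z i ^ 2 :=
        Finset.single_le_sum (f := fun i => z i ^ 2) (fun i _ => sq_nonneg _) (Finset.mem_univ i)
    _ ≤ 7 * Fintype.card ι := hz

variable (ι) in
theorem card_latticeBall_le : ((latticeBall ι).card : ℝ) ≤ Real.exp (9 * Fintype.card ι) := by
  set N : ℕ := Fintype.card ι with hN
  calc ((latticeBall ι).card : ℝ) = ∑ _z ∈ latticeBall ι, (1 : ℝ) := by simp
    _ ≤ ∑ z ∈ latticeBall ι, Real.exp (7 * N) * ∏ i, Real.exp (-(z i : ℝ) ^ 2) := by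
        refine Finset.sum_le_sum fun z hz => ?_
        have hz' : ∑ i, (z i : ℝ) ^ 2 ≤ 7 * N := by exact_mod_cast mem_latticeBall.1 hz
        rw [← Real.exp_sum, ← Real.exp_add, Real.one_le_exp_iff, Finset.sum_neg_distrib]
        linarith
    _ ≤ ∑ z ∈ Fintype.piFinset fun _ : ι => Finset.Icc (-(7 * N : ℤ)) (7 * N),
          Real.exp (7 * N) * ∏ i, Real.exp (-(z i : ℝ) ^ 2) :=
        Finset.sum_le_sum_of_subset_of_nonneg (Finset.filter_subset _ _) fun z _ _ => by positivity
    _ = Real.exp (7 * N) *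
          ∏ _i : ι, ∑ j ∈ Finset.Icc (-(7 * N : ℤ)) (7 * N), Real.exp (-(j : ℝ) ^ 2) := by
        rw [← Finset.mul_sum, Finset.prod_univ_sum]
    _ ≤ Real.exp (7 * N) * ∏ _i : ι, Real.exp 2 := by
        gcongr
        exact sum_exp_neg_sq_le _
    _ = Real.exp (9 * N) := by
        rw [Finset.prod_const, Finset.card_univ, ← hN, ← Real.exp_nat_mul, ← Real.exp_add]
        ring_nf

theorem exists_mem_latticeBall_of_sum_sq_le {x : ι → ℝ}
    (hx : ∑ i, x i ^ 2 ≤ 4 * (Fintype.card ι : ℝ)) :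
    ∃ z ∈ latticeBall ι, ∑ i, (4 / 5 * (z i : ℝ)) ^ 2 ≤ 4 * (Fintype.card ι : ℝ) ∧
      ∑ i, (4 * (x i - z i)) ^ 2 ≤ 4 * (Fintype.card ι : ℝ) := by
  have hdist : ∀ i, (x i - round (x i)) ^ 2 ≤ 1 / 4 := fun i => by
    have := abs_le.1 (abs_sub_round (x i))
    nlinarith
  have hsq : ∀ i, (round (x i) : ℝ) ^ 2 ≤ 5 / 4 * x i ^ 2 + 5 / 4 := fun i => by
    nlinarith [hdist i, sq_nonneg (x i / 2 + 2 * (x i - round (x i)))]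
  have hsum : ∑ i, (round (x i) : ℝ) ^ 2 ≤ 25 / 4 * Fintype.card ι :=
    calc ∑ i, (round (x i) : ℝ) ^ 2 ≤ ∑ i, (5 / 4 * x i ^ 2 + 5 / 4) :=
          Finset.sum_le_sum fun i _ => hsq i
      _ = 5 / 4 * ∑ i, x i ^ 2 + Fintype.card ι * (5 / 4) := by
          rw [Finset.sum_add_distrib, ← Finset.mul_sum, Finset.sum_const, Finset.card_univ,
            nsmul_eq_mul]
      _ ≤ 25 / 4 * Fintype.card ι := by linarith
  have : (0 : ℝ) ≤ Fintype.card ι := Nat.cast_nonneg _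
  refine ⟨fun i => round (x i), mem_latticeBall.2 ?_, ?_, ?_⟩
  · have : ∑ i, (round (x i) : ℝ) ^ 2 ≤ 7 * Fintype.card ι := by linarith
    exact_mod_cast this
  · simp only [mul_pow, ← Finset.mul_sum]
    linarith
  · calc ∑ i, (4 * (x i - round (x i))) ^ 2 ≤ ∑ _i : ι, (4 : ℝ) :=
          Finset.sum_le_sum fun i _ => by linarith [mul_pow 4 (x i - round (x i)) 2, hdist i]
      _ = 4 * Fintype.card ι := by simp [mul_comm]

omit [DecidableEq ι] in
theorem isCompact_setOf_sum_sq_le (c : ℝ) : IsCompact {x : ι → ℝ | ∑ i, x i ^ 2 ≤ c} := by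
  refine (isCompact_Icc (a := fun _ : ι => -(c + 1)) (b := fun _ => c + 1)).of_isClosed_subset
    (isClosed_le (by fun_prop) continuous_const) fun x hx => ?_
  have hle : ∀ i, x i ^ 2 ≤ c := fun i =>
    (Finset.single_le_sum (f := fun i => x i ^ 2) (fun i _ => sq_nonneg _)
      (Finset.mem_univ i)).trans hx
  exact ⟨fun i => by nlinarith [hle i], fun i => by nlinarith [hle i]⟩

/- At a maximizer over the ball, rounding both arguments to lattice points loses only a fraction
`9 / 16` of the maximum, since the rounding errors lie in a multiple of the ball. -/
theorem bilin_le_of_latticeBall (m : ι → ι → ℝ) {T : ℝ}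
    (hT : ∀ z ∈ latticeBall ι, ∀ w ∈ latticeBall ι, ∑ u, ∑ v, m u v * (z u * w v) ≤ T)
    {x y : ι → ℝ} (hx : ∑ i, x i ^ 2 ≤ 4 * (Fintype.card ι : ℝ))
    (hy : ∑ i, y i ^ 2 ≤ 4 * (Fintype.card ι : ℝ)) :
    ∑ u, ∑ v, m u v * (x u * y v) ≤ 16 / 7 * T := by
  let Q : (ι → ℝ) → (ι → ℝ) → ℝ := fun x y => ∑ u, ∑ v, m u v * (x u * y v)
  let K : Set (ι → ℝ) := {x | ∑ i, x i ^ 2 ≤ 4 * (Fintype.card ι : ℝ)}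
  have hK : IsCompact K := isCompact_setOf_sum_sq_le _
  have hQ : Continuous fun p : (ι → ℝ) × (ι → ℝ) => Q p.1 p.2 := by
    simp only [Q]
    fun_prop
  obtain ⟨⟨a, b⟩, ⟨ha, hb⟩, hmax⟩ :=
    (hK.prod hK).exists_isMaxOn ⟨(x, y), hx, hy⟩ hQ.continuousOn
  have hmax' : ∀ x ∈ K, ∀ y ∈ K, Q x y ≤ Q a b := fun x hx y hy => hmax (a := (x, y)) ⟨hx, hy⟩
  obtain ⟨z, hz, hzK, hazK⟩ := exists_mem_latticeBall_of_sum_sq_le ha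
  obtain ⟨w, hw, -, hbwK⟩ := exists_mem_latticeBall_of_sum_sq_le hb
  have hsplit : Q a b = ∑ u, ∑ v, m u v * (z u * w v) +
      5 / 16 * Q (fun i => 4 / 5 * (z i : ℝ)) (fun i => 4 * (b i - w i)) +
      1 / 4 * Q (fun i => 4 * (a i - z i)) b := by
    simp only [Q, Finset.mul_sum, ← Finset.sum_add_distrib]
    exact Finset.sum_congr rfl fun u _ => Finset.sum_congr rfl fun v _ => by ring
  linarith [hT z hz w hw, hmax' _ hzK _ hbwK, hmax' _ hazK b hb, hmax' x hx y hy]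

omit [DecidableEq ι] in
theorem exists_eq_smul_of_sum_sq (x : ι → ℝ) :
    ∃ x' : ι → ℝ, ∑ i, x' i ^ 2 ≤ 4 * (Fintype.card ι : ℝ) ∧
      x = (√(∑ i, x i ^ 2) / (2 * √(Fintype.card ι))) • x' := by
  set a := √(∑ i, x i ^ 2) with ha
  set r := √(Fintype.card ι : ℝ)
  have ha2 : a ^ 2 = ∑ i, x i ^ 2 := Real.sq_sqrt (Finset.sum_nonneg fun i _ => sq_nonneg _)
  have hr2 : r ^ 2 = Fintype.card ι := Real.sq_sqrt (Nat.cast_nonneg _)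
  by_cases ha0 : a = 0
  · have hx : ∑ i, x i ^ 2 = 0 := by rw [← ha2, ha0, zero_pow two_ne_zero]
    refine ⟨0, by simp, funext fun i => ?_⟩
    simpa using (Finset.sum_eq_zero_iff_of_nonneg fun i _ => sq_nonneg (x i)).1 hx i
      (Finset.mem_univ i)
  · have hr0 : r ≠ 0 := fun hr0 => ha0 <| by
      have : IsEmpty ι := Fintype.card_eq_zero_iff.1 (by simpa [hr0] using hr2.symm)
      simp [ha]
    refine ⟨(2 * r / a) • x, le_of_eq ?_, ?_⟩
    · simp only [Pi.smul_apply, smul_eq_mul, mul_pow, ← Finset.mul_sum, ← ha2, ← hr2]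
      field_simp
      norm_num
    · rw [smul_smul, div_mul_div_cancel₀' ha0, div_self (by positivity), one_smul]

theorem bilin_le_sqrt_mul_sqrt_of_latticeBall (m : ι → ι → ℝ) {T : ℝ}
    (hT : ∀ z ∈ latticeBall ι, ∀ w ∈ latticeBall ι, ∑ u, ∑ v, m u v * (z u * w v) ≤ T)
    (x y : ι → ℝ) :
    ∑ u, ∑ v, m u v * (x u * y v) ≤
      4 / 7 * T / Fintype.card ι * (√(∑ i, x i ^ 2) * √(∑ i, y i ^ 2)) := by
  set a := √(∑ i, x i ^ 2)
  set b := √(∑ i, y i ^ 2)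
  set r := √(Fintype.card ι : ℝ)
  have hr2 : r ^ 2 = Fintype.card ι := Real.sq_sqrt (Nat.cast_nonneg _)
  obtain ⟨x', hx', hxx'⟩ := exists_eq_smul_of_sum_sq x
  obtain ⟨y', hy', hyy'⟩ := exists_eq_smul_of_sum_sq y
  calc ∑ u, ∑ v, m u v * (x u * y v)
      = a / (2 * r) * (b / (2 * r)) * ∑ u, ∑ v, m u v * (x' u * y' v) := by
        rw [hxx', hyy']
        simp only [Finset.mul_sum, Pi.smul_apply, smul_eq_mul]
        exact Finset.sum_congr rfl fun u _ => Finset.sum_congr rfl fun v _ => by ring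
    _ ≤ a / (2 * r) * (b / (2 * r)) * (16 / 7 * T) := by
        gcongr
        exact bilin_le_of_latticeBall m hT hx' hy'
    _ = 4 / 7 * T / Fintype.card ι * (a * b) := by
        rw [← hr2]
        ring

theorem sum_sum_le_sqrt_mul_sqrt_of_latticeBall (m : ι → ι → ℝ) (S S' : Finset ι) {T : ℝ}
    (hT : ∀ z ∈ latticeBall ι, ∀ w ∈ latticeBall ι,
      ∑ u ∈ S, ∑ v ∈ S', m u v * (z u * w v) ≤ T) (x y : ι → ℝ) :
    ∑ u ∈ S, ∑ v ∈ S', m u v * (x u * y v) ≤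
      4 / 7 * T / Fintype.card ι * (√(∑ u ∈ S, x u ^ 2) * √(∑ v ∈ S', y v ^ 2)) := by
  let m' : ι → ι → ℝ := fun u v => if u ∈ S then if v ∈ S' then m u v else 0 else 0
  have hm' : ∀ x y : ι → ℝ, ∑ u, ∑ v, m' u v * (x u * y v) =
      ∑ u ∈ S, ∑ v ∈ S', m u v * (x u * y v) := fun x y => by
    simp only [m', ite_mul, zero_mul, Finset.sum_ite_irrel, Finset.sum_const_zero,
      Finset.sum_ite_mem, Finset.univ_inter]
  have hbound := bilin_le_sqrt_mul_sqrt_of_latticeBall m'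
    (fun z hz w hw => (hm' _ _).trans_le (hT z hz w hw))
    (fun u => if u ∈ S then x u else 0) (fun v => if v ∈ S' then y v else 0)
  rw [hm'] at hbound
  simp only [ite_pow, zero_pow two_ne_zero, Finset.sum_ite_mem, Finset.univ_inter] at hbound
  convert hbound using 1
  exact Finset.sum_congr rfl fun u hu => Finset.sum_congr rfl fun v hv => by
    rw [if_pos hu, if_pos hv]

end LatticeBall

/-! ### Typical boundary edges -/

section GoodEdges

open MeasureTheory ProbabilityTheory

open Classical in
/-- The properties of the random boundary edges that are used: no vertex outside `S` has few
neighbours in `S`, and the signed adjacency matrix has small norm. -/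
structure GoodEdges {n : ℕ} (S : Finset (Fin n)) (E : Set (Fin n × Fin n)) : Prop where
  card_lt : ∀ w ∉ S, S.card < 4 * {u ∈ S | (u, w) ∈ E}.card
  spectral : ∀ x y : Fin n → ℝ, ∑ u ∈ S, ∑ v ∈ Sᶜ, sgn E (u, v) * (x u * y v) ≤
    26 * √n * (√(∑ u ∈ S, x u ^ 2) * √(∑ v ∈ Sᶜ, y v ^ 2))

variable {n : ℕ} (S : Finset (Fin n))

theorem boundaryLaw_eq_halfLaw : boundaryLaw S = halfLaw (S ×ˢ Sᶜ) := by
  simp [boundaryLaw, halfLaw]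

instance : IsProbabilityMeasure (boundaryLaw S) := by
  unfold boundaryLaw
  infer_instance

theorem card_filter_snd_eq {α β : Type*} [DecidableEq α] [DecidableEq β] {s : Finset (α × β)}
    {A : Finset α} (hs : ∀ i ∈ s, i.1 ∈ A) (w : β) :
    {i ∈ s | i.2 = w}.card = {u ∈ A | (u, w) ∈ s}.card :=
  Finset.card_bij' (fun i _ => i.1) (fun u _ => (u, w)) (by grind) (by grind) (by grind)
    (by grind)

open Classical in
theorem boundaryLaw_real_card_le {w : Fin n} (hw : w ∉ S) :
    (boundaryLaw S).real {E | 4 * {u ∈ S | (u, w) ∈ E}.card ≤ S.card} ≤ (9 / 10) ^ S.card := by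
  let A : Set (Set (Fin n × Fin n)) := {E | 4 * {u ∈ S | (u, w) ∈ E}.card ≤ S.card}
  have hmarkov : ∀ s ⊆ S ×ˢ Sᶜ, (s : Set (Fin n × Fin n)) ∈ A → 1 ≤
      (6 / 5 : ℝ) ^ S.card *
        ((∏ i ∈ s, if i.2 = w then (1 / 2 : ℝ) else 1) * ∏ _i ∈ (S ×ˢ Sᶜ) \ s, 1) := by
    intro s hs hcard
    rw [Finset.prod_const_one, mul_one, ← Finset.prod_filter, Finset.prod_const,
      card_filter_snd_eq fun i hi => (Finset.mem_product.1 (hs hi)).1]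
    simp only [A, Set.mem_ofPred_eq, SetLike.mem_coe] at hcard
    set d := {u ∈ S | (u, w) ∈ s}.card
    calc (1 : ℝ) ≤ ((6 / 5) ^ 4 * (1 / 2)) ^ d := one_le_pow₀ (by norm_num)
      _ = (6 / 5) ^ (4 * d) * (1 / 2) ^ d := by rw [mul_pow, ← pow_mul]
      _ ≤ (6 / 5) ^ S.card * (1 / 2) ^ d := by
          gcongr
          norm_num
  have hfactor : ∀ v, ((if v = w then (1 / 2 : ℝ) else 1) + 1) / 2 = if v = w then 3 / 4 else 1 :=
    fun v => by split_ifs <;> norm_num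
  calc (boundaryLaw S).real {E | 4 * {u ∈ S | (u, w) ∈ E}.card ≤ S.card}
      ≤ (6 / 5) ^ S.card * ∏ i ∈ S ×ˢ Sᶜ, ((if i.2 = w then (1 / 2 : ℝ) else 1) + 1) / 2 := by
        rw [boundaryLaw_eq_halfLaw]
        exact halfLaw_real_le_prod _ _ (fun i => by split_ifs <;> norm_num)
          (fun _ => zero_le_one) (by positivity) hmarkov
    _ = (6 / 5) ^ S.card * (3 / 4) ^ S.card := by
        simp only [hfactor, Finset.prod_product, Finset.prod_ite_eq', Finset.mem_compl, hw,
          not_false_eq_true, if_true, Finset.prod_const]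
    _ = (9 / 10) ^ S.card := by
        rw [← mul_pow]
        norm_num

theorem sum_sq_le_of_mem_latticeBall {ι : Type*} [Fintype ι] [DecidableEq ι] {z : ι → ℤ}
    (hz : z ∈ latticeBall ι) (A : Finset ι) : ∑ i ∈ A, (z i : ℝ) ^ 2 ≤ 7 * Fintype.card ι :=
  (Finset.sum_le_univ_sum_of_nonneg fun i => sq_nonneg _).trans
    (by exact_mod_cast mem_latticeBall.1 hz)

theorem boundaryLaw_real_le_sum_sgn_mul_le {z w : Fin n → ℤ} (hz : z ∈ latticeBall (Fin n))
    (hw : w ∈ latticeBall (Fin n)) :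
    (boundaryLaw S).real {E | 45 * n * √n ≤ ∑ u ∈ S, ∑ v ∈ Sᶜ, sgn E (u, v) * (z u * w v)} ≤
      Real.exp (-(20 * n)) := by
  rcases n.eq_zero_or_pos with rfl | hn
  · simp
  have hn0 : (0 : ℝ) < n := by exact_mod_cast hn
  set r := √(n : ℝ)
  have hr0 : 0 < r := Real.sqrt_pos.2 hn0
  have hr2 : r * r = n := Real.mul_self_sqrt hn0.le
  -- `σ` minimizes the exponent `49 n² σ² / 2 - 45 n √n σ`.
  let σ : ℝ := 45 / (49 * r)
  have hset : {E | 45 * n * r ≤ ∑ u ∈ S, ∑ v ∈ Sᶜ, sgn E (u, v) * ((z u : ℝ) * w v)} ⊆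
      {E | σ * (45 * n * r) ≤ ∑ i ∈ S ×ˢ Sᶜ, sgn E i * (σ * ((z i.1 : ℝ) * w i.2))} := by
    intro E hE
    simp only [Set.mem_ofPred_eq, mul_left_comm _ σ, ← Finset.mul_sum, Finset.sum_product]
    exact mul_le_mul_of_nonneg_left hE (by positivity)
  have hvar : ∑ i ∈ S ×ˢ Sᶜ, (σ * ((z i.1 : ℝ) * w i.2)) ^ 2 ≤ σ ^ 2 * (7 * n * (7 * n)) := by
    simp only [mul_pow, ← Finset.mul_sum, Finset.sum_product, ← Finset.sum_mul]
    gcongr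
    · exact (sum_sq_le_of_mem_latticeBall hz S).trans_eq (by simp)
    · exact (sum_sq_le_of_mem_latticeBall hw Sᶜ).trans_eq (by simp)
  have hexp : σ ^ 2 * (7 * n * (7 * n)) / 2 - σ * (45 * n * r) = -(2025 / 98 * n) := by
    simp only [σ, ← hr2]
    field_simp
    norm_num
  calc (boundaryLaw S).real {E | 45 * n * r ≤ ∑ u ∈ S, ∑ v ∈ Sᶜ, sgn E (u, v) * (z u * w v)}
      ≤ (boundaryLaw S).real
          {E | σ * (45 * n * r) ≤ ∑ i ∈ S ×ˢ Sᶜ, sgn E i * (σ * ((z i.1 : ℝ) * w i.2))} :=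
        measureReal_mono hset
    _ ≤ Real.exp ((∑ i ∈ S ×ˢ Sᶜ, (σ * ((z i.1 : ℝ) * w i.2)) ^ 2) / 2 - σ * (45 * n * r)) := by
        rw [boundaryLaw_eq_halfLaw]
        exact halfLaw_real_le_sum_sgn_mul_le _ _ _
    _ ≤ Real.exp (-(20 * n)) := by
        gcongr
        linarith

variable {S} in
theorem spectral_of_latticeBall {E : Set (Fin n × Fin n)}
    (h : ∀ z ∈ latticeBall (Fin n), ∀ w ∈ latticeBall (Fin n),
      ∑ u ∈ S, ∑ v ∈ Sᶜ, sgn E (u, v) * ((z u : ℝ) * w v) ≤ 45 * n * √n) (x y : Fin n → ℝ) :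
    ∑ u ∈ S, ∑ v ∈ Sᶜ, sgn E (u, v) * (x u * y v) ≤
      26 * √n * (√(∑ u ∈ S, x u ^ 2) * √(∑ v ∈ Sᶜ, y v ^ 2)) := by
  refine (sum_sum_le_sqrt_mul_sqrt_of_latticeBall (fun u v => sgn E (u, v)) S Sᶜ h x y).trans ?_
  gcongr
  rw [Fintype.card_fin]
  rcases eq_or_ne (n : ℝ) 0 with hn | hn
  · simp [hn]
  · calc 4 / 7 * (45 * n * √n) / n = 180 / 7 * √n := by
          field_simp
          norm_num
      _ ≤ 26 * √n := by
          gcongr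
          norm_num

open Classical in
theorem boundaryLaw_real_exists_card_le :
    (boundaryLaw S).real (⋃ w ∈ Sᶜ, {E | 4 * {u ∈ S | (u, w) ∈ E}.card ≤ S.card}) ≤
      n * (9 / 10) ^ S.card :=
  calc _ ≤ ∑ w ∈ Sᶜ, (boundaryLaw S).real {E | 4 * {u ∈ S | (u, w) ∈ E}.card ≤ S.card} :=
        measureReal_biUnion_finset_le _ _
    _ ≤ ∑ _w ∈ Sᶜ, (9 / 10) ^ S.card :=
        Finset.sum_le_sum fun w hw => boundaryLaw_real_card_le S (Finset.mem_compl.1 hw)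
    _ = Sᶜ.card * (9 / 10) ^ S.card := by rw [Finset.sum_const, nsmul_eq_mul]
    _ ≤ n * (9 / 10) ^ S.card := by
        gcongr
        exact Sᶜ.card_le_univ.trans_eq (Fintype.card_fin n)

theorem boundaryLaw_real_exists_le_sum_sgn_mul_le :
    (boundaryLaw S).real (⋃ p ∈ latticeBall (Fin n) ×ˢ latticeBall (Fin n),
      {E | 45 * n * √n ≤ ∑ u ∈ S, ∑ v ∈ Sᶜ, sgn E (u, v) * ((p.1 u : ℝ) * p.2 v)}) ≤
      Real.exp (-n) :=
  calc _ ≤ ∑ p ∈ latticeBall (Fin n) ×ˢ latticeBall (Fin n), (boundaryLaw S).real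
          {E | 45 * n * √n ≤ ∑ u ∈ S, ∑ v ∈ Sᶜ, sgn E (u, v) * ((p.1 u : ℝ) * p.2 v)} :=
        measureReal_biUnion_finset_le _ _
    _ ≤ ∑ _p ∈ latticeBall (Fin n) ×ˢ latticeBall (Fin n), Real.exp (-(20 * n)) :=
        Finset.sum_le_sum fun p hp => boundaryLaw_real_le_sum_sgn_mul_le S
          (Finset.mem_product.1 hp).1 (Finset.mem_product.1 hp).2
    _ = (latticeBall (Fin n)).card * (latticeBall (Fin n)).card * Real.exp (-(20 * n)) := by
        rw [Finset.sum_const, nsmul_eq_mul, Finset.card_product, Nat.cast_mul]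
    _ ≤ Real.exp (9 * n) * Real.exp (9 * n) * Real.exp (-(20 * n)) := by
        gcongr <;> exact (card_latticeBall_le (Fin n)).trans_eq (by rw [Fintype.card_fin])
    _ = Real.exp (-2 * n) := by
        rw [← Real.exp_add, ← Real.exp_add]
        ring_nf
    _ ≤ Real.exp (-n) := by
        gcongr
        linarith [n.cast_nonneg (α := ℝ)]

theorem one_sub_le_boundaryLaw_real_goodEdges :
    1 - (Real.exp (-n) + n * (9 / 10) ^ S.card) ≤ (boundaryLaw S).real {E | GoodEdges S E} := by
  classical
  let A : Set (Set (Fin n × Fin n)) := ⋃ w ∈ Sᶜ, {E | 4 * {u ∈ S | (u, w) ∈ E}.card ≤ S.card}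
  let B : Set (Set (Fin n × Fin n)) := ⋃ p ∈ latticeBall (Fin n) ×ˢ latticeBall (Fin n),
    {E | 45 * n * √n ≤ ∑ u ∈ S, ∑ v ∈ Sᶜ, sgn E (u, v) * ((p.1 u : ℝ) * p.2 v)}
  have hcover : (Set.univ : Set (Set (Fin n × Fin n))) ⊆ {E | GoodEdges S E} ∪ (A ∪ B) := by
    intro E _
    by_contra hE
    simp only [A, B, Set.mem_union, Set.mem_iUnion, not_or, not_exists, Set.mem_ofPred_eq,
      not_le] at hE
    obtain ⟨hgood, hA, hB⟩ := hE
    exact hgood ⟨fun w hw => hA w (Finset.mem_compl.2 hw), spectral_of_latticeBall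
      fun z hz w hw => (hB (z, w) (Finset.mem_product.2 ⟨hz, hw⟩)).le⟩
  have hone : 1 ≤ (boundaryLaw S).real ({E | GoodEdges S E} ∪ (A ∪ B)) :=
    (probReal_univ (μ := boundaryLaw S)).symm.trans_le (measureReal_mono hcover)
  linarith [measureReal_union_le (μ := boundaryLaw S) {E | GoodEdges S E} (A ∪ B),
    measureReal_union_le (μ := boundaryLaw S) A B, boundaryLaw_real_exists_card_le S,
    boundaryLaw_real_exists_le_sum_sgn_mul_le S]

end GoodEdges

/-! ### Recovery of the independent set from nearly optimal vectors -/

section Seed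

/-- `A` is a seed of `S`: a subset of `S` that has a neighbour of every vertex outside `S`. If `S`
is independent, then every greedy extension of a seed is `S`. -/
structure IsSeed {V : Type*} (G : SimpleGraph V) (S A : Finset V) : Prop where
  subset : A ⊆ S
  exists_adj : ∀ w ∉ S, ∃ v ∈ A, G.Adj v w

variable {V : Type*} {G : SimpleGraph V} {S A : Finset V}

theorem IsSeed.mono {B : Finset V} (hA : IsSeed G S A) (hAB : A ⊆ B) (hB : B ⊆ S) :
    IsSeed G S B :=
  ⟨hB, fun w hw => (hA.exists_adj w hw).imp fun _ h => ⟨hAB h.1, h.2⟩⟩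

theorem IsSeed.mem_iff (hA : IsSeed G S A) (hS : G.IsIndepSet (S : Set V)) {v : V} :
    v ∈ S ↔ ∀ w ∈ A, ¬ G.Adj w v := by
  refine ⟨fun hv w hw hadj => hS (hA.subset hw) hv hadj.ne hadj, fun h => ?_⟩
  by_contra hv
  obtain ⟨w, hw, hadj⟩ := hA.exists_adj v hv
  exact h w hw hadj

theorem IsSeed.greedyExtend_eq {n : ℕ} {G : SimpleGraph (Fin n)} {S A : Finset (Fin n)}
    (hA : IsSeed G S A) (hS : G.IsIndepSet (S : Set (Fin n))) {l : List (Fin n)}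
    (hl : ∀ v ∈ S, v ∈ A ∨ v ∈ l) : greedyExtend G l A = S := by
  classical
  induction l generalizing A with
  | nil => exact hA.subset.antisymm fun v hv => (hl v hv).resolve_right (by simp)
  | cons a l ih =>
    simp only [greedyExtend, List.foldl_cons, ← hA.mem_iff hS]
    split_ifs with ha
    · exact ih (hA.mono (Finset.subset_insert a A) (Finset.insert_subset ha hA.subset)) (by grind)
    · exact ih hA (by grind)

end Seed

section Center

variable {V F : Type*} [NormedAddCommGroup F] {G : SimpleGraph V} {S : Finset V} {x : V → F} {u : V}

/-- The vector of `u` is a centre of the vectors of `S`: every vertex outside `S` has a neighbour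
whose vector is close to that of `u`. -/
def IsCenter (G : SimpleGraph V) (S : Finset V) (x : V → F) (u : V) : Prop :=
  ∀ w ∉ S, ∃ v, G.Adj v w ∧ ‖x u - x v‖ ≤ 1 / 10

theorem card_filter_le_of_sum_norm_sub_sq_le (hu : ∑ v ∈ S, ‖x u - x v‖ ^ 2 ≤ S.card / 500) :
    ({v ∈ S | 1 / 10 < ‖x u - x v‖}.card : ℝ) ≤ S.card / 5 := by
  have hmarkov : ({v ∈ S | 1 / 10 < ‖x u - x v‖}.card : ℝ) * (1 / 100) ≤ S.card / 500 :=
    calc ({v ∈ S | 1 / 10 < ‖x u - x v‖}.card : ℝ) * (1 / 100)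
        = ∑ v ∈ S with 1 / 10 < ‖x u - x v‖, (1 / 100 : ℝ) := by simp
      _ ≤ ∑ v ∈ S with 1 / 10 < ‖x u - x v‖, ‖x u - x v‖ ^ 2 :=
          Finset.sum_le_sum fun v hv => by nlinarith [(Finset.mem_filter.1 hv).2]
      _ ≤ ∑ v ∈ S, ‖x u - x v‖ ^ 2 :=
          Finset.sum_le_sum_of_subset_of_nonneg (Finset.filter_subset _ _) fun _ _ _ => sq_nonneg _
      _ ≤ S.card / 500 := hu
  linarith

theorem exists_isCenter (hS : S.Nonempty)
    (hdeg : ∀ w ∉ S, ∃ N ⊆ S, S.card < 4 * N.card ∧ ∀ v ∈ N, G.Adj v w)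
    (hsum : ∑ u ∈ S, ∑ v ∈ S, ‖x u - x v‖ ^ 2 ≤ (S.card : ℝ) ^ 2 / 500) :
    ∃ u ∈ S, IsCenter G S x u := by
  obtain ⟨u, hu, hu'⟩ : ∃ u ∈ S, ∑ v ∈ S, ‖x u - x v‖ ^ 2 ≤ (S.card : ℝ) / 500 := by
    refine Finset.exists_le_of_sum_le hS (hsum.trans_eq ?_)
    rw [Finset.sum_const, nsmul_eq_mul]
    ring
  refine ⟨u, hu, fun w hw => ?_⟩
  obtain ⟨N, hN, hcard, hadj⟩ := hdeg w hw
  by_contra! hfar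
  have hsub : N ⊆ {v ∈ S | 1 / 10 < ‖x u - x v‖} := fun v hv =>
    Finset.mem_filter.2 ⟨hN hv, hfar v (hadj v hv)⟩
  have hle : (N.card : ℝ) ≤ S.card / 5 :=
    (Nat.cast_le.2 (Finset.card_le_card hsub)).trans (card_filter_le_of_sum_norm_sub_sq_le hu')
  have hlt : (S.card : ℝ) < 4 * N.card := by exact_mod_cast hcard
  linarith [N.card.cast_nonneg (α := ℝ)]

variable [InnerProductSpace ℝ F]

theorem IsCenter.inner_lt (hu : IsCenter G S x u) (hnorm : ∀ u, |‖x u‖ ^ 2 - 1| ≤ 1 / 100)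
    (hedge : ∀ u v, G.Adj u v → |inner ℝ (x u) (x v)| ≤ 1 / 100) {w : V} (hw : w ∉ S) :
    inner ℝ (x u) (x w) < 4 / 10 := by
  obtain ⟨v, hvw, hdist⟩ := hu w hw
  have hxw : ‖x w‖ ≤ 2 := by nlinarith [(abs_le.1 (hnorm w)).2, norm_nonneg (x w)]
  calc inner ℝ (x u) (x w) = inner ℝ (x v) (x w) + inner ℝ (x u - x v) (x w) := by
        rw [inner_sub_left]
        ring
    _ ≤ 1 / 100 + ‖x u - x v‖ * ‖x w‖ :=
        add_le_add (le_of_abs_le (hedge v w hvw)) (real_inner_le_norm _ _)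
    _ ≤ 1 / 100 + 1 / 10 * 2 := by gcongr
    _ < 4 / 10 := by norm_num

theorem IsCenter.exists_adj_le_inner (hu : IsCenter G S x u)
    (hnorm : ∀ u, |‖x u‖ ^ 2 - 1| ≤ 1 / 100) {w : V} (hw : w ∉ S) :
    ∃ v, G.Adj v w ∧ 6 / 10 ≤ inner ℝ (x u) (x v) := by
  obtain ⟨v, hvw, hdist⟩ := hu w hw
  refine ⟨v, hvw, ?_⟩
  nlinarith [norm_sub_sq_real (x u) (x v), (abs_le.1 (hnorm u)).1, (abs_le.1 (hnorm v)).1,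
    norm_nonneg (x u - x v)]

theorem IsCenter.isSeed (hu : IsCenter G S x u) (hnorm : ∀ u, |‖x u‖ ^ 2 - 1| ≤ 1 / 100)
    (hedge : ∀ u v, G.Adj u v → |inner ℝ (x u) (x v)| ≤ 1 / 100) {A : Finset V}
    (hA : ∀ v, 6 / 10 ≤ inner ℝ (x u) (x v) → v ∈ A)
    (hA' : ∀ v ∈ A, 4 / 10 ≤ inner ℝ (x u) (x v)) : IsSeed G S A where
  subset v hv := by
    by_contra hvS
    exact (hA' v hv).not_gt (hu.inner_lt hnorm hedge hvS)
  exists_adj w hw := by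
    obtain ⟨v, hvw, hinner⟩ := hu.exists_adj_le_inner hnorm hw
    exact ⟨v, hA v hinner, hvw⟩

theorem sum_norm_sub_sq (S : Finset V) (x : V → F) :
    ∑ u ∈ S, ∑ v ∈ S, ‖x u - x v‖ ^ 2 =
      2 * (S.card * ∑ u ∈ S, ‖x u‖ ^ 2 - ∑ u ∈ S, ∑ v ∈ S, inner ℝ (x u) (x v)) := by
  simp only [norm_sub_sq_real, Finset.sum_add_distrib, Finset.sum_sub_distrib, Finset.sum_const,
    nsmul_eq_mul, ← Finset.mul_sum]
  ring

end Center

section Clustering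

variable {n : ℕ} {S : Finset (Fin n)} {E : Set (Fin n × Fin n)}

theorem Admissible.adj {G : SimpleGraph (Fin n)} (h : Admissible S E G) {u v : Fin n}
    (huv : u ≠ v) (hE : (u, v) ∈ E) : G.Adj u v :=
  h.1 (by simp [graphOf, huv, hE])

theorem GoodEdges.exists_subset_adj (hE : GoodEdges S E) {G : SimpleGraph (Fin n)}
    (h : Admissible S E G) {w : Fin n} (hw : w ∉ S) :
    ∃ N ⊆ S, S.card < 4 * N.card ∧ ∀ v ∈ N, G.Adj v w := by
  classical
  refine ⟨{u ∈ S | (u, w) ∈ E}, Finset.filter_subset _ _, by convert hE.card_lt w hw,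
    fun v hv => ?_⟩
  obtain ⟨hvS, hvw⟩ := Finset.mem_filter.1 hv
  exact h.adj (ne_of_mem_of_not_mem hvS hw) hvw

variable {ι : Type*} [Fintype ι] (x : Fin n → EuclideanSpace ℝ ι)

theorem GoodEdges.sum_sgn_mul_inner_le (hE : GoodEdges S E) :
    ∑ u ∈ S, ∑ v ∈ Sᶜ, sgn E (u, v) * inner ℝ (x u) (x v) ≤
      26 * √n * (√(∑ u ∈ S, ‖x u‖ ^ 2) * √(∑ v ∈ Sᶜ, ‖x v‖ ^ 2)) := by
  have hnorm : ∀ A : Finset (Fin n), ∑ u ∈ A, ‖x u‖ ^ 2 = ∑ j : ι, ∑ u ∈ A, x u j ^ 2 :=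
    fun A => by
      rw [Finset.sum_comm]
      simp only [EuclideanSpace.real_norm_sq_eq]
  calc ∑ u ∈ S, ∑ v ∈ Sᶜ, sgn E (u, v) * inner ℝ (x u) (x v)
      = ∑ j : ι, ∑ u ∈ S, ∑ v ∈ Sᶜ, sgn E (u, v) * (x u j * x v j) := by
        rw [Finset.sum_comm (s := Finset.univ)]
        refine Finset.sum_congr rfl fun u _ => ?_
        rw [Finset.sum_comm (s := Finset.univ)]
        refine Finset.sum_congr rfl fun v _ => ?_
        rw [← Finset.mul_sum, PiLp.inner_apply]
        simp [mul_comm]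
    _ ≤ ∑ j : ι, 26 * √n * (√(∑ u ∈ S, x u j ^ 2) * √(∑ v ∈ Sᶜ, x v j ^ 2)) :=
        Finset.sum_le_sum fun j _ => hE.spectral (fun u => x u j) fun v => x v j
    _ = 26 * √n * ∑ j : ι, √(∑ u ∈ S, x u j ^ 2) * √(∑ v ∈ Sᶜ, x v j ^ 2) := by
        rw [Finset.mul_sum]
    _ ≤ 26 * √n * (√(∑ u ∈ S, ‖x u‖ ^ 2) * √(∑ v ∈ Sᶜ, ‖x v‖ ^ 2)) := by
        rw [hnorm, hnorm]
        gcongr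
        exact Real.sum_sqrt_mul_sqrt_le _ (fun j => Finset.sum_nonneg fun _ _ => sq_nonneg _)
          fun j => Finset.sum_nonneg fun _ _ => sq_nonneg _

theorem GoodEdges.sum_inner_le (hE : GoodEdges S E) {C : ℝ} (hC : 0 ≤ C)
    (hedge : ∀ u v, u ≠ v → (u, v) ∈ E → |inner ℝ (x u) (x v)| ≤ C) :
    ∑ u ∈ S, ∑ v ∈ Sᶜ, inner ℝ (x u) (x v) ≤
      26 * √n * (√(∑ u ∈ S, ‖x u‖ ^ 2) * √(∑ v ∈ Sᶜ, ‖x v‖ ^ 2)) + 2 * n ^ 2 * C := by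
  have hsgn : ∀ u ∈ S, ∀ v ∈ Sᶜ,
      inner ℝ (x u) (x v) ≤ sgn E (u, v) * inner ℝ (x u) (x v) + 2 * C := by
    intro u hu v hv
    have huv := ne_of_mem_of_not_mem hu (Finset.mem_compl.1 hv)
    unfold sgn
    split_ifs with h
    · linarith [le_of_abs_le (hedge u v huv h)]
    · linarith
  have hcard : ∀ A : Finset (Fin n), A.card ≤ n := fun A =>
    A.card_le_univ.trans_eq (Fintype.card_fin n)
  calc ∑ u ∈ S, ∑ v ∈ Sᶜ, inner ℝ (x u) (x v)
      ≤ ∑ u ∈ S, ∑ v ∈ Sᶜ, (sgn E (u, v) * inner ℝ (x u) (x v) + 2 * C) :=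
        Finset.sum_le_sum fun u hu => Finset.sum_le_sum fun v hv => hsgn u hu v hv
    _ = ∑ u ∈ S, ∑ v ∈ Sᶜ, sgn E (u, v) * inner ℝ (x u) (x v) + S.card * (Sᶜ.card * (2 * C)) := by
        simp only [Finset.sum_add_distrib, Finset.sum_const, nsmul_eq_mul]
    _ ≤ 26 * √n * (√(∑ u ∈ S, ‖x u‖ ^ 2) * √(∑ v ∈ Sᶜ, ‖x v‖ ^ 2)) + n * (n * (2 * C)) := by
        gcongr
        · exact hE.sum_sgn_mul_inner_le x
        · exact hcard S
        · exact hcard Sᶜ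
    _ = _ := by ring

theorem le_of_mul_rpow_le {c n p k : ℝ} (hc : 0 ≤ c) (hn : 1 ≤ n) (hp : 0 ≤ p)
    (h : c * n ^ p ≤ k) : c ≤ k :=
  (le_mul_of_one_le_right hc (Real.one_le_rpow hn hp)).trans h

theorem nonempty_of_mul_rpow_le {V : Type*} {S : Finset V} {c n p : ℝ} (hc : 0 < c) (hn : 1 ≤ n)
    (hp : 0 ≤ p) (h : c * n ^ p ≤ S.card) : S.Nonempty :=
  Finset.card_pos.1 (Nat.cast_pos.1 (hc.trans_le (le_of_mul_rpow_le hc.le hn hp h)))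

theorem le_mul_sqrt_of_rpow_le {n k : ℝ} (hn : 0 ≤ n) (hk : 0 < k)
    (hnk : 10 ^ 4 * n ^ (2 / 3 : ℝ) ≤ k) : 10 ^ 6 * n ≤ k * √k :=
  calc 10 ^ 6 * n = (10 ^ 4 * n ^ (2 / 3 : ℝ)) ^ (3 / 2 : ℝ) := by
        rw [Real.mul_rpow (by positivity) (by positivity), ← Real.rpow_mul hn,
          ← Real.rpow_natCast 10 4, ← Real.rpow_mul (by norm_num)]
        norm_num
    _ ≤ k ^ (3 / 2 : ℝ) := by gcongr
    _ = k * √k := by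
        rw [Real.sqrt_eq_rpow, show (3 / 2 : ℝ) = 1 + 1 / 2 by norm_num, Real.rpow_add hk,
          Real.rpow_one]

theorem GoodEdges.sum_inner_le_of_norm_le (hE : GoodEdges S E)
    (hnorm : ∀ u, ‖x u‖ ^ 2 ≤ 2) {C : ℝ} (hC : 0 ≤ C) (hCn : n ^ 2 * C ≤ n)
    (hedge : ∀ u v, u ≠ v → (u, v) ∈ E → |inner ℝ (x u) (x v)| ≤ C) :
    ∑ u ∈ S, ∑ v ∈ Sᶜ, inner ℝ (x u) (x v) ≤ 52 * (n * √S.card) + 2 * n := by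
  have hsum : ∀ A : Finset (Fin n), ∑ u ∈ A, ‖x u‖ ^ 2 ≤ 2 * A.card := fun A =>
    (Finset.sum_le_card_nsmul A _ 2 fun u _ => hnorm u).trans_eq (by simp [mul_comm])
  have hcard : (Sᶜ.card : ℝ) ≤ n := by exact_mod_cast Sᶜ.card_le_univ.trans_eq (Fintype.card_fin n)
  calc ∑ u ∈ S, ∑ v ∈ Sᶜ, inner ℝ (x u) (x v)
      ≤ 26 * √n * (√(∑ u ∈ S, ‖x u‖ ^ 2) * √(∑ v ∈ Sᶜ, ‖x v‖ ^ 2)) + 2 * n ^ 2 * C :=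
        hE.sum_inner_le x hC hedge
    _ ≤ 26 * √n * (√(2 * S.card) * √(2 * n)) + 2 * n := by
        gcongr ?_ * (√?_ * √?_) + ?_
        · exact hsum S
        · exact (hsum Sᶜ).trans (by gcongr)
        · linarith
    _ = 26 * (√n * √n) * (√2 * √2) * √S.card + 2 * n := by
        rw [Real.sqrt_mul zero_le_two, Real.sqrt_mul zero_le_two]
        ring
    _ = 52 * (n * √S.card) + 2 * n := by
        rw [Real.mul_self_sqrt zero_le_two, Real.mul_self_sqrt n.cast_nonneg]
        ring

/- The value of `x` is compared with that of the solution in which the vectors of `S` are merged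
into a unit vector orthogonal to all others. -/
theorem GoodEdges.sum_norm_sub_sq_le (hE : GoodEdges S E) (hn : 1 ≤ n)
    (hk : (10 : ℝ) ^ 4 * (n : ℝ) ^ (2 / 3 : ℝ) ≤ S.card) {C : ℝ} (hC : 0 ≤ C)
    (hCn : n ^ 2 * C ≤ n) (hnorm : ∀ u, ‖x u‖ ^ 2 ≤ 2)
    (hedge : ∀ u v, u ≠ v → (u, v) ∈ E → |inner ℝ (x u) (x v)| ≤ C)
    (hopt : S.card * ∑ u ∈ S, ‖x u‖ ^ 2 - ∑ u ∈ S, ∑ v ∈ S, inner ℝ (x u) (x v) ≤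
      2 * ∑ u ∈ S, ∑ v ∈ Sᶜ, inner ℝ (x u) (x v) + 1) :
    ∑ u ∈ S, ∑ v ∈ S, ‖x u - x v‖ ^ 2 ≤ (S.card : ℝ) ^ 2 / 500 := by
  have hn1 : (1 : ℝ) ≤ n := by exact_mod_cast hn
  have hk4 : (10 : ℝ) ^ 4 ≤ S.card := le_of_mul_rpow_le (by norm_num) hn1 (by norm_num) hk
  have hnk := le_mul_sqrt_of_rpow_le n.cast_nonneg (by linarith) hk
  have hboundary := hE.sum_inner_le_of_norm_le x hnorm hC hCn hedge
  rw [sum_norm_sub_sq]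
  set k : ℝ := (S.card : ℝ)
  have hsqrt : 100 ≤ √k := Real.le_sqrt_of_sq_le (by linarith)
  have hn_le : 100 * (n : ℝ) ≤ n * √k := by rw [mul_comm]; gcongr
  have hnk' : 10 ^ 6 * (n * √k) ≤ k ^ 2 :=
    calc 10 ^ 6 * (n * √k) = 10 ^ 6 * n * √k := by ring
      _ ≤ k * √k * √k := by gcongr
      _ = k ^ 2 := by rw [mul_assoc, Real.mul_self_sqrt (by linarith), sq]
  linarith

end Clustering

/-! ### The crude semidefinite program -/

theorem sum_sum_eq_of_symm {V : Type*} [Fintype V] [DecidableEq V] (S : Finset V) {f : V → V → ℝ}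
    (hf : ∀ u v, f u v = f v u) :
    ∑ u, ∑ v, f u v = ∑ u ∈ S, ∑ v ∈ S, f u v + 2 * ∑ u ∈ S, ∑ v ∈ Sᶜ, f u v +
      ∑ u ∈ Sᶜ, ∑ v ∈ Sᶜ, f u v := by
  have hswap : ∑ u ∈ Sᶜ, ∑ v ∈ S, f u v = ∑ u ∈ S, ∑ v ∈ Sᶜ, f u v := by
    rw [Finset.sum_comm]
    simp only [hf]
  have hsplit : ∀ u, ∑ v, f u v = ∑ v ∈ S, f u v + ∑ v ∈ Sᶜ, f u v := fun u =>
    (Finset.sum_add_sum_compl S (f u)).symm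
  rw [← Finset.sum_add_sum_compl S]
  simp only [hsplit, Finset.sum_add_distrib, hswap]
  ring

section Program

variable {n : ℕ} {S : Finset (Fin n)} {E : Set (Fin n × Fin n)} {G : SimpleGraph (Fin n)}
  {x : Fin n → EuclideanSpace ℝ (Fin n)}

theorem isClosed_setOf_isFeasible (G : SimpleGraph (Fin n)) : IsClosed {x | IsFeasible G x} := by
  have hinter : {x | IsFeasible G x} = (⋂ u, {x | ‖x u‖ = 1}) ∩
      ((⋂ u, ⋂ v, {x | (0 : ℝ) ≤ inner ℝ (x u) (x v)}) ∩
        ⋂ u, ⋂ v, ⋂ (_ : G.Adj u v), {x | (inner ℝ (x u) (x v) : ℝ) = 0}) := by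
    ext x
    simp only [Set.mem_inter_iff, Set.mem_iInter, Set.mem_ofPred_eq]
    exact ⟨fun h => ⟨h.1, h.2, h.3⟩, fun h => ⟨h.1, h.2.1, h.2.2⟩⟩
  rw [hinter]
  exact (isClosed_iInter fun u => isClosed_eq (by fun_prop) continuous_const).inter
    ((isClosed_iInter fun u => isClosed_iInter fun v =>
      isClosed_le continuous_const (by fun_prop)).inter
    (isClosed_iInter fun u => isClosed_iInter fun v => isClosed_iInter fun _ =>
      isClosed_eq (by fun_prop) continuous_const))

theorem isCompact_setOf_isFeasible (G : SimpleGraph (Fin n)) : IsCompact {x | IsFeasible G x} := by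
  refine (isCompact_closedBall (0 : Fin n → EuclideanSpace ℝ (Fin n)) 1).of_isClosed_subset
    (isClosed_setOf_isFeasible G) fun x hx => ?_
  rw [mem_closedBall_zero_iff, pi_norm_le_iff_of_nonneg zero_le_one]
  exact fun u => (hx.norm_eq_one u).le

theorem isFeasible_single (G : SimpleGraph (Fin n)) :
    IsFeasible G fun u => EuclideanSpace.single u 1 where
  norm_eq_one u := by simp
  inner_nonneg u v := by
    rw [EuclideanSpace.inner_single_left, PiLp.single_apply]
    split_ifs <;> simp
  inner_eq_zero u v h := by simp [EuclideanSpace.inner_single_left, h.ne]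

theorem exists_isOptimal (G : SimpleGraph (Fin n)) : ∃ x, IsOptimal G x := by
  have hcont : Continuous (cost : (Fin n → EuclideanSpace ℝ (Fin n)) → ℝ) := by
    unfold cost
    fun_prop
  obtain ⟨x, hx, hmin⟩ :=
    (isCompact_setOf_isFeasible G).exists_isMinOn ⟨_, isFeasible_single G⟩ hcont.continuousOn
  exact ⟨x, hx, fun _ hy => hmin hy⟩

theorem exists_norm_eq_one_inner_eq_zero {V F : Type*} [NormedAddCommGroup F]
    [InnerProductSpace ℝ F] {A : Finset V} (hA : A.card < Module.finrank ℝ F) (x : V → F) :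
    ∃ e : F, ‖e‖ = 1 ∧ ∀ v ∈ A, inner ℝ (x v) e = 0 := by
  classical
  set K := Submodule.span ℝ (A.image x : Set F)
  have hK : K ≠ ⊤ := fun h => hA.not_ge <| calc
    Module.finrank ℝ F = Module.finrank ℝ K := by rw [h, finrank_top]
    _ ≤ (A.image x).card := finrank_span_finset_le_card _
    _ ≤ A.card := Finset.card_image_le
  obtain ⟨e, he, he0⟩ := Submodule.exists_mem_ne_zero_of_ne_bot
    (mt Submodule.orthogonal_eq_bot_iff.1 hK)
  refine ⟨(‖e‖⁻¹ : ℝ) • e, norm_smul_inv_norm he0, fun v hv => ?_⟩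
  have hvK : x v ∈ K :=
    Submodule.subset_span (Finset.mem_coe.2 (Finset.mem_image_of_mem x hv))
  rw [inner_smul_right, (K.mem_orthogonal e).1 he (x v) hvK, mul_zero]

theorem IsFeasible.cost_eq (hx : IsFeasible G x) :
    cost x = 2 * (n ^ 2 - ∑ u, ∑ v, inner ℝ (x u) (x v)) := by
  rw [cost, sum_norm_sub_sq]
  simp [hx.norm_eq_one, sq]

section Piecewise

variable {e : EuclideanSpace ℝ (Fin n)}

theorem inner_piecewise (he : ‖e‖ = 1) (heo : ∀ v ∉ S, inner ℝ (x v) e = 0) (u v : Fin n) :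
    inner ℝ (S.piecewise (fun _ => e) x u) (S.piecewise (fun _ => e) x v) =
      if u ∈ S then if v ∈ S then 1 else 0 else if v ∈ S then 0 else inner ℝ (x u) (x v) := by
  unfold Finset.piecewise
  split_ifs with hu hv hv
  · simp [he]
  · rw [real_inner_comm, heo v hv]
  · exact heo u hu
  · rfl

theorem IsFeasible.piecewise (hx : IsFeasible G x) (hS : G.IsIndepSet (S : Set (Fin n)))
    (he : ‖e‖ = 1) (heo : ∀ v ∉ S, inner ℝ (x v) e = 0) :
    IsFeasible G (S.piecewise (fun _ => e) x) where
  norm_eq_one u := by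
    unfold Finset.piecewise
    split_ifs
    exacts [he, hx.norm_eq_one u]
  inner_nonneg u v := by
    rw [inner_piecewise he heo]
    split_ifs
    exacts [zero_le_one, le_rfl, le_rfl, hx.inner_nonneg u v]
  inner_eq_zero u v huv := by
    rw [inner_piecewise he heo]
    split_ifs with hu hv
    exacts [absurd huv (hS hu hv huv.ne), rfl, rfl, hx.inner_eq_zero u v huv]

theorem sum_sum_inner_piecewise (he : ‖e‖ = 1) (heo : ∀ v ∉ S, inner ℝ (x v) e = 0) :
    ∑ u, ∑ v, inner ℝ (S.piecewise (fun _ => e) x u) (S.piecewise (fun _ => e) x v) =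
      S.card ^ 2 + ∑ u ∈ Sᶜ, ∑ v ∈ Sᶜ, inner ℝ (x u) (x v) := by
  have hinner := inner_piecewise he heo
  rw [sum_sum_eq_of_symm S fun u v => real_inner_comm _ _]
  set y := S.piecewise (fun _ => e) x
  have hin : ∑ u ∈ S, ∑ v ∈ S, inner ℝ (y u) (y v) = S.card ^ 2 := by
    rw [Finset.sum_congr rfl fun u hu => Finset.sum_congr rfl fun v hv => by
      rw [hinner, if_pos hu, if_pos hv]]
    simp [sq]
  have hcross : ∑ u ∈ S, ∑ v ∈ Sᶜ, inner ℝ (y u) (y v) = 0 :=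
    Finset.sum_eq_zero fun u hu => Finset.sum_eq_zero fun v hv => by
      rw [hinner, if_pos hu, if_neg (Finset.mem_compl.1 hv)]
  have hout : ∑ u ∈ Sᶜ, ∑ v ∈ Sᶜ, inner ℝ (y u) (y v) =
      ∑ u ∈ Sᶜ, ∑ v ∈ Sᶜ, inner ℝ (x u) (x v) :=
    Finset.sum_congr rfl fun u hu => Finset.sum_congr rfl fun v hv => by
      rw [hinner, if_neg (Finset.mem_compl.1 hu), if_neg (Finset.mem_compl.1 hv)]
  rw [hin, hcross, hout, mul_zero, add_zero]

end Piecewise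

theorem IsOptimal.sum_le (hx : IsOptimal G x) (hS : S.Nonempty)
    (hind : G.IsIndepSet (S : Set (Fin n))) :
    S.card ^ 2 - ∑ u ∈ S, ∑ v ∈ S, inner ℝ (x u) (x v) ≤
      2 * ∑ u ∈ S, ∑ v ∈ Sᶜ, inner ℝ (x u) (x v) := by
  have hcard : Sᶜ.card < Module.finrank ℝ (EuclideanSpace ℝ (Fin n)) := by
    rw [finrank_euclideanSpace, Finset.card_compl]
    exact Nat.sub_lt (hS.card_pos.trans_le S.card_le_univ) hS.card_pos
  obtain ⟨e, he, heo⟩ := exists_norm_eq_one_inner_eq_zero hcard x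
  replace heo : ∀ v ∉ S, inner ℝ (x v) e = 0 := fun v hv => heo v (Finset.mem_compl.2 hv)
  have hfeas := hx.1.piecewise hind he heo
  have hcost := hx.2 _ hfeas
  rw [hx.1.cost_eq, hfeas.cost_eq, sum_sum_inner_piecewise he heo,
    sum_sum_eq_of_symm S fun u v => real_inner_comm (x v) (x u)] at hcost
  linarith

theorem IsFeasible.mem_unitBall_iff (hx : IsFeasible G x) {u v : Fin n} :
    v ∈ unitBall x u ↔ 1 / 2 < inner ℝ (x u) (x v) := by
  have hsq := norm_sub_sq_real (x v) (x u)
  rw [hx.norm_eq_one, hx.norm_eq_one, real_inner_comm] at hsq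
  rw [unitBall, Finset.mem_filter_univ, ← sq_lt_one_iff₀ (norm_nonneg _), hsq]
  constructor <;> intro h <;> linarith

theorem mem_candidates (hn : 1 ≤ n) (hk : (10 : ℝ) ^ 4 * (n : ℝ) ^ (2 / 3 : ℝ) ≤ S.card)
    (hE : GoodEdges S E) (hG : Admissible S E G) (hx : IsOptimal G x) {l : List (Fin n)}
    (hl : ∀ v, v ∈ l) : S ∈ candidates G l x := by
  have hS : S.Nonempty :=
    nonempty_of_mul_rpow_le (by norm_num) (by exact_mod_cast hn) (by norm_num) hk
  have hnorm : ∀ u, ‖x u‖ ^ 2 = 1 := fun u => by rw [hx.1.norm_eq_one, one_pow]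
  have hsum : ∑ u ∈ S, ∑ v ∈ S, ‖x u - x v‖ ^ 2 ≤ (S.card : ℝ) ^ 2 / 500 := by
    refine hE.sum_norm_sub_sq_le x hn hk (C := 0) le_rfl (by simp) (fun u => ?_)
      (fun u v huv h => ?_) ?_
    · rw [hnorm]
      norm_num
    · rw [hx.1.inner_eq_zero u v (hG.adj huv h), abs_zero]
    · have := hx.sum_le hS hG.2
      simp only [hnorm, Finset.sum_const, nsmul_eq_mul, mul_one]
      linarith
  obtain ⟨u, -, hu⟩ := exists_isCenter hS (fun w => hE.exists_subset_adj hG) hsum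
  have hseed : IsSeed G S (unitBall x u) :=
    hu.isSeed (fun u => by norm_num [hnorm])
      (fun u v h => by rw [hx.1.inner_eq_zero u v h]; norm_num)
      (fun v hv => hx.1.mem_unitBall_iff.2 (by linarith))
      fun v hv => by linarith [hx.1.mem_unitBall_iff.1 hv]
  exact List.mem_map.2 ⟨u, List.mem_finRange u, hseed.greedyExtend_eq hG.2 fun v _ => .inr (hl v)⟩

end Program

/-! ### Recovery from the Frank–Wolfe iterate -/

section Merge

open Matrix

variable {V : Type*} [DecidableEq V] (S : Finset V) (X : Matrix V V ℝ)

/-- The matrix obtained from the Gram matrix `X` by replacing the vectors of `S` by one vector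
orthogonal to all others, whose squared length is the average over `S`. -/
noncomputable def mergeMatrix : Matrix V V ℝ :=
  .of fun u v => if u ∈ S then if v ∈ S then (∑ w ∈ S, X w w) / S.card else 0
    else if v ∈ S then 0 else X u v

variable {S X}

theorem posSemidef_mergeMatrix [Finite V] (hX : X.PosSemidef) : (mergeMatrix S X).PosSemidef := by
  cases nonempty_fintype V
  set p : V → ℝ := fun u => if u ∈ S then 0 else 1
  set s : V → ℝ := fun u => if u ∈ S then 1 else 0
  have ha : 0 ≤ (∑ w ∈ S, X w w) / S.card :=
    div_nonneg (Finset.sum_nonneg fun w _ => hX.diag_nonneg) S.card.cast_nonneg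
  have hmerge : mergeMatrix S X = diagonal p * X * (diagonal p)ᴴ +
      ((∑ w ∈ S, X w w) / S.card) • vecMulVec s (star s) := by
    ext u v
    by_cases hu : u ∈ S <;> by_cases hv : v ∈ S <;>
      simp [mergeMatrix, p, s, vecMulVec_apply, hu, hv]
  rw [hmerge]
  exact (hX.mul_mul_conjTranspose_same _).add ((posSemidef_vecMulVec_self_star s).smul ha)

theorem isSymm_mergeMatrix (hX : X.IsSymm) : (mergeMatrix S X).IsSymm := by
  ext u v
  simp only [mergeMatrix, transpose_apply, of_apply, hX.apply u v]
  split_ifs <;> rfl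

variable [Fintype V]

theorem trace_mergeMatrix (hS : S.Nonempty) : (mergeMatrix S X).trace = X.trace := by
  have hcard : (S.card : ℝ) ≠ 0 := Nat.cast_ne_zero.2 hS.card_ne_zero
  rw [trace, trace, ← Finset.sum_add_sum_compl S, ← Finset.sum_add_sum_compl S]
  congr 1
  · calc ∑ u ∈ S, (mergeMatrix S X).diag u = ∑ _u ∈ S, (∑ w ∈ S, X w w) / S.card :=
          Finset.sum_congr rfl fun u hu => by simp [mergeMatrix, hu]
      _ = ∑ u ∈ S, X.diag u := by
          rw [Finset.sum_const, nsmul_eq_mul, mul_div_cancel₀ _ hcard]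
          rfl
  · exact Finset.sum_congr rfl fun u hu => by simp [mergeMatrix, Finset.mem_compl.1 hu]

theorem sum_sum_mergeMatrix (hS : S.Nonempty) : ∑ u, ∑ v, mergeMatrix S X u v =
    S.card * ∑ u ∈ S, X u u + ∑ u ∈ Sᶜ, ∑ v ∈ Sᶜ, X u v := by
  have hcard : (S.card : ℝ) ≠ 0 := Nat.cast_ne_zero.2 hS.card_ne_zero
  have hin : ∀ u ∈ S, ∑ v, mergeMatrix S X u v = ∑ w ∈ S, X w w := fun u hu => by
    simp [mergeMatrix, hu, mul_div_cancel₀ _ hcard]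
  have hout : ∀ u ∈ Sᶜ, ∑ v, mergeMatrix S X u v = ∑ v ∈ Sᶜ, X u v := fun u hu => by
    simp [mergeMatrix, Finset.mem_compl.1 hu, Finset.sum_ite, ← Finset.compl_filter]
  rw [← Finset.sum_add_sum_compl S, Finset.sum_congr rfl hin, Finset.sum_congr rfl hout,
    Finset.sum_const, nsmul_eq_mul]

end Merge

section Penalty

variable {n : ℕ} {S : Finset (Fin n)} {G : SimpleGraph (Fin n)} {X : Matrix (Fin n) (Fin n) ℝ}

/-- The sum of the squared violations of the constraints that fix an entry of the Gram matrix. -/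
noncomputable def violation (G : SimpleGraph (Fin n)) (X : Matrix (Fin n) (Fin n) ℝ) : ℝ :=
  ∑ u, ∑ v, mask G u v * (X u v - (1 : Matrix _ _ ℝ) u v) ^ 2

theorem objective_eq_sub_violation :
    objective G X = ∑ u, ∑ v, X u v - n ^ 4 * violation G X := by
  simp only [objective, violation, cast_penWeight, Finset.sum_sub_distrib, Finset.mul_sum]

theorem violation_eq_of_isIndepSet (hS : G.IsIndepSet (S : Set (Fin n))) (hX : X.IsSymm) :
    violation G X = ∑ u ∈ S, (X u u - 1) ^ 2 +
      2 * ∑ u ∈ S, ∑ v ∈ Sᶜ, mask G u v * (X u v - (1 : Matrix _ _ ℝ) u v) ^ 2 +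
      ∑ u ∈ Sᶜ, ∑ v ∈ Sᶜ, mask G u v * (X u v - (1 : Matrix _ _ ℝ) u v) ^ 2 := by
  have hsymm : ∀ u v, (mask G u v : ℝ) * (X u v - (1 : Matrix _ _ ℝ) u v) ^ 2 =
      mask G v u * (X v u - (1 : Matrix _ _ ℝ) v u) ^ 2 := fun u v => by
    rw [mask_comm, hX.apply, Matrix.isSymm_one.apply]
  have hmask : ∀ u ∈ S, ∀ v ∈ S, v ≠ u → mask G u v = 0 := fun u hu v hv huv =>
    if_neg (not_or.2 ⟨huv.symm, hS hu hv huv.symm⟩)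
  rw [violation, sum_sum_eq_of_symm S hsymm]
  congr 2
  refine Finset.sum_congr rfl fun u hu => ?_
  rw [Finset.sum_eq_single_of_mem u hu fun v hv huv => by simp [hmask u hu v hv huv]]
  simp [mask_self]

theorem violation_mergeMatrix_le (hS : G.IsIndepSet (S : Set (Fin n))) (hX : X.IsSymm) :
    violation G (mergeMatrix S X) ≤ violation G X := by
  rw [violation_eq_of_isIndepSet hS hX, violation_eq_of_isIndepSet hS (isSymm_mergeMatrix hX)]
  have hin : ∑ u ∈ S, (mergeMatrix S X u u - 1) ^ 2 ≤ ∑ u ∈ S, (X u u - 1) ^ 2 := by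
    rcases S.eq_empty_or_nonempty with rfl | hne
    · simp
    have hcard : (0 : ℝ) < S.card := Nat.cast_pos.2 hne.card_pos
    calc ∑ u ∈ S, (mergeMatrix S X u u - 1) ^ 2
        = ∑ u ∈ S, ((∑ w ∈ S, (X w w - 1)) / S.card) ^ 2 :=
          Finset.sum_congr rfl fun u hu => by
            simp [mergeMatrix, hu, sub_div, div_self hcard.ne']
      _ = ((∑ w ∈ S, (X w w - 1)) / S.card) ^ 2 * S.card := by
          rw [Finset.sum_const, nsmul_eq_mul, mul_comm]
      _ ≤ ∑ u ∈ S, (X u u - 1) ^ 2 :=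
          (le_div_iff₀ hcard).1 sum_div_card_sq_le_sum_sq_div_card
  have hcross : ∀ u ∈ S, ∀ v ∈ Sᶜ,
      (mask G u v : ℝ) * (mergeMatrix S X u v - (1 : Matrix _ _ ℝ) u v) ^ 2 = 0 :=
    fun u hu v hv => by
      have hv := Finset.mem_compl.1 hv
      simp [mergeMatrix, hu, hv, Matrix.one_apply_ne (ne_of_mem_of_not_mem hu hv)]
  have hout : ∀ u ∈ Sᶜ, ∀ v ∈ Sᶜ, mergeMatrix S X u v = X u v := fun u hu v hv => by
    simp [mergeMatrix, Finset.mem_compl.1 hu, Finset.mem_compl.1 hv]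
  refine add_le_add (add_le_add hin (mul_le_mul_of_nonneg_left ?_ zero_le_two)) ?_
  · exact Finset.sum_le_sum fun u hu => Finset.sum_le_sum fun v hv =>
      (hcross u hu v hv).trans_le (mul_nonneg (cast_mask_nonneg G u v) (sq_nonneg _))
  · exact Finset.sum_le_sum fun u hu => Finset.sum_le_sum fun v hv => by rw [hout u hu v hv]

end Penalty

section NearlyOptimal

variable {n : ℕ} {S : Finset (Fin n)} {G : SimpleGraph (Fin n)} {X : Matrix (Fin n) (Fin n) ℝ}

theorem IsDensity.mergeMatrix (hX : IsDensity X) (hS : S.Nonempty) :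
    IsDensity (mergeMatrix S X) :=
  ⟨posSemidef_mergeMatrix hX.posSemidef, (trace_mergeMatrix hS).trans hX.trace_eq⟩

theorem IsDensity.sum_sum_le (hX : IsDensity X) : ∑ u, ∑ v, X u v ≤ (n : ℝ) ^ 2 := by
  obtain ⟨x, hx⟩ := exists_eq_inner_of_posSemidef hX.posSemidef
  have htrace : ∑ u, ‖x u‖ ^ 2 = n := by
    simp only [← hX.trace_eq, Matrix.trace, Matrix.diag_apply, hx, real_inner_self_eq_norm_sq]
  have hsq : 0 ≤ ∑ u, ∑ v, ‖x u - x v‖ ^ 2 :=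
    Finset.sum_nonneg fun u _ => Finset.sum_nonneg fun v _ => sq_nonneg _
  simp only [sum_norm_sub_sq, htrace, Finset.card_univ, Fintype.card_fin, ← hx] at hsq
  linarith

theorem IsNearlyOptimal.abs_sub_one_le (hX : IsNearlyOptimal G X) (hn : 1 ≤ n) {u v : Fin n}
    (huv : u = v ∨ G.Adj u v) : |X u v - (1 : Matrix _ _ ℝ) u v| ≤ 1 / n := by
  have hn1 : (1 : ℝ) ≤ n := by exact_mod_cast hn
  have hviol : n ^ 4 * violation G X ≤ n ^ 2 := by
    have hone := hX.sub_le 1 isDensity_one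
    rw [objective_one, objective_eq_sub_violation] at hone
    linarith [hX.isDensity.sum_sum_le]
  have hentry : (X u v - (1 : Matrix _ _ ℝ) u v) ^ 2 ≤ violation G X := by
    have hnonneg : ∀ u v, 0 ≤ mask G u v * (X u v - (1 : Matrix _ _ ℝ) u v) ^ 2 := fun u v =>
      mul_nonneg (cast_mask_nonneg G u v) (sq_nonneg _)
    calc (X u v - (1 : Matrix _ _ ℝ) u v) ^ 2
        = mask G u v * (X u v - (1 : Matrix _ _ ℝ) u v) ^ 2 := by simp [mask, huv]
      _ ≤ ∑ v, mask G u v * (X u v - (1 : Matrix _ _ ℝ) u v) ^ 2 :=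
          Finset.single_le_sum (f := fun v => (mask G u v : ℝ) * _) (fun v _ => hnonneg u v)
            (Finset.mem_univ v)
      _ ≤ violation G X :=
          Finset.single_le_sum (f := fun u => ∑ v, (mask G u v : ℝ) * _)
            (fun u _ => Finset.sum_nonneg fun v _ => hnonneg u v) (Finset.mem_univ u)
  refine abs_le_of_sq_le_sq ?_ (by positivity)
  rw [div_pow, one_pow, le_div_iff₀ (by positivity)]
  refine le_of_mul_le_mul_left ?_ (show (0 : ℝ) < n ^ 2 by positivity)
  calc (n : ℝ) ^ 2 * ((X u v - (1 : Matrix _ _ ℝ) u v) ^ 2 * n ^ 2)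
      = n ^ 4 * (X u v - (1 : Matrix _ _ ℝ) u v) ^ 2 := by ring
    _ ≤ n ^ 4 * violation G X := by gcongr
    _ ≤ n ^ 2 * 1 := by rwa [mul_one]

theorem IsNearlyOptimal.sum_le (hX : IsNearlyOptimal G X) (hS : S.Nonempty)
    (hind : G.IsIndepSet (S : Set (Fin n))) :
    S.card * ∑ u ∈ S, X u u - ∑ u ∈ S, ∑ v ∈ S, X u v ≤ 2 * ∑ u ∈ S, ∑ v ∈ Sᶜ, X u v + 1 := by
  have hmerge := hX.sub_le _ (hX.isDensity.mergeMatrix hS)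
  rw [objective_eq_sub_violation, objective_eq_sub_violation, sum_sum_mergeMatrix hS,
    sum_sum_eq_of_symm S fun u v => hX.isDensity.isSymm.apply v u] at hmerge
  have hviol : (n : ℝ) ^ 4 * violation G (PlantedIndepSet.mergeMatrix S X) ≤
      n ^ 4 * violation G X := by
    gcongr
    exact violation_mergeMatrix_le hind hX.isDensity.isSymm
  linarith

end NearlyOptimal

section Output

variable {n : ℕ} {S : Finset (Fin n)} {E : Set (Fin n × Fin n)} {G : SimpleGraph (Fin n)}
  {X : Matrix (Fin n) (Fin n) ℝ}

/-- The vertices whose vectors, according to the last Frank–Wolfe iterate, are close to that of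
`u`. -/
noncomputable def nearSet (G : SimpleGraph (Fin n)) (u : Fin n) : Finset (Fin n) :=
  {v | denom n < 2 * fwIter G (numIter n) u v}

open Classical in
/-- The vertices without neighbours in `nearSet G u`. -/
noncomputable def candSet (G : SimpleGraph (Fin n)) (u : Fin n) : Finset (Fin n) :=
  {v | ∀ w ∈ nearSet G u, ¬ G.Adj w v}

open Classical in
/-- The set computed for the vertex `u`: the set `candSet G u` if it is independent. -/
noncomputable def outSet (G : SimpleGraph (Fin n)) (u : Fin n) : Finset (Fin n) :=
  if G.IsIndepSet (candSet G u : Set (Fin n)) then candSet G u else ∅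

/-- The list of the sets computed for all vertices. -/
noncomputable def outList (n : ℕ) (G : SimpleGraph (Fin n)) : List (Finset (Fin n)) :=
  (List.finRange n).map (outSet G)

theorem isIndepSet_outSet (G : SimpleGraph (Fin n)) (u : Fin n) :
    G.IsIndepSet (outSet G u : Set (Fin n)) := by
  unfold outSet
  split_ifs with h
  · exact h
  · simp [SimpleGraph.IsIndepSet]

theorem IsSeed.outSet_eq {u : Fin n} (h : IsSeed G S (nearSet G u))
    (hS : G.IsIndepSet (S : Set (Fin n))) : outSet G u = S := by
  have hcand : candSet G u = S := by
    ext v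
    simp only [candSet, Finset.mem_filter_univ, h.mem_iff hS]
  rw [outSet, hcand, if_pos hS]

theorem IsRounding.mem_nearSet (hX : IsRounding (fwIter G (numIter n)) X) (hn : 1 ≤ n)
    {u v : Fin n} (huv : 6 / 10 ≤ X u v) : v ∈ nearSet G u := by
  have hlt : (denom n : ℝ) < 2 * fwIter G (numIter n) u v := by
    nlinarith [(abs_le.1 (hX.abs_sub_le u v)).1, twenty_mul_cast_stepInv_le_cast_denom hn,
      cast_denom_pos hn]
  rw [nearSet, Finset.mem_filter_univ]
  exact_mod_cast hlt

theorem IsRounding.le_of_mem_nearSet (hX : IsRounding (fwIter G (numIter n)) X) (hn : 1 ≤ n)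
    {u v : Fin n} (hv : v ∈ nearSet G u) : 4 / 10 ≤ X u v := by
  rw [nearSet, Finset.mem_filter_univ] at hv
  have hlt : (denom n : ℝ) < 2 * fwIter G (numIter n) u v := by exact_mod_cast hv
  nlinarith [(abs_le.1 (hX.abs_sub_le u v)).2, twenty_mul_cast_stepInv_le_cast_denom hn,
    cast_denom_pos hn]

theorem exists_outSet_eq (hn : 1 ≤ n) (hk : (10 : ℝ) ^ 4 * (n : ℝ) ^ (2 / 3 : ℝ) ≤ S.card)
    (hE : GoodEdges S E) (hG : Admissible S E G) : ∃ u, outSet G u = S := by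
  have hn1 : (1 : ℝ) ≤ n := by exact_mod_cast hn
  have hn4 : (10 : ℝ) ^ 4 ≤ n := (le_of_mul_rpow_le (by norm_num) hn1 (by norm_num) hk).trans
    (by exact_mod_cast S.card_le_univ.trans_eq (Fintype.card_fin n))
  have hS : S.Nonempty := nonempty_of_mul_rpow_le (by norm_num) hn1 (by norm_num) hk
  obtain ⟨X, hround, hX⟩ := exists_isRounding_fwIter_numIter G hn
  obtain ⟨x, hx⟩ := exists_eq_inner_of_posSemidef hX.isDensity.posSemidef
  have hinv : 1 / (n : ℝ) ≤ 1 / 100 := one_div_le_one_div_of_le (by norm_num) (by linarith)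
  have hdiag : ∀ u, ‖x u‖ ^ 2 = X u u := fun u => by rw [hx, real_inner_self_eq_norm_sq]
  have hnorm : ∀ u, |‖x u‖ ^ 2 - 1| ≤ 1 / 100 := fun u => by
    rw [hdiag]
    simpa using (hX.abs_sub_one_le hn (.inl rfl)).trans hinv
  have hadj : ∀ u v, G.Adj u v → |inner ℝ (x u) (x v)| ≤ 1 / n := fun u v h => by
    rw [← hx]
    simpa [Matrix.one_apply_ne h.ne] using hX.abs_sub_one_le hn (.inr h)
  have hsum : ∑ u ∈ S, ∑ v ∈ S, ‖x u - x v‖ ^ 2 ≤ (S.card : ℝ) ^ 2 / 500 := by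
    refine hE.sum_norm_sub_sq_le x hn hk (C := 1 / n) (by positivity) (le_of_eq (by field_simp))
      (fun u => ?_) (fun u v huv h => hadj u v (hG.adj huv h)) ?_
    · linarith [(abs_le.1 (hnorm u)).2]
    · simpa only [hdiag, ← hx] using hX.sum_le hS hG.2
  obtain ⟨u, -, hu⟩ := exists_isCenter hS (fun w => hE.exists_subset_adj hG) hsum
  have hseed : IsSeed G S (nearSet G u) :=
    hu.isSeed hnorm (fun u v h => (hadj u v h).trans hinv)
      (fun v hv => hround.mem_nearSet hn (hx u v ▸ hv))
      fun v hv => hx u v ▸ hround.le_of_mem_nearSet hn hv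
  exact ⟨u, hseed.outSet_eq hG.2⟩

end Output

section Largest

variable {n : ℕ}

/-- A preference order on the computed sets: larger sets first, then lower numbers. -/
noncomputable def rank (G : SimpleGraph (Fin n)) (u : Fin n) : ℤ :=
  (outSet G u).card * n - u

open Classical in
/-- The largest computed set. It is defined as the union of the computed sets of maximal `rank`, of
which there is only one, so that the empty graph needs no special case. -/
noncomputable def largestSet (n : ℕ) (G : SimpleGraph (Fin n)) : Finset (Fin n) :=
  {v | ∃ u, (∀ w, rank G w ≤ rank G u) ∧ v ∈ outSet G u}

variable (G : SimpleGraph (Fin n))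

theorem card_le_of_rank_le {u w : Fin n} (h : rank G w ≤ rank G u) :
    (outSet G w).card ≤ (outSet G u).card := by
  unfold rank at h
  by_contra! hlt
  nlinarith [u.isLt, w.isLt]

theorem rank_injective : Function.Injective (rank G) := by
  intro u w h
  have hcard : (outSet G u).card = (outSet G w).card :=
    (card_le_of_rank_le G h.le).antisymm (card_le_of_rank_le G h.ge)
  unfold rank at h
  rw [hcard] at h
  ext
  omega

theorem exists_largestSet_eq (hn : 1 ≤ n) :
    ∃ u, largestSet n G = outSet G u ∧ ∀ w, (outSet G w).card ≤ (outSet G u).card := by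
  have : Nonempty (Fin n) := ⟨⟨0, hn⟩⟩
  obtain ⟨u, hu⟩ := Finite.exists_max (rank G)
  refine ⟨u, ?_, fun w => card_le_of_rank_le G (hu w)⟩
  ext v
  rw [largestSet, Finset.mem_filter_univ]
  refine ⟨fun ⟨u', hu', hv⟩ => ?_, fun hv => ⟨u, hu, hv⟩⟩
  rwa [rank_injective G (le_antisymm (hu u') (hu' u))] at hv

theorem isIndepSet_largestSet : G.IsIndepSet (largestSet n G : Set (Fin n)) := by
  rcases Nat.eq_zero_or_pos n with rfl | hn
  · exact fun u => u.elim0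
  · obtain ⟨u, hu, -⟩ := exists_largestSet_eq G hn
    rw [hu]
    exact isIndepSet_outSet G u

end Largest

/-! ### Matrix programs -/

namespace Expr

instance : Add Expr := ⟨op .add⟩
instance : Sub Expr := ⟨op .sub⟩
instance : Mul Expr := ⟨op .mul⟩
instance : Div Expr := ⟨op .div⟩

/-- The monomial `c * X ^ k` in the variable `0`. -/
def monom (c : ℤ) : ℕ → Expr
  | 0 => const c
  | k + 1 => monom c k * var 0

/-- The indicator of the equality of two variables. -/
def delta (x y : ℕ) : Expr :=
  cond (var x - var y) (const 0) (cond (var y - var x) (const 0) (const 1))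

/-- The entry of the square matrix stored row by row in array `b`, with row and column given by the
variables `x` and `y`. The size of the matrix is the variable `0`. -/
def entry (b x y : ℕ) : Expr := load b (var x * var 0 + var y)

end Expr

/-- The entry of the matrix with rows of length `n` stored in array `b`. -/
def cell (m : ℕ → ℤ → ℤ) (b : ℕ) (n i j : ℤ) : ℤ := m b (i * n + j)

/-- The square matrices stored row by row in the arrays. -/
def mat (n : ℕ) (m : ℕ → ℤ → ℤ) (b : ℕ) : Matrix (Fin n) (Fin n) ℤ :=
  .of fun u w => m b (u * n + w)

@[simp] theorem cell_cast {n : ℕ} (m : ℕ → ℤ → ℤ) (b : ℕ) (u w : Fin n) :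
    cell m b n (u : ℕ) (w : ℕ) = mat n m b u w := rfl

namespace Expr

section Eval

variable (e e₁ e₂ : Expr) (v : ℕ → ℤ) (m : ℕ → ℤ → ℤ)

@[simp] theorem eval_add : (e₁ + e₂).eval v m = e₁.eval v m + e₂.eval v m := rfl
@[simp] theorem eval_sub : (e₁ - e₂).eval v m = e₁.eval v m - e₂.eval v m := rfl
@[simp] theorem eval_mul : (e₁ * e₂).eval v m = e₁.eval v m * e₂.eval v m := rfl
@[simp] theorem eval_div : (e₁ / e₂).eval v m = e₁.eval v m / e₂.eval v m := rfl
@[simp] theorem eval_const (c : ℤ) : (const c).eval v m = c := rfl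
@[simp] theorem eval_var (x : ℕ) : (var x).eval v m = v x := rfl

@[simp] theorem eval_cond :
    (cond e e₁ e₂).eval v m = if 0 < e.eval v m then e₁.eval v m else e₂.eval v m := rfl

@[simp] theorem eval_monom (c : ℤ) (k : ℕ) : (monom c k).eval v m = c * v 0 ^ k := by
  induction k with
  | zero => simp [monom]
  | succ k ih => simp [monom, ih, pow_succ, mul_assoc]

@[simp] theorem eval_delta (x y : ℕ) : (delta x y).eval v m = if v x = v y then 1 else 0 := by
  simp only [delta, eval_cond, eval_sub, eval_var, eval_const]
  split_ifs <;> omega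

@[simp] theorem eval_entry (b x y : ℕ) : (entry b x y).eval v m = cell m b (v 0) (v x) (v y) := rfl

theorem eval_sum_fin {n x : ℕ} (h0 : v 0 = n) :
    (sum x 0 e).eval v m = ∑ l : Fin n, e.eval (Function.update v x (l : ℕ)) m := by
  simp only [eval, h0, Int.toNat_natCast]
  exact (Fin.sum_univ_eq_sum_range (fun l : ℕ => e.eval (Function.update v x l) m) n).symm

end Eval

section Below

variable {e e₁ e₂ : Expr} {d : ℕ}

@[simp] theorem below_add : (e₁ + e₂).Below d ↔ e₁.Below d ∧ e₂.Below d := Iff.rfl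
@[simp] theorem below_sub : (e₁ - e₂).Below d ↔ e₁.Below d ∧ e₂.Below d := Iff.rfl
@[simp] theorem below_mul : (e₁ * e₂).Below d ↔ e₁.Below d ∧ e₂.Below d := Iff.rfl
@[simp] theorem below_div : (e₁ / e₂).Below d ↔ e₁.Below d ∧ e₂.Below d := Iff.rfl
@[simp] theorem below_const (c : ℤ) : (const c).Below d := trivial
@[simp] theorem below_var (x : ℕ) : (var x).Below d ↔ x < d := Iff.rfl

@[simp] theorem below_cond : (cond e e₁ e₂).Below d ↔ e.Below d ∧ e₁.Below d ∧ e₂.Below d :=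
  Iff.rfl

@[simp] theorem below_sum (x y : ℕ) : (sum x y e).Below d ↔ x < d ∧ y < d ∧ e.Below d := Iff.rfl

@[simp] theorem below_monom (c : ℤ) (k : ℕ) (hd : 0 < d) : (monom c k).Below d := by
  induction k with
  | zero => trivial
  | succ k ih => exact ⟨ih, hd⟩

@[simp] theorem below_delta (x y : ℕ) : (delta x y).Below d ↔ x < d ∧ y < d := by
  simp only [delta, below_cond, below_sub, below_var, below_const]
  tauto

@[simp] theorem below_entry (b x y : ℕ) : (entry b x y).Below d ↔ (x < d ∧ 0 < d) ∧ y < d := Iff.rfl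

end Below

end Expr

theorem mul_add_inj {n : ℕ} {u u' w w' : Fin n} :
    (u : ℤ) * n + w = u' * n + w' ↔ u = u' ∧ w = w' := by
  refine ⟨fun h => ?_, by rintro ⟨rfl, rfl⟩; rfl⟩
  have h : (w : ℕ) + n * u = w' + n * u' := by
    zify
    linarith
  exact Prod.mk.inj (finProdFinEquiv.injective (a₁ := (u, w)) (a₂ := (u', w')) (Fin.ext h))

theorem mat_update {n : ℕ} (m : ℕ → ℤ → ℤ) (b : ℕ) (u w : Fin n) (z : ℤ) :
    mat n (Function.update m b (Function.update (m b) (u * n + w) z)) =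
      Function.update (mat n m) b
        (.of fun u' w' => if u' = u ∧ w' = w then z else mat n m b u' w') := by
  ext b' u' w'
  by_cases hb : b' = b
  · subst hb
    simp [mat, Function.update_apply, mul_add_inj]
  · simp [mat, hb]

namespace Cmd

section Triple

variable {n : ℕ}

/-- The assertions on the contents of the memory; they only speak about the stored matrices. -/
abbrev Assertion (n : ℕ) : Type := (ℕ → Matrix (Fin n) (Fin n) ℤ) → Prop

/-- The Hoare triple `{P} c {Q}`: from every memory with `P`, the command `c` is safe and leads to a
memory with `Q`. -/
def Triple (L : ℕ) (v : ℕ → ℤ) (P : Assertion n) (c : Cmd) (Q : Assertion n) : Prop :=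
  ∀ m, P (mat n m) → c.Safe L v m ∧ Q (mat n (c.run v m))

/-- The assertion `P` does not depend on the contents of array `b`. -/
def Ignores (P : Assertion n) (b : ℕ) : Prop :=
  ∀ A M, P A → P (Function.update A b M)

variable {b L : ℕ} {v : ℕ → ℤ} {c c₁ c₂ : Cmd} {e : Expr}
  {P P' Q Q' : Assertion n} {M : Matrix (Fin n) (Fin n) ℤ}

theorem Ignores.and (hP : Ignores P b) (hQ : Ignores Q b) : Ignores (fun A => P A ∧ Q A) b :=
  fun A M h => ⟨hP A M h.1, hQ A M h.2⟩

theorem ignores_apply {b' : ℕ} (hb : b' ≠ b) : Ignores (fun A => A b' = M) b :=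
  fun A N h => by simpa [hb] using h

namespace Triple

theorem imp (h : Triple L v P c Q) (hP : ∀ A, P' A → P A) (hQ : ∀ A, Q A → Q' A) :
    Triple L v P' c Q' :=
  fun m hm => (h m (hP _ hm)).imp_right (hQ _)

theorem seq (h₁ : Triple L v P c₁ P') (h₂ : Triple L v P' c₂ Q) : Triple L v P (seq c₁ c₂) Q :=
  fun m hm => ⟨⟨(h₁ m hm).1, (h₂ _ (h₁ m hm).2).1⟩, (h₂ _ (h₁ m hm).2).2⟩

theorem loop {x y N : ℕ} {I : ℕ → Assertion n} (hy : v y = N)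
    (h : ∀ l < N, Triple L (Function.update v x l) (I l) c (I (l + 1))) :
    Triple L v (I 0) (loop x y c) (I N) := by
  intro m hm
  have hN : (v y).toNat = N := by simp [hy]
  have hI : ∀ l ≤ N, I l (mat n (rounds (fun l => c.run (Function.update v x l)) l m)) := by
    intro l
    induction l with
    | zero => exact fun _ => hm
    | succ l ih => exact fun hl => (h l (by omega) _ (ih (by omega))).2
  exact ⟨fun l hl => (h l (hN ▸ hl) _ (hI l (hN ▸ hl.le))).1, hN ▸ hI _ hN.le⟩

end Triple

/-- The command that fills the matrix in array `b` with the values of an expression in the row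
variable `2` and the column variable `3`. -/
def fill (b : ℕ) (e : Expr) : Cmd :=
  .loop 2 0 (.loop 3 0 (store b (.var 2 * .var 0 + .var 3) e))

theorem below_fill {d : ℕ} (hd : 4 ≤ d) (he : e.Below d) : (fill b e).Below d := by
  have : ∀ k < 4, k < d := fun k hk => by omega
  simp [fill, Below, this, he]

theorem triple_store {u w : Fin n} (h0 : v 0 = n) (hu : v 2 = (u : ℕ)) (hw : v 3 = (w : ℕ))
    (he : ∀ m, P (mat n m) → e.eval v m = M u w) (hL : |M u w| ≤ 2 ^ L) :
    Triple L v P (store b (.var 2 * .var 0 + .var 3) e) fun A => ∃ A₀, P A₀ ∧ A =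
      Function.update A₀ b (.of fun u' w' => if u' = u ∧ w' = w then M u w else A₀ b u' w') := by
  intro m hm
  refine ⟨(congrArg abs (he m hm)).trans_le hL, mat n m, hm, ?_⟩
  simp only [run, Expr.eval_add, Expr.eval_mul, Expr.eval_var, h0, hu, hw, he m hm, mat_update]

theorem triple_fill (h0 : v 0 = n) (hP : Ignores P b)
    (he : ∀ m, P (mat n m) → ∀ u w : Fin n,
      e.eval (Function.update (Function.update v 2 (u : ℕ)) 3 (w : ℕ)) m = M u w)
    (hL : ∀ u w, |M u w| ≤ 2 ^ L) : Triple L v P (fill b e) fun A => P A ∧ A b = M := by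
  let I (l k : ℕ) : Assertion n := fun A =>
    P A ∧ ∀ u w : Fin n, (u < l ∨ (u : ℕ) = l ∧ w < k) → A b u w = M u w
  have hcell : ∀ l k (hl : l < n) (hk : k < n), Triple L
      (Function.update (Function.update v 2 l) 3 k) (I l k)
      (store b (.var 2 * .var 0 + .var 3) e) (I l (k + 1)) := by
    refine fun l k hl hk => (triple_store (u := ⟨l, hl⟩) (w := ⟨k, hk⟩) (by simp [h0]) (by simp)
      (by simp) (fun m hm => he m hm.1 ⟨l, hl⟩ ⟨k, hk⟩) (hL _ _)).imp (fun _ => id) ?_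
    rintro _ ⟨A, hA, rfl⟩
    refine ⟨hP _ _ hA.1, fun u w huw => ?_⟩
    simp only [Function.update_self, Matrix.of_apply, Fin.ext_iff]
    split_ifs with h
    · congr 1 <;> simp [Fin.ext_iff, h]
    · exact hA.2 u w (by omega)
  have hrow : ∀ l < n, Triple L (Function.update v 2 l) (I l 0)
      (.loop 3 0 (store b (.var 2 * .var 0 + .var 3) e)) (I (l + 1) 0) := fun l hl =>
    (Triple.loop (I := I l) (by simpa using h0) fun k hk => hcell l k hl hk).imp (fun _ => id)
      fun A hA => ⟨hA.1, fun u w huw => hA.2 u w (by omega)⟩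
  exact (Triple.loop (I := fun l => I l 0) h0 hrow).imp (fun A hA => ⟨hA, fun _ _ h => by omega⟩)
    fun A hA => ⟨hA.1, Matrix.ext fun u w => hA.2 u w (.inl u.isLt)⟩

end Triple

end Cmd

/-! ### Word length -/

/-- A bound for the entries of the iterates. -/
def iterBound (n : ℕ) : ℕ := 4096 * n ^ 16 + 64 * n ^ 8

/-- A bound for the entries of the scaled gradients. -/
def gradBound (n : ℕ) : ℕ :=
  4096 * n ^ 15 + 8 * n ^ 6 * (4096 * n ^ 15) + 2 * n ^ 4 * (iterBound n + 4096 * n ^ 15)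

/-- A bound for the loop variables and for the sizes of the matrices. -/
def loopBound (n : ℕ) : ℕ := numIter n + n

/-- A bound for the number of binary digits of the numbers occurring in the computation; most of
them are used up by the powers of the gradients. -/
def wordLen (n : ℕ) : ℕ :=
  n * gradBound n * numIter n + iterBound n + gradBound n + n * n + loopBound n + 1

theorem polyBounded_iterBound : PolyBounded iterBound :=
  ⟨4096 * .X ^ 16 + 64 * .X ^ 8, fun n => by simp [iterBound]⟩

theorem polyBounded_gradBound : PolyBounded gradBound :=
  ⟨4096 * .X ^ 15 + 8 * .X ^ 6 * (4096 * .X ^ 15) +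
    2 * .X ^ 4 * (4096 * .X ^ 16 + 64 * .X ^ 8 + 4096 * .X ^ 15),
    fun n => by simp [gradBound, iterBound]⟩

theorem polyBounded_numIter : PolyBounded numIter :=
  ⟨1024 * .X ^ 11, fun n => by simp [numIter]⟩

theorem polyBounded_loopBound : PolyBounded loopBound := polyBounded_numIter.add .id

theorem polyBounded_wordLen : PolyBounded wordLen :=
  ((((((PolyBounded.id.mul polyBounded_gradBound).mul polyBounded_numIter).add
    polyBounded_iterBound).add polyBounded_gradBound).add (PolyBounded.id.mul .id)).add
    polyBounded_loopBound).add (.const 1)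

theorem natCast_le_two_pow {a L : ℕ} (h : a ≤ L) : (a : ℤ) ≤ 2 ^ L := by
  exact_mod_cast h.trans Nat.lt_two_pow_self.le

theorem abs_indicator_le_two_pow {p : Prop} [Decidable p] (L : ℕ) :
    |(if p then 1 else 0 : ℤ)| ≤ 2 ^ L := by
  have : (1 : ℤ) ≤ 2 ^ L := one_le_pow₀ (by norm_num)
  split_ifs <;> simp [this]

theorem abs_pow_apply_le {ι R : Type*} [Fintype ι] [DecidableEq ι] [CommRing R] [LinearOrder R]
    [IsStrictOrderedRing R] {M : Matrix ι ι R} {β : R} (hβ : 0 ≤ β) (hM : ∀ u v, |M u v| ≤ β)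
    (j : ℕ) (u v : ι) : |(M ^ j) u v| ≤ (Fintype.card ι * β) ^ j := by
  induction j generalizing v with
  | zero =>
    simp only [pow_zero, Matrix.one_apply]
    split_ifs <;> simp
  | succ j ih =>
    rw [pow_succ, Matrix.mul_apply]
    calc |∑ w, (M ^ j) u w * M w v| ≤ ∑ w, |(M ^ j) u w * M w v| := Finset.abs_sum_le_sum_abs _ _
      _ ≤ ∑ _w : ι, (Fintype.card ι * β) ^ j * β := Finset.sum_le_sum fun w _ => by
          rw [abs_mul]
          exact mul_le_mul (ih w) (hM w v) (abs_nonneg _) (by positivity)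
      _ = (Fintype.card ι * β) ^ (j + 1) := by
          rw [Finset.sum_const, Finset.card_univ, nsmul_eq_mul]
          ring

section Bounds

variable {n : ℕ} (G : SimpleGraph (Fin n))

theorem abs_mask_le_one (u v : Fin n) : |mask G u v| ≤ 1 := by
  unfold mask
  split_ifs <;> simp

theorem abs_gradMat_le {W : Matrix (Fin n) (Fin n) ℤ} {u v : Fin n} {β : ℤ} (hW : |W u v| ≤ β) :
    |gradMat G W u v| ≤
      denom n + shiftWeight n * denom n + 2 * penWeight n * (β + denom n) := by
  have hD : 0 ≤ denom n := by unfold denom; positivity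
  have hσ : 0 ≤ shiftWeight n := by unfold shiftWeight; positivity
  have hπ : 0 ≤ 2 * penWeight n := by unfold penWeight; positivity
  have hone : |(1 : Matrix (Fin n) (Fin n) ℤ) u v| ≤ 1 := by
    rw [Matrix.one_apply]
    split_ifs <;> simp
  have hsub : |W u v - denom n * (1 : Matrix _ _ ℤ) u v| ≤ β + denom n := by
    refine (abs_sub _ _).trans (add_le_add hW ?_)
    rw [abs_mul, abs_of_nonneg hD]
    exact mul_le_of_le_one_right hD hone
  have hpen : |mask G u v * (W u v - denom n * (1 : Matrix _ _ ℤ) u v)| ≤ β + denom n := by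
    rw [abs_mul]
    exact (mul_le_of_le_one_left (abs_nonneg _) (abs_mask_le_one G u v)).trans hsub
  refine (abs_sub _ _).trans (add_le_add ((abs_add_le _ _).trans (add_le_add ?_ ?_)) ?_)
  · exact (abs_of_nonneg hD).le
  · rw [abs_mul, abs_of_nonneg (mul_nonneg hσ hD)]
    exact mul_le_of_le_one_right (mul_nonneg hσ hD) hone
  · rw [abs_mul, abs_of_nonneg hπ]
    exact mul_le_mul_of_nonneg_left hpen hπ

theorem abs_fwIter_le_iterBound (t : ℕ) (u v : Fin n) : |fwIter G t u v| ≤ iterBound n := by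
  refine (abs_fwIter_le G u.pos t u v).trans_eq ?_
  simp only [iterBound, denom, stepInv]
  push_cast
  ring

theorem abs_gradMat_fwIter_le_gradBound (t : ℕ) (u v : Fin n) :
    |gradMat G (fwIter G t) u v| ≤ gradBound n := by
  refine (abs_gradMat_le G (abs_fwIter_le_iterBound G t u v)).trans_eq ?_
  simp [gradBound, denom, shiftWeight, penWeight]

theorem abs_fwIter_le_two_pow (t : ℕ) (u v : Fin n) : |fwIter G t u v| ≤ 2 ^ wordLen n :=
  (abs_fwIter_le_iterBound G t u v).trans (natCast_le_two_pow (by unfold wordLen; omega))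

theorem abs_gradMat_fwIter_le_two_pow (t : ℕ) (u v : Fin n) :
    |gradMat G (fwIter G t) u v| ≤ 2 ^ wordLen n :=
  (abs_gradMat_fwIter_le_gradBound G t u v).trans (natCast_le_two_pow (by unfold wordLen; omega))

theorem abs_gradMat_fwIter_pow_le_two_pow (t : ℕ) {j : ℕ} (hj : j ≤ numIter n) (u v : Fin n) :
    |(gradMat G (fwIter G t) ^ j) u v| ≤ 2 ^ wordLen n := by
  have hexp : n * gradBound n * j ≤ wordLen n := by
    have := Nat.mul_le_mul_left (n * gradBound n) hj
    unfold wordLen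
    omega
  calc |(gradMat G (fwIter G t) ^ j) u v| ≤ (n * gradBound n : ℤ) ^ j := by
        simpa using abs_pow_apply_le (by positivity) (abs_gradMat_fwIter_le_gradBound G t) j u v
    _ ≤ (2 ^ (n * gradBound n)) ^ j := by
        gcongr
        exact_mod_cast natCast_le_two_pow le_rfl
    _ = 2 ^ (n * gradBound n * j) := (pow_mul _ _ _).symm
    _ ≤ 2 ^ wordLen n := pow_le_pow_right₀ one_le_two hexp

theorem abs_rank_le_two_pow (u : Fin n) : |rank G u| ≤ 2 ^ wordLen n := by
  have hcard : ((outSet G u).card : ℤ) ≤ n := by exact_mod_cast card_finset_fin_le _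
  have hbound : ((n * n + n : ℕ) : ℤ) ≤ 2 ^ wordLen n :=
    natCast_le_two_pow (by unfold wordLen loopBound; omega)
  push_cast at hbound
  unfold rank
  rw [abs_le]
  constructor <;> nlinarith [u.isLt]

end Bounds

theorem sum_indicator_pos {ι : Type*} [Fintype ι] (p : ι → Prop) [DecidablePred p] :
    0 < ∑ i, (if p i then 1 else 0 : ℤ) ↔ ∃ i, p i := by
  simp [Finset.sum_boole, Finset.card_pos, Finset.Nonempty]

open Classical in
/-- The matrix whose rows are the indicators of the members of a family of sets. -/
noncomputable def setMat {n : ℕ} (f : Fin n → Finset (Fin n)) : Matrix (Fin n) (Fin n) ℤ :=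
  .of fun u v => if v ∈ f u then 1 else 0

theorem abs_setMat_le_two_pow {n L : ℕ} (f : Fin n → Finset (Fin n)) (u v : Fin n) :
    |setMat f u v| ≤ 2 ^ L := abs_indicator_le_two_pow L

open Classical in
/-- The matrix whose rows are constant, with the value one for the vertices of largest rank. -/
noncomputable def topMat {n : ℕ} (G : SimpleGraph (Fin n)) : Matrix (Fin n) (Fin n) ℤ :=
  .of fun u _ => if ∀ w, rank G w ≤ rank G u then 1 else 0

theorem fwIter_zero_apply {n : ℕ} (G : SimpleGraph (Fin n)) (u v : Fin n) :
    fwIter G 0 u v = if u = v then denom n else 0 := by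
  rw [fwIter, Function.iterate_zero_apply, Matrix.smul_apply, Matrix.one_apply, smul_ite,
    smul_eq_mul, mul_one, smul_zero]

namespace Expr

/-- The entries of the scaled gradient, the iterate being in array `2`. -/
def grad : Expr :=
  monom 4096 15 + monom 8 6 * monom 4096 15 * delta 2 3 -
    const 2 * monom 1 4 *
      (cond (delta 2 3) (const 1) (entry 0 2 3) * (entry 2 2 3 - monom 4096 15 * delta 2 3))

/-- The entries of the next iterate, the iterate being in array `2` and the power of the scaled
gradient in array `4`. -/
def step : Expr :=
  ((monom 64 8 - const 1) * entry 2 2 3 * sum 4 0 (entry 4 4 4) +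
      var 0 * monom 4096 15 * entry 4 2 3) /
    (monom 64 8 * sum 4 0 (entry 4 4 4))

/-- The entries of the matrix of the sets `nearSet`, the last iterate being in array `2`. -/
def near : Expr := cond (const 2 * entry 2 2 3 - monom 4096 15) (const 1) (const 0)

/-- The entries of the matrix of the sets `candSet`, that of the sets `nearSet` being in
array `3`. -/
def cand : Expr := cond (sum 4 0 (entry 3 2 4 * entry 0 4 3)) (const 0) (const 1)

/-- The entries of the matrix of the sets `outSet`, that of the sets `candSet` being in
array `4`. -/
def out : Expr :=
  cond (sum 4 0 (sum 5 0 (entry 4 2 4 * entry 4 2 5 * entry 0 4 5))) (const 0) (entry 4 2 3)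

/-- The rank of the row vertex, the matrix of the sets `outSet` being in array `1`. -/
def outRank : Expr := sum 4 0 (entry 1 2 4) * var 0 - var 2

/-- The entries of `topMat`, the ranks being in array `3`. -/
def top : Expr := cond (sum 4 0 (cond (entry 3 4 3 - entry 3 2 3) (const 1) (const 0)))
  (const 0) (const 1)

/-- The indicator of the largest set, the matrix of the sets `outSet` being in array `1` and
`topMat` in array `4`. -/
def largest : Expr := cond (sum 4 0 (entry 4 4 3 * entry 1 4 3)) (const 1) (const 0)

section Eval

variable {n : ℕ} {G : SimpleGraph (Fin n)} {v : ℕ → ℤ} {m : ℕ → ℤ → ℤ} {u w : Fin n} {t : ℕ}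

theorem eval_grad [DecidableRel G.Adj] (h0 : v 0 = n) (hu : v 2 = (u : ℕ)) (hw : v 3 = (w : ℕ))
    (hG : mat n m 0 = G.adjMatrix ℤ) (hW : mat n m 2 = fwIter G t) :
    grad.eval v m = gradMat G (fwIter G t) u w := by
  by_cases huw : u = w <;>
    simp [grad, h0, hu, hw, hG, hW, gradMat, mask, denom, shiftWeight, penWeight, huw,
      Fin.val_inj]

theorem eval_step (h0 : v 0 = n) (hu : v 2 = (u : ℕ)) (hw : v 3 = (w : ℕ))
    (hW : mat n m 2 = fwIter G t) (hB : mat n m 4 = gradMat G (fwIter G t) ^ numIter n) :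
    step.eval v m = fwIter G (t + 1) u w := by
  have htrace : (sum 4 0 (entry 4 4 4)).eval v m =
      (gradMat G (fwIter G t) ^ numIter n).trace := by
    rw [eval_sum_fin _ _ _ h0]
    simp [h0, hB, Matrix.trace]
  rw [fwIter, Function.iterate_succ_apply', ← fwIter]
  simp [step, htrace, h0, hu, hw, hW, hB, fwStep, denom, stepInv]

theorem eval_near (h0 : v 0 = n) (hu : v 2 = (u : ℕ)) (hw : v 3 = (w : ℕ))
    (hW : mat n m 2 = fwIter G (numIter n)) : near.eval v m = setMat (nearSet G) u w := by
  simp only [near, eval_cond, setMat, Matrix.of_apply, nearSet, Finset.mem_filter_univ]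
  exact if_congr (by simp [h0, hu, hw, hW, denom]) rfl rfl

theorem eval_cand [DecidableRel G.Adj] (h0 : v 0 = n) (hu : v 2 = (u : ℕ)) (hw : v 3 = (w : ℕ))
    (hG : mat n m 0 = G.adjMatrix ℤ) (hS : mat n m 3 = setMat (nearSet G)) :
    cand.eval v m = setMat (candSet G) u w := by
  have hsum : (sum 4 0 (entry 3 2 4 * entry 0 4 3)).eval v m =
      ∑ l, if G.Adj l w ∧ l ∈ nearSet G u then 1 else 0 := by
    rw [eval_sum_fin _ _ _ h0]
    simp [h0, hu, hw, hG, hS, setMat, ← ite_and]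
  have hmem : (∃ l, G.Adj l w ∧ l ∈ nearSet G u) ↔ w ∉ candSet G u := by
    simp [candSet, and_comm]
  simp only [cand, eval_cond, eval_const, hsum, sum_indicator_pos, hmem, ite_not, setMat,
    Matrix.of_apply]

theorem eval_out [DecidableRel G.Adj] (h0 : v 0 = n) (hu : v 2 = (u : ℕ)) (hw : v 3 = (w : ℕ))
    (hG : mat n m 0 = G.adjMatrix ℤ) (hS : mat n m 4 = setMat (candSet G)) :
    out.eval v m = setMat (outSet G) u w := by
  have hsum : (sum 4 0 (sum 5 0 (entry 4 2 4 * entry 4 2 5 * entry 0 4 5))).eval v m =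
      ∑ p : Fin n × Fin n,
        if G.Adj p.1 p.2 ∧ p.2 ∈ candSet G u ∧ p.1 ∈ candSet G u then 1 else 0 := by
    rw [eval_sum_fin _ _ _ h0, Fintype.sum_prod_type]
    refine Finset.sum_congr rfl fun l _ => ?_
    rw [eval_sum_fin (n := n) _ _ _ (by simp [h0])]
    simp [h0, hu, hG, hS, setMat, ← ite_and]
  have hindep : (∃ p : Fin n × Fin n, G.Adj p.1 p.2 ∧ p.2 ∈ candSet G u ∧ p.1 ∈ candSet G u) ↔
      ¬ G.IsIndepSet (candSet G u : Set (Fin n)) := by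
    simp only [SimpleGraph.isIndepSet_iff, Set.Pairwise]
    push Not
    exact ⟨fun ⟨p, h, hb, ha⟩ => ⟨p.1, ha, p.2, hb, h.ne, h⟩,
      fun ⟨a, ha, b, hb, _, h⟩ => ⟨(a, b), h, hb, ha⟩⟩
  simp only [out, eval_cond, hsum, sum_indicator_pos, hindep]
  by_cases h : G.IsIndepSet (candSet G u : Set (Fin n)) <;>
    simp [h, h0, hu, hw, hS, setMat, outSet]

theorem eval_outRank (h0 : v 0 = n) (hu : v 2 = (u : ℕ)) (hS : mat n m 1 = setMat (outSet G)) :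
    outRank.eval v m = rank G u := by
  have hsum : (sum 4 0 (entry 1 2 4)).eval v m = (outSet G u).card := by
    rw [eval_sum_fin _ _ _ h0]
    simp [h0, hu, hS, setMat]
  simp [outRank, hsum, h0, hu, rank]

theorem eval_top (h0 : v 0 = n) (hu : v 2 = (u : ℕ)) (hw : v 3 = (w : ℕ))
    (hR : mat n m 3 = .of fun u _ => rank G u) : top.eval v m = topMat G u w := by
  have hsum : (sum 4 0 (cond (entry 3 4 3 - entry 3 2 3) (const 1) (const 0))).eval v m =
      ∑ l, if rank G u < rank G l then 1 else 0 := by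
    rw [eval_sum_fin _ _ _ h0]
    simp [h0, hu, hw, hR]
  have htop : (∃ l, rank G u < rank G l) ↔ ¬ ∀ l, rank G l ≤ rank G u := by simp
  simp only [top, eval_cond, eval_const, hsum, sum_indicator_pos, htop, ite_not, topMat,
    Matrix.of_apply]

theorem eval_largest (h0 : v 0 = n) (hw : v 3 = (w : ℕ)) (hS : mat n m 1 = setMat (outSet G))
    (hT : mat n m 4 = topMat G) : largest.eval v m = setMat (fun _ => largestSet n G) u w := by
  have hsum : (sum 4 0 (entry 4 4 3 * entry 1 4 3)).eval v m =
      ∑ l, if w ∈ outSet G l ∧ ∀ k, rank G k ≤ rank G l then 1 else 0 := by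
    rw [eval_sum_fin _ _ _ h0]
    simp [h0, hw, hS, hT, setMat, topMat, ← ite_and]
  simp only [largest, eval_cond, eval_const, hsum, sum_indicator_pos, setMat, Matrix.of_apply,
    largestSet, Finset.mem_filter_univ, and_comm]

end Eval

end Expr

namespace Cmd

/-- The command that copies the matrix in array `b'` to array `b`. -/
def copy (b b' : ℕ) : Cmd := fill b (.entry b' 2 3)

/-- The command that replaces the matrix in array `4` by its product with that in array `3`. -/
def mulMat : Cmd := seq (fill 5 (.sum 4 0 (.entry 4 2 4 * .entry 3 4 3))) (copy 4 5)

/-- The command that puts a power of the matrix in array `3` into array `4`. -/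
def powMat : Cmd := seq (fill 4 (.delta 2 3)) (loop 7 1 mulMat)

/-- One step of the Frank-Wolfe method on the matrix in array `2`. -/
def stepMat : Cmd := seq (fill 3 .grad) (seq powMat (seq (fill 5 .step) (copy 2 5)))

/-- The Frank-Wolfe method. -/
def iterMat : Cmd := seq (fill 2 (.monom 4096 15 * .delta 2 3)) (loop 6 1 stepMat)

/-- The command that writes the computed sets into array `1`. -/
def listSets : Cmd := seq iterMat (seq (fill 3 .near) (seq (fill 4 .cand) (fill 1 .out)))

/-- The command that writes the largest computed set into array `1`. -/
def bestSet : Cmd :=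
  seq listSets (seq (fill 3 .outRank) (seq (fill 4 .top) (seq (fill 5 .largest) (copy 1 5))))

theorem below_listSets : listSets.Below 8 := by
  simp only [listSets, iterMat, stepMat, powMat, mulMat, copy, Below]
  refine ⟨⟨below_fill ?_ ?_, ?_, ?_, below_fill ?_ ?_, ⟨below_fill ?_ ?_, ?_, ?_,
    below_fill ?_ ?_, below_fill ?_ ?_⟩, below_fill ?_ ?_, below_fill ?_ ?_⟩, below_fill ?_ ?_,
    below_fill ?_ ?_, below_fill ?_ ?_⟩ <;>
    simp [Expr.grad, Expr.step, Expr.near, Expr.cand, Expr.out]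

theorem below_bestSet : bestSet.Below 8 := by
  refine ⟨below_listSets, below_fill ?_ ?_, below_fill ?_ ?_, below_fill ?_ ?_,
    below_fill ?_ ?_⟩ <;> simp [Expr.outRank, Expr.top, Expr.largest]

section Triple

variable {n L : ℕ} {v : ℕ → ℤ} {P : Assertion n} {M N : Matrix (Fin n) (Fin n) ℤ}

theorem triple_copy {b b' : ℕ} (h0 : v 0 = n) (hP : Ignores P b) (hM : ∀ A, P A → A b' = M)
    (hL : ∀ u w, |M u w| ≤ 2 ^ L) : Triple L v P (copy b b') fun A => P A ∧ A b = M :=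
  triple_fill h0 hP (fun m hm u w => by simp [h0, hM _ hm]) hL

theorem triple_mulMat (h0 : v 0 = n) (hP₄ : Ignores P 4) (hP₅ : Ignores P 5)
    (hM : ∀ A, P A → A 3 = M) (hL : ∀ u w, |(N * M) u w| ≤ 2 ^ L) :
    Triple L v (fun A => P A ∧ A 4 = N) mulMat fun A => P A ∧ A 4 = N * M := by
  have hfill := triple_fill (e := .sum 4 0 (.entry 4 2 4 * .entry 3 4 3)) h0
    (hP₅.and (ignores_apply (b' := 4) (M := N) (by decide))) (fun m hm u w => by
      rw [Expr.eval_sum_fin (n := n) _ _ _ (by simp [h0])]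
      simp [h0, hM _ hm.1, hm.2, Matrix.mul_apply]) hL
  exact (hfill.imp (fun _ => id) fun A hA => ⟨hA.1.1, hA.2⟩).seq <|
    (triple_copy h0 (hP₄.and (ignores_apply (by decide))) (fun A hA => hA.2) hL).imp
      (fun _ => id) fun A hA => ⟨hA.1.1, hA.2⟩

theorem triple_powMat {k : ℕ} (h0 : v 0 = n) (h1 : v 1 = k) (hP₄ : Ignores P 4) (hP₅ : Ignores P 5)
    (hM : ∀ A, P A → A 3 = M) (hL : ∀ j ≤ k, ∀ u w, |(M ^ j) u w| ≤ 2 ^ L) :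
    Triple L v P powMat fun A => P A ∧ A 4 = M ^ k := by
  have hone : Triple L v P (fill 4 (.delta 2 3)) fun A => P A ∧ A 4 = M ^ 0 :=
    triple_fill h0 hP₄ (fun m _ u w => by simp [Matrix.one_apply, Fin.val_inj])
      (hL 0 k.zero_le)
  exact hone.seq <| Triple.loop (I := fun j A => P A ∧ A 4 = M ^ j) h1 fun j hj => by
    rw [pow_succ]
    exact triple_mulMat (by simp [h0]) hP₄ hP₅ hM (pow_succ M j ▸ hL (j + 1) hj)

end Triple

section Algorithm

variable {n : ℕ} {G : SimpleGraph (Fin n)} [DecidableRel G.Adj] {v : ℕ → ℤ}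

theorem triple_stepMat (t : ℕ) (h0 : v 0 = n) (h1 : v 1 = numIter n) :
    Triple (wordLen n) v (fun A => A 0 = G.adjMatrix ℤ ∧ A 2 = fwIter G t) stepMat
      fun A => A 0 = G.adjMatrix ℤ ∧ A 2 = fwIter G (t + 1) := by
  have hgrad := triple_fill (b := 3) (e := .grad) h0
    ((ignores_apply (b' := 0) (M := G.adjMatrix ℤ) (by decide)).and
      (ignores_apply (b' := 2) (M := fwIter G t) (by decide)))
    (fun m hm u w => Expr.eval_grad (by simp [h0]) (by simp) (by simp) hm.1 hm.2)
    (abs_gradMat_fwIter_le_two_pow G t)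
  have hpow := triple_powMat (k := numIter n) h0 h1
    (((ignores_apply (b' := 0) (M := G.adjMatrix ℤ) (by decide)).and
      (ignores_apply (b' := 2) (M := fwIter G t) (by decide))).and
      (ignores_apply (b' := 3) (M := gradMat G (fwIter G t)) (by decide)))
    (((ignores_apply (by decide)).and (ignores_apply (by decide))).and (ignores_apply (by decide)))
    (fun A hA => hA.2) fun j hj => abs_gradMat_fwIter_pow_le_two_pow G t hj
  have hstep := triple_fill (b := 5) (e := .step) h0
    ((ignores_apply (b' := 0) (M := G.adjMatrix ℤ) (by decide)).and
      ((ignores_apply (b' := 2) (M := fwIter G t) (by decide)).and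
        (ignores_apply (b' := 4) (M := gradMat G (fwIter G t) ^ numIter n) (by decide))))
    (fun m hm u w => Expr.eval_step (by simp [h0]) (by simp) (by simp) hm.2.1 hm.2.2)
    (abs_fwIter_le_two_pow G (t + 1))
  have hcopy := triple_copy (b := 2) h0
    ((ignores_apply (b' := 0) (M := G.adjMatrix ℤ) (by decide)).and
      (ignores_apply (b' := 5) (M := fwIter G (t + 1)) (by decide)))
    (fun A hA => hA.2) (abs_fwIter_le_two_pow G (t + 1))
  exact hgrad.seq <| hpow.seq <|
    (hstep.imp (fun A hA => ⟨hA.1.1.1, hA.1.1.2, hA.2⟩) fun A hA => ⟨hA.1.1, hA.2⟩).seq <|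
      hcopy.imp (fun _ => id) fun A hA => ⟨hA.1.1, hA.2⟩

theorem triple_iterMat (h0 : v 0 = n) (h1 : v 1 = numIter n) :
    Triple (wordLen n) v (fun A => A 0 = G.adjMatrix ℤ) iterMat
      fun A => A 0 = G.adjMatrix ℤ ∧ A 2 = fwIter G (numIter n) := by
  have hinit := triple_fill (b := 2) (e := .monom 4096 15 * .delta 2 3) (M := fwIter G 0) h0
    (ignores_apply (b' := 0) (M := G.adjMatrix ℤ) (by decide))
    (fun m _ u w => by simp [fwIter_zero_apply, h0, Fin.val_inj, denom])
    (abs_fwIter_le_two_pow G 0)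
  exact hinit.seq <| Triple.loop (I := fun t A => A 0 = G.adjMatrix ℤ ∧ A 2 = fwIter G t) h1
    fun t _ => triple_stepMat t (by simp [h0]) (by simp [h1])

theorem triple_listSets (h0 : v 0 = n) (h1 : v 1 = numIter n) :
    Triple (wordLen n) v (fun A => A 0 = G.adjMatrix ℤ) listSets
      fun A => A 1 = setMat (outSet G) := by
  have hnear := triple_fill (L := wordLen n) (b := 3) (e := .near) (M := setMat (nearSet G)) h0
    ((ignores_apply (b' := 0) (M := G.adjMatrix ℤ) (by decide)).and
      (ignores_apply (b' := 2) (M := fwIter G (numIter n)) (by decide)))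
    (fun m hm u w => Expr.eval_near (by simp [h0]) (by simp) (by simp) hm.2)
    (abs_setMat_le_two_pow _)
  have hcand := triple_fill (L := wordLen n) (b := 4) (e := .cand) (M := setMat (candSet G)) h0
    ((ignores_apply (b' := 0) (M := G.adjMatrix ℤ) (by decide)).and
      (ignores_apply (b' := 3) (M := setMat (nearSet G)) (by decide)))
    (fun m hm u w => Expr.eval_cand (by simp [h0]) (by simp) (by simp) hm.1 hm.2)
    (abs_setMat_le_two_pow _)
  have hout := triple_fill (L := wordLen n) (b := 1) (e := .out) (M := setMat (outSet G)) h0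
    ((ignores_apply (b' := 0) (M := G.adjMatrix ℤ) (by decide)).and
      (ignores_apply (b' := 4) (M := setMat (candSet G)) (by decide)))
    (fun m hm u w => Expr.eval_out (by simp [h0]) (by simp) (by simp) hm.1 hm.2)
    (abs_setMat_le_two_pow _)
  exact (triple_iterMat h0 h1).seq <|
    (hnear.imp (fun _ => id) fun A hA => ⟨hA.1.1, hA.2⟩).seq <|
      (hcand.imp (fun _ => id) fun A hA => ⟨hA.1.1, hA.2⟩).seq <|
        hout.imp (fun _ => id) fun A hA => hA.2

theorem triple_bestSet (h0 : v 0 = n) (h1 : v 1 = numIter n) :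
    Triple (wordLen n) v (fun A => A 0 = G.adjMatrix ℤ) bestSet
      fun A => A 1 = setMat fun _ => largestSet n G := by
  have hrank := triple_fill (b := 3) (e := .outRank) (M := .of fun u _ => rank G u) h0
    (ignores_apply (b' := 1) (M := setMat (outSet G)) (by decide))
    (fun m hm u w => Expr.eval_outRank (by simp [h0]) (by simp) hm)
    (fun u _ => abs_rank_le_two_pow G u)
  have htop := triple_fill (L := wordLen n) (b := 4) (e := .top) (M := topMat G) h0
    ((ignores_apply (b' := 1) (M := setMat (outSet G)) (by decide)).and
      (ignores_apply (b' := 3) (M := .of fun u _ => rank G u) (by decide)))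
    (fun m hm u w => Expr.eval_top (by simp [h0]) (by simp) (by simp) hm.2)
    (fun _ _ => abs_indicator_le_two_pow _)
  have hlargest := triple_fill (L := wordLen n) (b := 5) (e := .largest)
    (M := setMat fun _ => largestSet n G) h0
    ((ignores_apply (b' := 1) (M := setMat (outSet G)) (by decide)).and
      (ignores_apply (b' := 4) (M := topMat G) (by decide)))
    (fun m hm u w => Expr.eval_largest (by simp [h0]) (by simp) hm.1 hm.2)
    (abs_setMat_le_two_pow _)
  have hcopy := triple_copy (L := wordLen n) (b := 1) h0
    (ignores_apply (b' := 5) (M := setMat fun _ => largestSet n G) (by decide))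
    (fun A hA => hA) (abs_setMat_le_two_pow _)
  exact (triple_listSets h0 h1).seq <| hrank.seq <|
    (htop.imp (fun _ => id) fun A hA => ⟨hA.1.1, hA.2⟩).seq <|
      (hlargest.imp (fun _ => id) fun A hA => hA.2).seq <|
        hcopy.imp (fun _ => id) fun A hA => hA.2

end Algorithm

end Cmd

/-! ### Running time -/

section InputState

variable {n : ℕ} (G : SimpleGraph (Fin n))

theorem fits_inputState : Fits 8 (loopBound n) (wordLen n) (inputState G).reg (inputState G).mem :=
  have hreg (r : ℕ) : 0 ≤ (inputState G).reg r ∧ (inputState G).reg r ≤ loopBound n := by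
    simp only [inputState, loopBound]
    split_ifs <;> omega
  { nonneg := fun r _ => (hreg r).1
    le := fun r _ => (hreg r).2
    abs_mem_le := fun _ _ => by classical exact abs_indicator_le_two_pow _ }

open Classical in
theorem mat_inputState : mat n (inputState G).mem 0 = G.adjMatrix ℤ := by
  ext u v
  simp only [mat, Matrix.of_apply, inputState, SimpleGraph.adjMatrix_apply, true_and]
  refine if_congr ⟨?_, fun h => ⟨u, v, rfl, h⟩⟩ rfl rfl
  rintro ⟨u', v', h, hadj⟩
  obtain ⟨rfl, rfl⟩ := mul_add_inj.1 h
  exact hadj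

end InputState

theorem one_le_wordLen (n : ℕ) : 1 ≤ wordLen n := by unfold wordLen; omega

theorem loopBound_le_two_pow (n : ℕ) : loopBound n ≤ 2 ^ wordLen n := by
  exact_mod_cast natCast_le_two_pow (show loopBound n ≤ wordLen n by unfold wordLen; omega)

/-- The program computing `numIter n` in register `1`; it uses the registers from `8` on. -/
def initProg : Prog := .seq ((Expr.monom 1024 11).code 8) (.arith .add 1 8 1)

theorem haltsWithin_initProg {n : ℕ} (G : SimpleGraph (Fin n)) :
    ∃ s, initProg.HaltsWithin (inputState G) s
        ((Expr.monom 1024 11).time (loopBound n) (wordLen n) + (wordLen n + 2)) ∧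
      s.reg 0 = n ∧ s.reg 1 = numIter n ∧ s.mem = (inputState G).mem ∧
      Fits 8 (loopBound n) (wordLen n) s.reg s.mem := by
  have hfits := fits_inputState G
  obtain ⟨s, hcode, hmem, hreg, hval⟩ := (Expr.monom 1024 11).compiles (one_le_wordLen n)
    (loopBound_le_two_pow n) (Expr.below_monom _ _ (by norm_num)) le_rfl hfits
  have h0 : s.reg 0 = n := by simp [hreg (show 0 ∈ Set.Iio 8 by simp), inputState]
  have h1 : s.reg 1 = 0 := by simp [hreg (show 1 ∈ Set.Iio 8 by simp), inputState]
  have h8 : s.reg 8 = numIter n := by simp [hval, inputState, numIter]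
  have hbits : bits (s.reg 8) ≤ wordLen n + 1 := bits_le_of_abs_le_two_pow <| by
    rw [h8, Nat.abs_cast]
    exact natCast_le_two_pow (by unfold wordLen loopBound; omega)
  have hadd := Prog.HaltsWithin.arith .add 1 hbits (show bits (s.reg 1) ≤ 0 by simp [h1])
  refine ⟨_, (hcode.seq hadd).mono (by omega), by simpa using h0, by simp [Op.eval, h1, h8],
    by simpa using hmem, ?_⟩
  have hreg' (r : ℕ) (hr : r < 8) : 0 ≤ (s.setReg 1 (Op.add.eval (s.reg 8) (s.reg 1))).reg r ∧
      (s.setReg 1 (Op.add.eval (s.reg 8) (s.reg 1))).reg r ≤ loopBound n := by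
    obtain rfl | hr1 := eq_or_ne r 1
    · simp [Op.eval, h1, h8, loopBound]
    · simpa [hr1, hreg hr] using ⟨hfits.nonneg r hr, hfits.le r hr⟩
  exact ⟨fun r hr => (hreg' r hr).1, fun r hr => (hreg' r hr).2, by
    simpa [hmem] using hfits.abs_mem_le⟩

open Classical in
theorem Cmd.exists_polyTime {c : Cmd} (hc : c.Below 8)
    {F : (n : ℕ) → SimpleGraph (Fin n) → Matrix (Fin n) (Fin n) ℤ}
    (h : ∀ (n : ℕ) (G : SimpleGraph (Fin n)) (v : ℕ → ℤ), v 0 = n → v 1 = numIter n →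
      Triple (wordLen n) v (fun A => A 0 = G.adjMatrix ℤ) c fun A => A 1 = F n G) :
    ∃ (p : Prog) (q : Polynomial ℕ), ∀ (n : ℕ) (G : SimpleGraph (Fin n)),
      ∃ s, p.HaltsWithin (inputState G) s (q.eval n) ∧ s.reg 0 = n ∧ mat n s.mem 1 = F n G := by
  obtain ⟨q, hq⟩ := ((PolyBounded.exprTime (.monom 1024 11) polyBounded_loopBound
    polyBounded_wordLen).add (polyBounded_wordLen.add (.const 2))).add
      (PolyBounded.cmdTime c polyBounded_loopBound polyBounded_wordLen)
  refine ⟨.seq initProg (c.code 8), q, fun n G => ?_⟩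
  obtain ⟨s, hinit, h0, h1, hmem, hfits⟩ := haltsWithin_initProg G
  obtain ⟨hsafe, hF⟩ := h n G s.reg h0 h1 s.mem (hmem ▸ mat_inputState G)
  obtain ⟨s', hcode, hmem', hreg'⟩ :=
    c.compiles (one_le_wordLen n) (loopBound_le_two_pow n) hc le_rfl hfits hsafe
  exact ⟨s', (hinit.seq hcode).mono (hq n), (hreg' (by simp)).trans h0, by rw [hmem', hF]⟩

theorem polyTimeComputable_outList : PolyTimeComputable outList := by
  classical
  obtain ⟨p, q, h⟩ := Cmd.exists_polyTime Cmd.below_listSets fun n G _ => Cmd.triple_listSets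
  refine ⟨p, q, fun n G => ?_⟩
  obtain ⟨s, ⟨t, ht, hexec⟩, h0, hmat⟩ := h n G
  refine ⟨s, t, hexec, ht, by simp [h0, outList], fun i w => ?_⟩
  have hi : (i : ℕ) < n := by simpa [outList] using i.isLt
  have hget : (outList n G)[(i : ℕ)] = outSet G ⟨i, hi⟩ := by
    simp only [outList, List.getElem_map, List.getElem_finRange]
    rfl
  simpa [hget, mat, setMat] using congr_fun₂ hmat ⟨i, hi⟩ w

theorem polyTimeComputable_largestSet : PolyTimeComputable fun n G => [largestSet n G] := by
  classical
  obtain ⟨p, q, h⟩ := Cmd.exists_polyTime Cmd.below_bestSet fun n G _ => Cmd.triple_bestSet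
  refine ⟨.seq p (.const 0 1), q + 2, fun n G => ?_⟩
  obtain ⟨s, hp, -, hmat⟩ := h n G
  obtain ⟨t, ht, hexec⟩ := hp.seq (.const 0 1 s)
  refine ⟨_, t, hexec, by simpa using ht, by simp, fun i w => ?_⟩
  obtain rfl : i = ⟨0, by simp⟩ := Fin.ext (by simp)
  simpa [mat, setMat] using congr_fun₂ hmat ⟨0, w.pos⟩ w

/-! ### Success probability -/

/-- A bound for the probability that the algorithms fail: `exp (-n)` for the spectral bound, and
`6000 / n` for the degrees into `S`. -/
noncomputable def failureBound (n : ℕ) : ℝ := Real.exp (-n) + 6000 / n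

theorem tendsto_failureBound : Filter.Tendsto failureBound Filter.atTop (nhds 0) := by
  have hexp : Filter.Tendsto (fun n : ℕ => Real.exp (-n)) Filter.atTop (nhds 0) :=
    Real.tendsto_exp_neg_atTop_nhds_zero.comp tendsto_natCast_atTop_atTop
  exact add_zero (0 : ℝ) ▸ hexp.add (tendsto_const_div_atTop_nhds_zero_nat 6000)

theorem one_sub_pow_le_exp_neg_mul {a : ℝ} (ha : a ≤ 1) (k : ℕ) :
    (1 - a) ^ k ≤ Real.exp (-(k * a)) := by
  calc (1 - a) ^ k ≤ Real.exp (-a) ^ k :=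
        pow_le_pow_left₀ (sub_nonneg.2 ha) (Real.one_sub_le_exp_neg a) k
    _ = Real.exp (-(k * a)) := by rw [← Real.exp_nat_mul, mul_neg]

theorem pow_mul_exp_neg_le_factorial {x : ℝ} (hx : 0 ≤ x) (m : ℕ) :
    x ^ m * Real.exp (-x) ≤ m.factorial := by
  rw [Real.exp_neg, ← div_eq_mul_inv, div_le_iff₀ (Real.exp_pos x), ← div_le_iff₀' (by positivity)]
  exact Real.pow_div_factorial_le_exp x hx m

theorem sq_le_pow_three_of_rpow_le {x y : ℝ} (hx : 0 ≤ x) (h : x ^ (2 / 3 : ℝ) ≤ y) :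
    x ^ 2 ≤ y ^ 3 := by
  calc x ^ 2 = (x ^ (2 / 3 : ℝ)) ^ 3 := by
        rw [← Real.rpow_natCast, ← Real.rpow_natCast, ← Real.rpow_mul hx]
        norm_num
    _ ≤ y ^ 3 := pow_le_pow_left₀ (by positivity) h 3

theorem mul_pow_le_div {n k : ℕ} (hn : 0 < n) (hk : (n : ℝ) ^ (2 / 3 : ℝ) ≤ k) :
    n * (9 / 10 : ℝ) ^ k ≤ 6000 / n := by
  have hpow : (9 / 10 : ℝ) ^ k ≤ Real.exp (-(k / 10)) := by
    have := one_sub_pow_le_exp_neg_mul (a := 1 / 10) (by norm_num) k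
    norm_num at this
    simpa [div_eq_mul_inv] using this
  have hfact := pow_mul_exp_neg_le_factorial (x := (k : ℝ) / 10) (by positivity) 3
  rw [le_div_iff₀ (by positivity)]
  calc n * (9 / 10 : ℝ) ^ k * n = (n : ℝ) ^ 2 * (9 / 10) ^ k := by ring
    _ ≤ (k : ℝ) ^ 3 * Real.exp (-(k / 10)) := by
        gcongr
        exact sq_le_pow_three_of_rpow_le (by positivity) hk
    _ = 1000 * ((k / 10 : ℝ) ^ 3 * Real.exp (-(k / 10))) := by ring
    _ ≤ 6000 := by
        norm_num [Nat.factorial] at hfact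
        linarith

theorem one_sub_failureBound_le {n : ℕ} {S : Finset (Fin n)}
    (hk : (10 : ℝ) ^ 4 * (n : ℝ) ^ (2 / 3 : ℝ) ≤ S.card) :
    1 - failureBound n ≤ (boundaryLaw S).real {E | ∀ G : SimpleGraph (Fin n), Admissible S E G →
      S ∈ outList n G ∧ S.card ≤ (largestSet n G).card ∧
        ∀ x, IsOptimal G x → ∀ l : List (Fin n), (∀ v, v ∈ l) → S ∈ candidates G l x} := by
  obtain rfl | hn := n.eq_zero_or_pos
  · simp [failureBound]
  have hcard : (n : ℝ) ^ (2 / 3 : ℝ) ≤ S.card :=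
    (le_mul_of_one_le_left (by positivity) (by norm_num)).trans hk
  calc 1 - failureBound n ≤ 1 - (Real.exp (-n) + n * (9 / 10) ^ S.card) :=
        sub_le_sub_left (add_le_add_right (mul_pow_le_div hn hcard) _) _
    _ ≤ (boundaryLaw S).real {E | GoodEdges S E} := one_sub_le_boundaryLaw_real_goodEdges S
    _ ≤ _ := by
        refine MeasureTheory.measureReal_mono fun E hE G hG => ?_
        obtain ⟨u, hu⟩ := exists_outSet_eq hn hk hE hG
        obtain ⟨w, hw, hmax⟩ := exists_largestSet_eq G hn
        exact ⟨List.mem_map.2 ⟨u, List.mem_finRange u, hu⟩, hw ▸ hu ▸ hmax u,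
          fun x hx l hl => mem_candidates hn hk hE hG hx hl⟩

end PlantedIndepSet

theorem theorem1 :
    -- the crude semidefinite program always has an optimal solution
    (∀ (n : ℕ) (G : SimpleGraph (Fin n)), ∃ x, PlantedIndepSet.IsOptimal G x) ∧
    ∃ (c₁ : ℝ) (list : (n : ℕ) → SimpleGraph (Fin n) → List (Finset (Fin n)))
      (single : (n : ℕ) → SimpleGraph (Fin n) → Finset (Fin n)) (δ : ℕ → ℝ),
      0 < c₁ ∧
      Filter.Tendsto δ Filter.atTop (nhds 0) ∧
      -- two deterministic polynomial-time algorithms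
      PlantedIndepSet.PolyTimeComputable list ∧
      PlantedIndepSet.PolyTimeComputable (fun n G => [single n G]) ∧
      -- on every graph the first one lists at most `n` independent sets,
      -- and the second one returns an independent set
      (∀ (n : ℕ) (G : SimpleGraph (Fin n)),
        (list n G).length ≤ n ∧
        (∀ T ∈ list n G, G.IsIndepSet (T : Set (Fin n))) ∧
        G.IsIndepSet (single n G : Set (Fin n))) ∧
      -- with high probability over the random edges, whatever the adversary does
      ∀ (n k : ℕ) (S : Finset (Fin n)), S.card = k → c₁ * (n : ℝ) ^ (2 / 3 : ℝ) ≤ (k : ℝ) →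
        1 - δ n ≤ (PlantedIndepSet.boundaryLaw S).real
          {E | ∀ G : SimpleGraph (Fin n), PlantedIndepSet.Admissible S E G →
            S ∈ list n G ∧
            k ≤ (single n G).card ∧
            -- `S` is a candidate for every optimal solution, in every order of the greedy step
            ∀ x, PlantedIndepSet.IsOptimal G x → ∀ l : List (Fin n), (∀ v, v ∈ l) →
              S ∈ PlantedIndepSet.candidates G l x} := by
  refine ⟨fun _ => PlantedIndepSet.exists_isOptimal, 10 ^ 4, PlantedIndepSet.outList,
    PlantedIndepSet.largestSet, PlantedIndepSet.failureBound, by norm_num,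
    PlantedIndepSet.tendsto_failureBound, PlantedIndepSet.polyTimeComputable_outList,
    PlantedIndepSet.polyTimeComputable_largestSet,
    fun n G => ⟨?_, fun T hT => ?_, PlantedIndepSet.isIndepSet_largestSet G⟩, fun n k S hS hk => ?_⟩
  · simp [PlantedIndepSet.outList]
  · obtain ⟨u, -, rfl⟩ := List.mem_map.1 hT
    exact PlantedIndepSet.isIndepSet_outSet G u
  · subst hS
    exact PlantedIndepSet.one_sub_failureBound_le hk
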